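/- Let $T=(V,E)$ be a finite tree, each vertex $v$ of which is a party with target space $\mathcal H_t^v=\mathbb C^{d_v}$, and let $|\psi\rangle\in\bigotimes_{v\in V}\mathcal H_t^v$ be a unit vector, $\psi=|\psi\rangle\langle\psi|$. For positive integers $(m_e)_{e\in E}$ let $|\Phi_{\mathrm{res}}\rangle=\bigotimes_{e\in E}|\Phi^+_{m_e}\rangle$ be the resource state in which the two ends of each edge $e$ share the maximally entangled state $|\Phi^+_{m_e}\rangle=m_e^{-1/2}\sum_{l=0}^{m_e-1}|l\rangle\otimes|l\rangle$. For an integer $n\ge 1$ and $\epsilon>0$, call $(m_e)_{e\in E}$ *achievable* if some LOCC operation $\Gamma$ (finitely many rounds of local operations by the parties $v\in V$, with local auxiliary systems of arbitrary finite dimension, and classical communication of the outcomes to all parties) satisfies $\|\Gamma(|\Phi_{\mathrm{res}}\rangle\langle\Phi_{\mathrm{res}}|)-\psi^{\otimes n}\|_1\le\epsilon$, and call it an *optimal configuration* for $(n,\epsilon)$ if it minimizes $\sum_{e\in E}\log_2 m_e$ among all achievable ones. Fix any root of $T$; for $e\in E$ let $\rho_e$ be the reduced state of $\psi$ on the parties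 on the side of $e$ not containing the root (the lower end of $e$ and its descendants), and let $S(\rho)=-\operatorname{tr}\rho\log_2\rho$. Then for all $n\ge1$ and $\epsilon>0$ an optimal configuration exists; and for every choice of optimal configurations $(m_e(n,\epsilon))_{e\in E}$, one for each $n\ge 1$ and $\epsilon>0$, and every $e\in E$, $$\lim_{\epsilon\to0^+}\ \lim_{n\to\infty}\ \frac1n\log_2 m_e(n,\epsilon)=S(\rho_e),$$ where the inner limit exists for all sufficiently small $\epsilon>0$. In particular the asymptotic edge costs do not depend on which optimal configurations are chosen, i.e. the asymptotic optimal configuration is uniquely determined. -/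

import Mathlib

open Filter Topology

noncomputable section

namespace TreeCost

/-! ### Matrices and states -/

/-- The rank-one operator `|φ⟩⟨φ|`. -/
def pureDensity {ι : Type} (φ : ι → ℂ) : Matrix ι ι ℂ :=
  Matrix.vecMulVec φ (star φ)

/-- The trace norm `‖A‖₁ = tr √(A† A)`, the sum of the singular values of `A`. -/
def traceNorm {ι : Type} [Fintype ι] [DecidableEq ι] (A : Matrix ι ι ℂ) : ℝ :=
  ∑ i, Real.sqrt ((Matrix.isHermitian_conjTranspose_mul_self A).eigenvalues i)

/-- The von Neumann entropy `S(ρ) = - tr (ρ log₂ ρ)` of a Hermitian matrix,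
with the convention `0 log₂ 0 = 0`. -/
def vonNeumannEntropy {ι : Type} [Fintype ι] [DecidableEq ι] (ρ : Matrix ι ι ℂ)
    (hρ : ρ.IsHermitian) : ℝ :=
  -∑ i, hρ.eigenvalues i * Real.logb 2 (hρ.eigenvalues i)

variable {V : Type} [Fintype V] [DecidableEq V]

/-- Tracing out the systems of all parties outside `S`: the partial trace of an operator on
`⨂ v, ℂ^(ι v)`, as an operator on `⨂ v ∈ S, ℂ^(ι v)`. -/
def partialTrace {ι : V → Type} [∀ v, Fintype (ι v)] (S : Finset V)
    (ρ : Matrix (∀ v, ι v) (∀ v, ι v) ℂ) :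
    Matrix (∀ v : {v // v ∈ S}, ι v) (∀ v : {v // v ∈ S}, ι v) ℂ :=
  Matrix.of fun x x' => ∑ y : (∀ v : {v // ¬ v ∈ S}, ι v),
    ρ ((Equiv.piEquivPiSubtypeProd (fun v => v ∈ S) ι).symm (x, y))
      ((Equiv.piEquivPiSubtypeProd (fun v => v ∈ S) ι).symm (x', y))

theorem partialTrace_isHermitian {ι : V → Type} [∀ v, Fintype (ι v)] (S : Finset V)
    {ρ : Matrix (∀ v, ι v) (∀ v, ι v) ℂ} (hρ : ρ.IsHermitian) :
    (partialTrace S ρ).IsHermitian := by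
  ext x x'
  simp only [partialTrace, Matrix.conjTranspose_apply, Matrix.of_apply, star_sum]
  exact Finset.sum_congr rfl fun y _ => hρ.apply _ _

theorem pureDensity_isHermitian {ι : Type} (φ : ι → ℂ) : (pureDensity φ).IsHermitian := by
  ext x x'
  simp [pureDensity, Matrix.vecMulVec_apply, mul_comm]

/-- The vector `|ψ⟩^{⊗ n}`, where party `v` holds its `n` systems together, so that its local
space is `(ℂ^(d v))^{⊗ n}` with basis `Fin n → Fin (d v)`. -/
def copies {d : V → ℕ} (ψ : EuclideanSpace ℂ (∀ v, Fin (d v))) (n : ℕ) :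
    (∀ v, Fin n → Fin (d v)) → ℂ :=
  fun x => ∏ k : Fin n, ψ (fun v => x v k)

/-! ### LOCC -/

/-- The product operator `⨂ v, A v`. -/
def localOp {ι κ : V → Type} (A : ∀ v, Matrix (κ v) (ι v) ℂ) :
    Matrix (∀ v, κ v) (∀ v, ι v) ℂ :=
  Matrix.of fun y x => ∏ v, A v (y v) (x v)

/-- `A j`, for `j` in a finite set of outcomes, are the measurement (Kraus) operators of a complete
local measurement, `∑ j, A j† A j = 1`.  The output space may differ from the input space,
so auxiliary systems may be added and systems may be discarded. -/
def IsMeasurement {ι κ J : Type} [Fintype ι] [DecidableEq ι] [Fintype κ] [Fintype J]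
    (A : J → Matrix κ ι ℂ) : Prop :=
  ∑ j, (A j).conjTranspose * A j = 1

/-- LOCC operations with `r` rounds of classical communication, from operators on
`⨂ v, ℂ^(ι v)` to operators on `⨂ v, ℂ^(κ v)`.
Without communication, each party applies a local channel (a local measurement whose outcome is
forgotten).  With `r + 1` rounds, each party `v` performs a local measurement, whose output system
has an arbitrary finite dimension `k v`, the tuple `j` of all outcomes is announced to all parties,
and the parties go on with an LOCC operation of `r` rounds which may depend on `j`.
(A round in which a single party measures is the case where all others apply the identity.) -/
def IsLOCCRounds : ℕ → ∀ (ι κ : V → Type) [∀ v, Fintype (ι v)] [∀ v, DecidableEq (ι v)]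
    [∀ v, Fintype (κ v)],
    (Matrix (∀ v, ι v) (∀ v, ι v) ℂ → Matrix (∀ v, κ v) (∀ v, κ v) ℂ) → Prop
  | 0, ι, κ, _, _, _, Γ =>
      ∃ (J : V → ℕ) (A : ∀ v, Fin (J v) → Matrix (κ v) (ι v) ℂ),
        (∀ v, IsMeasurement (A v)) ∧
        ∀ ρ, Γ ρ = ∑ j : (∀ v, Fin (J v)),
          localOp (fun v => A v (j v)) * ρ * (localOp (fun v => A v (j v))).conjTranspose
  | r + 1, ι, κ, _, _, _, Γ =>
      ∃ (J k : V → ℕ) (A : ∀ v, Fin (J v) → Matrix (Fin (k v)) (ι v) ℂ)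
        (Λ : (∀ v, Fin (J v)) → Matrix (∀ v, Fin (k v)) (∀ v, Fin (k v)) ℂ →
          Matrix (∀ v, κ v) (∀ v, κ v) ℂ),
        (∀ v, IsMeasurement (A v)) ∧
        (∀ j, IsLOCCRounds r (fun v => Fin (k v)) κ (Λ j)) ∧
        ∀ ρ, Γ ρ = ∑ j : (∀ v, Fin (J v)),
          Λ j (localOp (fun v => A v (j v)) * ρ * (localOp (fun v => A v (j v))).conjTranspose)

/-- LOCC operations: those with some finite number of rounds of communication. -/
def IsLOCC {ι κ : V → Type} [∀ v, Fintype (ι v)] [∀ v, DecidableEq (ι v)] [∀ v, Fintype (κ v)]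
    (Γ : Matrix (∀ v, ι v) (∀ v, ι v) ℂ → Matrix (∀ v, κ v) (∀ v, κ v) ℂ) : Prop :=
  ∃ r, IsLOCCRounds r ι κ Γ

/-! ### Resource states on a graph -/

variable (T : SimpleGraph V)

/-- Basis of the part of the resource that party `v` holds: one `m e`-level system
for each edge `e` incident to `v`. -/
abbrev ResourceIndex (m : T.edgeSet → ℕ) (v : V) : Type :=
  ∀ e : {e : T.edgeSet // v ∈ e.1}, Fin (m e.1)

/-- The resource state `⨂ e, |Φ⁺_{m e}⟩`, with `|Φ⁺_m⟩ = m^(-1/2) ∑ l, |l⟩ ⊗ |l⟩` shared by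
the two ends of the edge: the factor of `e` is `m^(-1/2)` if the two ends of `e` are in the same
basis state, and `0` otherwise. -/
def resourceVec [DecidableRel T.Adj] (m : T.edgeSet → ℕ) : (∀ v, ResourceIndex T m v) → ℂ :=
  open Classical in
  fun x => ∏ e : T.edgeSet,
    if ∀ (v v' : V) (h : v ∈ e.1) (h' : v' ∈ e.1), x v ⟨e, h⟩ = x v' ⟨e, h'⟩
    then (((Real.sqrt (m e))⁻¹ : ℝ) : ℂ) else 0

variable {d : V → ℕ}

/-- The dimensions `m` (one for each edge) for which the `(n, ε)`-approximate state construction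
task under `T` for the target state `ψ` is achievable. -/
def achievable [DecidableRel T.Adj] (ψ : EuclideanSpace ℂ (∀ v, Fin (d v))) (n : ℕ) (ε : ℝ) :
    Set (T.edgeSet → ℕ) :=
  {m | (∀ e, 1 ≤ m e) ∧
    ∃ Γ : Matrix (∀ v, ResourceIndex T m v) (∀ v, ResourceIndex T m v) ℂ →
        Matrix (∀ v, Fin n → Fin (d v)) (∀ v, Fin n → Fin (d v)) ℂ,
      IsLOCC Γ ∧
      traceNorm (Γ (pureDensity (resourceVec T m)) - pureDensity (copies ψ n)) ≤ ε}

/-- The total amount of entanglement (in ebits) of a resource state. -/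
def totalEntanglement [DecidableRel T.Adj] (m : T.edgeSet → ℕ) : ℝ :=
  ∑ e, Real.logb 2 (m e)

/-- The dimensions `m` of an optimal resource state for the `(n, ε)`-approximate task:
one that minimizes the total entanglement among those which achieve the task. -/
def IsOptimalConfig [DecidableRel T.Adj] (ψ : EuclideanSpace ℂ (∀ v, Fin (d v))) (n : ℕ) (ε : ℝ)
    (m : T.edgeSet → ℕ) : Prop :=
  m ∈ achievable T ψ n ε ∧
    ∀ m' ∈ achievable T ψ n ε, totalEntanglement T m ≤ totalEntanglement T m'

/-! ### Reduced states across edges of a rooted tree -/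

/-- The side of the edge `e` that does not contain the root `r`: for `e = {p(v), v}` in a tree
rooted at `r`, this is the set of `v` and its descendants. -/
def lowerSide (r : V) (e : T.edgeSet) : Finset V :=
  open Classical in
  Finset.univ.filter fun w => ¬ (T.deleteEdges {e.1}).Reachable r w

/-- The reduced state `ρ_e` of `ψ` with respect to the edge `e` of the tree rooted at `r`. -/
def edgeState (r : V) (ψ : EuclideanSpace ℂ (∀ v, Fin (d v))) (e : T.edgeSet) :
    Matrix (∀ v : {v // v ∈ lowerSide T r e}, Fin (d v))
      (∀ v : {v // v ∈ lowerSide T r e}, Fin (d v)) ℂ :=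
  partialTrace (ι := fun v => Fin (d v)) (lowerSide T r e) (pureDensity ψ)

theorem edgeState_isHermitian (r : V) (ψ : EuclideanSpace ℂ (∀ v, Fin (d v))) (e : T.edgeSet) :
    (edgeState T r ψ e).IsHermitian :=
  partialTrace_isHermitian _ (pureDensity_isHermitian _)

end TreeCost

/-- `lim_{ε → 0+} lim_{n → ∞} f n ε` exists and is equal to `a`; the inner limit is required to
exist for all sufficiently small `ε > 0`. -/
def TreeCost.HasIteratedLimit (f : ℕ → ℝ → ℝ) (a : ℝ) : Prop :=
  ∃ L : ℝ → ℝ, (∀ᶠ ε in 𝓝[>] 0, Tendsto (fun n => f n ε) atTop (𝓝 (L ε))) ∧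
    Tendsto L (𝓝[>] 0) (𝓝 a)

end

noncomputable section

namespace TreeCost

open scoped BigOperators ComplexConjugate

set_option linter.unusedSectionVars false

/-! ### Averages over product spaces -/

section Average

variable {V : Type*} {κ : V → Type*}

/-! Two one-shot estimates carry the proof: across every edge `e`, and for large `n`, any achievable
configuration has `m e ≥ 2 ^ (n (S(ρ_e) - δ))`, and some achievable configuration satisfies `m e ≤ 2
^ (n (S(ρ_e) + δ))` on all edges at once. The first bounds each edge of an optimal configuration
from below. The second bounds only the sum of its logarithms from above, but a sum of nonnegative
excesses that is `O(nδ)` has each excess `O(nδ)`. Hence every edge of every optimal configuration is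
pinned down, and the inner limit is already `S(ρ_e)` for each `ε` in `(0, 1)`.

Lower bound (`one_sub_le_of_mem_achievable`, `eventually_forall_mem_achievable_le`): an LOCC
operation has product Kraus operators, and these do not increase the Schmidt rank across the cut of
`e`, which is at most `m e` for the resource. By `HasSchmidtDecomp.norm_ip_sq_le`, a state of
Schmidt rank `M` has squared overlap at most `tail + τ M` with a state whose squared Schmidt
coefficients are at most `τ` apart from that tail. For `ψ^{⊗ n}` these are products of eigenvalues
of `ρ_e`, and typicality gives `τ ≈ 2 ^ (-n S(ρ_e))`.

Upper bound (`eventually_exists_mem_achievable`): truncate `ψ^{⊗ n}` to its typical Schmidt vectors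
across every edge. The lower sides of the edges form a laminar family, so projecting on the larger
sides first keeps all the ranks obtained so far (`exists_schmidtRankLE_approx`). The truncated,
normalized state is then prepared exactly from a resource whose dimensions are its Schmidt ranks
(`exists_isLOCC_pureDensity`). Orthonormal bases of the slice spaces write the state as a
contraction of one tensor per vertex, each of which is an isometry, up to a constant, from the leg
above the vertex to its own system and the legs below (`treeTensor_isometry`). Starting from the
root, each party corrects the leg above, applies its isometry and teleports the legs below.

Vectors are functions on a product space with the uniform probability measure, and an operator or
vector on a set of parties is handled as a function of the corresponding coordinates. Tensor
products then become independence (`expect_mul_of_dependsOn`), at the price of factors `√card`. -/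

theorem dependsOn_mul {f g : (∀ v, κ v) → ℂ} {R : Set V} (hf : DependsOn f R)
    (hg : DependsOn g R) : DependsOn (fun x => f x * g x) R := fun x y h => by
  simp only [hf h, hg h]

theorem dependsOn_conj {f : (∀ v, κ v) → ℂ} {R : Set V} (hf : DependsOn f R) :
    DependsOn (fun x => conj (f x)) R := fun x y h => by
  simp only [hf h]

variable [DecidableEq V]

theorem dependsOn_comp_piecewise_left {β : Type*} {f : (∀ v, κ v) → β} {S : Finset V}
    (hf : DependsOn f (S : Set V)) (x y : ∀ v, κ v) : f (S.piecewise x y) = f x :=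
  hf fun v hv => by simp [Finset.piecewise_eq_of_mem _ _ _ (Finset.mem_coe.1 hv)]

theorem dependsOn_comp_piecewise_right {β : Type*} {f : (∀ v, κ v) → β} {S : Finset V}
    {R : Set V} (hf : DependsOn f R) (hR : Disjoint (S : Set V) R) (x y : ∀ v, κ v) :
    f (S.piecewise x y) = f y :=
  hf fun v hv => by
    have : v ∉ S := fun h => Set.disjoint_left.1 hR (Finset.mem_coe.2 h) hv
    simp [Finset.piecewise_eq_of_notMem _ _ _ this]

variable [Fintype V] [∀ v, Fintype (κ v)]

/-- Exchanging the coordinates outside `S` between two independent uniform points is a bijection of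
the pairs, so the mixed point is again uniform. -/
theorem expect_piecewise (S : Finset V) (F : (∀ v, κ v) → ℂ) :
    𝔼 x, 𝔼 y, F (S.piecewise x y) = 𝔼 x, F x := by
  rcases isEmpty_or_nonempty (∀ v, κ v) with h | h
  · simp
  let e : ((∀ v, κ v) × (∀ v, κ v)) ≃ ((∀ v, κ v) × (∀ v, κ v)) :=
    { toFun := fun p => (S.piecewise p.1 p.2, S.piecewise p.2 p.1)
      invFun := fun p => (S.piecewise p.1 p.2, S.piecewise p.2 p.1)
      left_inv := fun p => by
        ext v <;> by_cases hv : v ∈ S <;> simp [hv]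
      right_inv := fun p => by
        ext v <;> by_cases hv : v ∈ S <;> simp [hv] }
  have h1 : 𝔼 p : (∀ v, κ v) × (∀ v, κ v), F (S.piecewise p.1 p.2)
      = 𝔼 p : (∀ v, κ v) × (∀ v, κ v), F p.1 :=
    Fintype.expect_equiv e _ _ fun p => rfl
  rw [← Finset.univ_product_univ, Finset.expect_product, Finset.expect_product] at h1
  simpa using h1

/-- Functions of disjoint sets of coordinates are independent: resampling the coordinates outside
`S` separates the two factors. -/
theorem expect_mul_of_dependsOn {f g : (∀ v, κ v) → ℂ} {S : Finset V} {R : Set V}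
    (hf : DependsOn f (S : Set V)) (hg : DependsOn g R) (hR : Disjoint (S : Set V) R) :
    𝔼 x, f x * g x = (𝔼 x, f x) * 𝔼 x, g x := by
  rw [← expect_piecewise S]
  simp only [dependsOn_comp_piecewise_left hf, dependsOn_comp_piecewise_right hg hR]
  simp only [Finset.mul_expect, Finset.expect_mul]
  rw [Finset.expect_comm]

theorem expect_prod_eq {h : ∀ v, κ v → ℂ} : 𝔼 x : (∀ v, κ v), ∏ v, h v (x v) = ∏ v, 𝔼 y, h v y := by
  simp only [Fintype.expect_eq_sum_div_card, Finset.prod_div_distrib]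
  rw [Finset.prod_univ_sum, Fintype.piFinset_univ, Fintype.card_pi]
  push_cast; rfl

theorem expect_eval [∀ v, Nonempty (κ v)] (v : V) (h : κ v → ℂ) :
    𝔼 x : (∀ v, κ v), h (x v) = 𝔼 y, h y := by
  have := expect_prod_eq (κ := κ)
    (h := fun w y => if hw : w = v then h (hw ▸ y) else 1)
  rw [Finset.prod_eq_single_of_mem v (Finset.mem_univ _)] at this
  · simp only [dite_true] at this
    rw [← this]
    refine Finset.expect_congr rfl fun x _ => ?_
    rw [Finset.prod_eq_single_of_mem v (Finset.mem_univ _)]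
    · simp
    · intro w _ hw; simp [hw]
  · intro w _ hw
    simp [hw]

end Average

/-! ### Inner products and orthonormal families -/

section Inner

variable {X : Type*} [Fintype X]

/-- The inner product with respect to the uniform probability measure. -/
def ip (f g : X → ℂ) : ℂ := 𝔼 x, conj (f x) * g x

theorem conj_expect (f : X → ℂ) : conj (𝔼 x, f x) = 𝔼 x, conj (f x) := by
  simp [Fintype.expect_eq_sum_div_card]

theorem ip_conj_symm (f g : X → ℂ) : conj (ip f g) = ip g f := by
  simp [ip, conj_expect, mul_comm]

theorem ip_sum_right {ι : Type*} (s : Finset ι) (f : X → ℂ) (g : ι → X → ℂ) :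
    ip f (fun x => ∑ i ∈ s, g i x) = ∑ i ∈ s, ip f (g i) := by
  simp only [ip, Finset.mul_sum, Finset.expect_sum_comm]

theorem ip_sum_left {ι : Type*} (s : Finset ι) (f : ι → X → ℂ) (g : X → ℂ) :
    ip (fun x => ∑ i ∈ s, f i x) g = ∑ i ∈ s, ip (f i) g := by
  simp only [ip, map_sum, Finset.sum_mul, Finset.expect_sum_comm]

theorem ip_sub_right (f g h : X → ℂ) : ip f (fun x => g x - h x) = ip f g - ip f h := by
  simp only [ip, mul_sub, Finset.expect_sub_distrib]

theorem ip_sub_left (f g h : X → ℂ) : ip (fun x => f x - g x) h = ip f h - ip g h := by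
  simp only [ip, map_sub, sub_mul, Finset.expect_sub_distrib]

theorem ip_mul_right (f g : X → ℂ) (c : ℂ) : ip f (fun x => c * g x) = c * ip f g := by
  simp only [ip, Finset.mul_expect, mul_left_comm]

theorem ip_mul_left (f g : X → ℂ) (c : ℂ) : ip (fun x => c * f x) g = conj c * ip f g := by
  simp only [ip, Finset.mul_expect, map_mul, mul_assoc]

/-- The squared norm with respect to the uniform probability measure. -/
def nsq (f : X → ℂ) : ℝ := 𝔼 x, ‖f x‖ ^ 2

theorem nsq_nonneg (f : X → ℂ) : 0 ≤ nsq f := Finset.expect_nonneg fun _ _ => by positivity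

theorem ip_self (f : X → ℂ) : ip f f = (nsq f : ℂ) := by
  simp only [ip, nsq, Fintype.expect_eq_sum_div_card]
  push_cast
  congr 1
  refine Finset.sum_congr rfl fun x _ => ?_
  rw [← Complex.normSq_eq_conj_mul_self, Complex.normSq_eq_norm_sq]
  push_cast; rfl

theorem nsq_eq (f : X → ℂ) : nsq f = (∑ x, ‖f x‖ ^ 2) / Fintype.card X := by
  rw [nsq, Fintype.expect_eq_sum_div_card]

theorem norm_ip_sq_le (f g : X → ℂ) : ‖ip f g‖ ^ 2 ≤ nsq f * nsq g := by
  have h1 : ip f g = (inner ℂ (WithLp.toLp 2 f : EuclideanSpace ℂ X)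
      (WithLp.toLp 2 g : EuclideanSpace ℂ X)) / Fintype.card X := by
    simp [ip, Fintype.expect_eq_sum_div_card, PiLp.inner_apply, mul_comm]
  have h2 := norm_inner_le_norm (𝕜 := ℂ) (WithLp.toLp 2 f : EuclideanSpace ℂ X)
      (WithLp.toLp 2 g : EuclideanSpace ℂ X)
  rw [h1, nsq_eq, nsq_eq, norm_div, div_pow, div_mul_div_comm, ← sq]
  simp only [Complex.norm_natCast]
  gcongr
  calc _ ≤ (‖(WithLp.toLp 2 f : EuclideanSpace ℂ X)‖ * ‖(WithLp.toLp 2 g : EuclideanSpace ℂ X)‖) ^ 2 := by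
        gcongr
    _ = _ := by
        rw [mul_pow, EuclideanSpace.norm_sq_eq, EuclideanSpace.norm_sq_eq]

/-- Orthonormality with respect to the uniform probability measure. -/
def OrthonormalFamily {ι : Type*} [DecidableEq ι] (b : ι → X → ℂ) : Prop :=
  ∀ i j, ip (b i) (b j) = if i = j then 1 else 0

theorem OrthonormalFamily.nsq_eq_one {ι : Type*} [DecidableEq ι] {b : ι → X → ℂ}
    (hb : OrthonormalFamily b) (i : ι) : nsq (b i) = 1 := by
  have := hb i i
  rw [ip_self] at this
  simpa using this

theorem OrthonormalFamily.bessel {ι : Type*} [DecidableEq ι] [Fintype ι] {b : ι → X → ℂ}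
    (hb : OrthonormalFamily b) (f : X → ℂ) : ∑ i, ‖ip (b i) f‖ ^ 2 ≤ nsq f := by
  have hz : ∀ z : ℂ, conj z * z = ((‖z‖ ^ 2 : ℝ) : ℂ) := fun z => by
    rw [← Complex.normSq_eq_conj_mul_self, Complex.normSq_eq_norm_sq]
  set g : X → ℂ := fun x => ∑ i, ip (b i) f * b i x with hg
  have hgf : ip g f = ((∑ i, ‖ip (b i) f‖ ^ 2 : ℝ) : ℂ) := by
    rw [hg, ip_sum_left]
    simp only [ip_mul_left, hz]
    push_cast; rfl
  have hgg : ip g g = ((∑ i, ‖ip (b i) f‖ ^ 2 : ℝ) : ℂ) := by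
    conv_lhs => rw [hg, ip_sum_left]
    simp only [ip_mul_left]
    push_cast
    refine Finset.sum_congr rfl fun i _ => ?_
    rw [ip_sum_right]
    simp only [ip_mul_right, hb i]
    simp only [mul_ite, mul_one, mul_zero, Finset.sum_ite_eq, Finset.mem_univ, if_true]
    rw [hz]; push_cast; rfl
  have hfg : ip f g = ((∑ i, ‖ip (b i) f‖ ^ 2 : ℝ) : ℂ) := by
    rw [← ip_conj_symm, hgf, Complex.conj_ofReal]
  have h0 := nsq_nonneg (fun x => f x - g x)
  have : ((nsq fun x => f x - g x : ℝ) : ℂ) = ((nsq f - ∑ i, ‖ip (b i) f‖ ^ 2 : ℝ) : ℂ) := by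
    rw [← ip_self, ip_sub_left, ip_sub_right, ip_sub_right, hgf, hgg, hfg, ip_self]
    push_cast; ring
  have h1 := Complex.ofReal_injective this
  linarith

/-- An orthonormal basis for the counting measure, rescaled by `√(card X)`. The last clause is the
reproducing property, from which all the partial projections are built. -/
theorem exists_orthonormalFamily (Q : Submodule ℂ (X → ℂ)) :
    ∃ b : Fin (Module.finrank ℂ Q) → X → ℂ, (∀ i, b i ∈ Q) ∧ OrthonormalFamily b ∧
      ∀ f ∈ Q, ∀ x, f x = ∑ i, b i x * ip (b i) f := by
  rcases isEmpty_or_nonempty X with hX | hX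
  · have : Module.finrank ℂ Q = 0 := by
      have : Subsingleton Q := ⟨fun a b => Subtype.ext (Subsingleton.elim _ _)⟩
      exact Module.finrank_zero_of_subsingleton
    rw [this]
    exact ⟨fun i => i.elim0, fun i => i.elim0, fun i => i.elim0, fun f _ x => (hX.false x).elim⟩
  let L := (WithLp.linearEquiv 2 ℂ (X → ℂ))
  let Q' : Submodule ℂ (EuclideanSpace ℂ X) := Q.map (L.symm : (X → ℂ) →ₗ[ℂ] EuclideanSpace ℂ X)
  have hfin : Module.finrank ℂ Q' = Module.finrank ℂ Q := LinearEquiv.finrank_map_eq L.symm Q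
  let o := (stdOrthonormalBasis ℂ Q').reindex (finCongr hfin)
  have hc : (0 : ℝ) < Fintype.card X := by exact_mod_cast Fintype.card_pos
  have hc' : ((Real.sqrt (Fintype.card X) : ℝ) : ℂ) * ((Real.sqrt (Fintype.card X) : ℝ) : ℂ)
      = Fintype.card X := by
    rw [← Complex.ofReal_mul, Real.mul_self_sqrt hc.le]; simp
  have hc0 : (Fintype.card X : ℂ) ≠ 0 := by exact_mod_cast hc.ne'
  have hip : ∀ f g : X → ℂ, ip f g = inner ℂ (WithLp.toLp 2 f : EuclideanSpace ℂ X)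
      (WithLp.toLp 2 g : EuclideanSpace ℂ X) / Fintype.card X := fun f g => by
    simp [ip, Fintype.expect_eq_sum_div_card, PiLp.inner_apply, mul_comm]
  refine ⟨fun i x => ((Real.sqrt (Fintype.card X) : ℝ) : ℂ) * (o i : EuclideanSpace ℂ X) x,
    fun i => ?_, fun i j => ?_, fun f hf x => ?_⟩
  · obtain ⟨g, hg, hgo⟩ := Submodule.mem_map.1 (o i).2
    have hgx : (fun x => ((Real.sqrt (Fintype.card X) : ℝ) : ℂ) * (o i : EuclideanSpace ℂ X) x)
        = ((Real.sqrt (Fintype.card X) : ℝ) : ℂ) • g := by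
      rw [← hgo]; rfl
    change (fun x => ((Real.sqrt (Fintype.card X) : ℝ) : ℂ) * (o i : EuclideanSpace ℂ X) x) ∈ Q
    rw [hgx]
    exact Q.smul_mem _ hg
  · rw [ip_mul_left, ip_mul_right, Complex.conj_ofReal, ← mul_assoc, hc', hip,
      mul_div_cancel₀ _ hc0]
    have := orthonormal_iff_ite.1 o.orthonormal i j
    rw [Submodule.coe_inner] at this
    exact this
  · have hf' : L.symm f ∈ Q' := Submodule.mem_map_of_mem hf
    have := o.sum_repr' ⟨L.symm f, hf'⟩
    have h2 := congrArg (fun w : Q' => (w : EuclideanSpace ℂ X) x) this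
    simp only [Submodule.coe_sum, Submodule.coe_smul, Submodule.coe_inner] at h2
    rw [WithLp.ofLp_sum, Finset.sum_apply] at h2
    have h3 : (L.symm f : EuclideanSpace ℂ X) x = f x := rfl
    rw [h3] at h2
    rw [← h2]
    refine Finset.sum_congr rfl fun i _ => ?_
    rw [ip_mul_left, hip, Complex.conj_ofReal]
    simp only [PiLp.smul_apply, smul_eq_mul]
    have h4 : (WithLp.toLp 2 f : EuclideanSpace ℂ X) = L.symm f := rfl
    have h5 : (WithLp.toLp 2 (fun x => (o i : EuclideanSpace ℂ X) x) : EuclideanSpace ℂ X)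
      = (o i : EuclideanSpace ℂ X) := rfl
    rw [h4, h5]
    field_simp
    linear_combination (-(inner ℂ (o i : EuclideanSpace ℂ X) (L.symm f : EuclideanSpace ℂ X)) * (o i : EuclideanSpace ℂ X) x) * hc'

end Inner

/-! ### Partial projections -/

section LocProj

variable {V : Type*} [Fintype V] [DecidableEq V] {κ : V → Type*} [∀ v, Fintype (κ v)]

/-- The partial inner product of `b` with `f` over the coordinates in `S`. -/
def coef (S : Finset V) (b f : (∀ v, κ v) → ℂ) (x : ∀ v, κ v) : ℂ :=
  𝔼 z, conj (b z) * f (S.piecewise z x)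

/-- The partial projection onto the span of the functions `b i` of the coordinates in `S`. -/
def locProj {ι : Type*} [Fintype ι] (S : Finset V) (b : ι → (∀ v, κ v) → ℂ)
    (f : (∀ v, κ v) → ℂ) (x : ∀ v, κ v) : ℂ :=
  ∑ i, b i x * coef S (b i) f x

theorem dependsOn_coef {S : Finset V} (b : (∀ v, κ v) → ℂ) {f : (∀ v, κ v) → ℂ} {R : Set V}
    (hf : DependsOn f R) : DependsOn (coef S b f) (R \ (S : Set V)) := fun x y h => by
  unfold coef
  refine Finset.expect_congr rfl fun z _ => ?_
  congr 1
  refine hf fun v hv => ?_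
  by_cases hS : v ∈ S
  · simp [hS]
  · simpa [hS] using h v ⟨hv, by simpa using hS⟩

theorem dependsOn_coef_compl (S : Finset V) (b f : (∀ v, κ v) → ℂ) :
    DependsOn (coef S b f) (S : Set V)ᶜ :=
  (dependsOn_coef b (dependsOn_univ f)).mono fun _ h => h.2

theorem coef_mul_right {S : Finset V} (b f : (∀ v, κ v) → ℂ) {g : (∀ v, κ v) → ℂ} {R : Set V}
    (hg : DependsOn g R) (hR : Disjoint (S : Set V) R) (x : ∀ v, κ v) :
    coef S b (fun x => f x * g x) x = coef S b f x * g x := by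
  simp only [coef, dependsOn_comp_piecewise_right hg hR, Finset.expect_mul, mul_assoc]

theorem coef_of_dependsOn {S : Finset V} (b : (∀ v, κ v) → ℂ) {f : (∀ v, κ v) → ℂ}
    (hf : DependsOn f (S : Set V)) (x : ∀ v, κ v) : coef S b f x = ip b f := by
  simp only [coef, dependsOn_comp_piecewise_left hf, ip]

theorem coef_sum {ι : Type*} (s : Finset ι) (S : Finset V) (b : (∀ v, κ v) → ℂ)
    (f : ι → (∀ v, κ v) → ℂ) (x : ∀ v, κ v) :
    coef S b (fun x => ∑ i ∈ s, f i x) x = ∑ i ∈ s, coef S b (f i) x := by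
  simp only [coef, Finset.mul_sum, Finset.expect_sum_comm]

/-- Tensoring with `b` and contracting with `b` are adjoint to each other. This makes `locProj` an
orthogonal projection. -/
theorem ip_mul_coef {S : Finset V} {b : (∀ v, κ v) → ℂ} (hb : DependsOn b (S : Set V))
    {c : (∀ v, κ v) → ℂ} (hc : DependsOn c (S : Set V)ᶜ) (f : (∀ v, κ v) → ℂ) :
    ip (fun x => b x * c x) f = ip c (coef S b f) := by
  rw [ip, ← expect_piecewise S, Finset.expect_comm, ip]
  refine Finset.expect_congr rfl fun x _ => ?_
  rw [coef, Finset.mul_expect]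
  refine Finset.expect_congr rfl fun z _ => ?_
  rw [dependsOn_comp_piecewise_left hb, dependsOn_comp_piecewise_right hc disjoint_compl_right,
    map_mul]
  ring

variable {ι : Type*} [Fintype ι] {S : Finset V} {b : ι → (∀ v, κ v) → ℂ}

theorem ip_locProj_left (hb : ∀ i, DependsOn (b i) (S : Set V)) (g f : (∀ v, κ v) → ℂ) :
    ip (locProj S b g) f = ∑ i, ip (coef S (b i) g) (coef S (b i) f) := by
  change ip (fun x => ∑ i, b i x * coef S (b i) g x) f = _
  rw [ip_sum_left]
  exact Finset.sum_congr rfl fun i _ => ip_mul_coef (hb i) (dependsOn_coef_compl _ _ _) f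

theorem locProj_mul_right (f : (∀ v, κ v) → ℂ) {g : (∀ v, κ v) → ℂ} {R : Set V}
    (hg : DependsOn g R) (hR : Disjoint (S : Set V) R) (x : ∀ v, κ v) :
    locProj S b (fun x => f x * g x) x = locProj S b f x * g x := by
  simp only [locProj, coef_mul_right _ _ hg hR, Finset.sum_mul, mul_assoc]

theorem locProj_sum {ι' : Type*} (s : Finset ι') (f : ι' → (∀ v, κ v) → ℂ) (x : ∀ v, κ v) :
    locProj S b (fun x => ∑ i ∈ s, f i x) x = ∑ i ∈ s, locProj S b (f i) x := by
  simp only [locProj, coef_sum, Finset.mul_sum]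
  rw [Finset.sum_comm]

theorem dependsOn_locProj (hb : ∀ i, DependsOn (b i) (S : Set V)) {f : (∀ v, κ v) → ℂ}
    {R : Set V} (hf : DependsOn f R) (hS : (S : Set V) ⊆ R) : DependsOn (locProj S b f) R :=
  fun x y h => by
    unfold locProj
    refine Finset.sum_congr rfl fun i _ => ?_
    rw [(hb i).mono hS h, (dependsOn_coef (b i) hf).mono Set.sdiff_subset h]

variable [DecidableEq ι]

theorem coef_sum_mul (hb : ∀ i, DependsOn (b i) (S : Set V)) (ho : OrthonormalFamily b)
    (s : Finset ι) {c : ι → (∀ v, κ v) → ℂ} (hc : ∀ i, DependsOn (c i) (S : Set V)ᶜ) (j : ι)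
    (x : ∀ v, κ v) :
    coef S (b j) (fun x => ∑ i ∈ s, b i x * c i x) x = if j ∈ s then c j x else 0 := by
  rw [coef_sum]
  simp only [coef_mul_right _ _ (hc _) disjoint_compl_right, coef_of_dependsOn _ (hb _), ho j]
  simp

theorem coef_locProj (hb : ∀ i, DependsOn (b i) (S : Set V)) (ho : OrthonormalFamily b)
    (f : (∀ v, κ v) → ℂ) (j : ι) : coef S (b j) (locProj S b f) = coef S (b j) f := by
  funext x
  have := coef_sum_mul hb ho Finset.univ (c := fun i => coef S (b i) f)
    (fun i => dependsOn_coef_compl _ _ _) j x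
  simp only [Finset.mem_univ, if_true] at this
  exact this

theorem ip_locProj_locProj (hb : ∀ i, DependsOn (b i) (S : Set V)) (ho : OrthonormalFamily b)
    (g f : (∀ v, κ v) → ℂ) : ip (locProj S b g) (locProj S b f) = ip (locProj S b g) f := by
  rw [ip_locProj_left hb, ip_locProj_left hb]
  simp only [coef_locProj hb ho]

theorem nsq_locProj (hb : ∀ i, DependsOn (b i) (S : Set V)) (ho : OrthonormalFamily b)
    (f : (∀ v, κ v) → ℂ) : nsq (locProj S b f) = ∑ i, nsq (coef S (b i) f) := by
  have h : ((nsq (locProj S b f) : ℝ) : ℂ) = ((∑ i, nsq (coef S (b i) f) : ℝ) : ℂ) := by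
    rw [← ip_self, ip_locProj_locProj hb ho, ip_locProj_left hb]
    push_cast
    simp only [ip_self]
  exact_mod_cast h

/-- Pythagoras for the orthogonal projection `locProj S b`. -/
theorem nsq_sub_locProj (hb : ∀ i, DependsOn (b i) (S : Set V)) (ho : OrthonormalFamily b)
    (f : (∀ v, κ v) → ℂ) :
    nsq (fun x => f x - locProj S b f x) = nsq f - nsq (locProj S b f) := by
  have h : ((nsq (fun x => f x - locProj S b f x) : ℝ) : ℂ)
      = ((nsq f - nsq (locProj S b f) : ℝ) : ℂ) := by
    have h1 : ip (locProj S b f) f = (nsq (locProj S b f) : ℂ) := by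
      rw [← ip_locProj_locProj hb ho, ip_self]
    have h2 : ip f (locProj S b f) = (nsq (locProj S b f) : ℂ) := by
      rw [← ip_conj_symm, h1, Complex.conj_ofReal]
    rw [← ip_self]
    have := ip_sub_left f (locProj S b f) (fun x => f x - locProj S b f x)
    rw [this, ip_sub_right, ip_sub_right, h1, h2, ip_self, ip_self]
    push_cast; ring
  exact_mod_cast h

theorem nsq_locProj_le (hb : ∀ i, DependsOn (b i) (S : Set V)) (ho : OrthonormalFamily b)
    (f : (∀ v, κ v) → ℂ) : nsq (locProj S b f) ≤ nsq f := by
  have := nsq_sub_locProj hb ho f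
  linarith [nsq_nonneg (fun x => f x - locProj S b f x)]

end LocProj

/-! ### Schmidt rank -/

section Schmidt

variable {V : Type*} [Fintype V] [DecidableEq V] {κ : V → Type*}

/-- `φ` is a sum of `M` products of a function of the coordinates in `S` and a function of the
other coordinates. -/
def SchmidtRankLE (S : Finset V) (M : ℕ) (φ : (∀ v, κ v) → ℂ) : Prop :=
  ∃ f g : Fin M → (∀ v, κ v) → ℂ, (∀ l, DependsOn (f l) (S : Set V)) ∧
    (∀ l, DependsOn (g l) (S : Set V)ᶜ) ∧ ∀ x, φ x = ∑ l, f l x * g l x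

theorem SchmidtRankLE.of_fintype {ι : Type*} [Fintype ι] {S : Finset V} {φ : (∀ v, κ v) → ℂ}
    {f g : ι → (∀ v, κ v) → ℂ} (hf : ∀ l, DependsOn (f l) (S : Set V))
    (hg : ∀ l, DependsOn (g l) (S : Set V)ᶜ) (h : ∀ x, φ x = ∑ l, f l x * g l x) :
    SchmidtRankLE S (Fintype.card ι) φ := by
  let e := Fintype.equivFin ι
  refine ⟨fun l => f (e.symm l), fun l => g (e.symm l), fun l => hf _, fun l => hg _, fun x => ?_⟩
  rw [h x]
  exact (Equiv.sum_comp e.symm (fun l => f l x * g l x)).symm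

/-- The span of the functions of the coordinates in `S` obtained from `φ` by fixing the other
coordinates. -/
def sliceSpan (S : Finset V) (φ : (∀ v, κ v) → ℂ) : Submodule ℂ ((∀ v, κ v) → ℂ) :=
  Submodule.span ℂ (Set.range fun y => fun x => φ (S.piecewise x y))

theorem dependsOn_of_mem_sliceSpan {S : Finset V} {φ f : (∀ v, κ v) → ℂ}
    (hf : f ∈ sliceSpan S φ) : DependsOn f (S : Set V) := by
  induction hf using Submodule.span_induction with
  | mem f hf =>
    obtain ⟨y, rfl⟩ := hf
    intro x x' h
    simp only
    congr 1
    funext v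
    by_cases hv : v ∈ S
    · simpa [hv] using h v hv
    · simp [hv]
  | zero => intro x y _; rfl
  | add f g _ _ hf hg => intro x y h; simp [hf h, hg h]
  | smul a f _ hf => intro x y h; simp [hf h]

variable [∀ v, Fintype (κ v)]

/-- Each slice is a combination of the `M` left factors, with the right factors evaluated at the
fixed point as coefficients. The dimension of the slice space thus plays the role of the Schmidt
rank. -/
theorem SchmidtRankLE.finrank_sliceSpan_le {S : Finset V} {φ : (∀ v, κ v) → ℂ} {M : ℕ}
    (h : SchmidtRankLE S M φ) : Module.finrank ℂ (sliceSpan S φ) ≤ M := by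
  obtain ⟨f, g, hf, hg, hφ⟩ := h
  have hle : sliceSpan S φ ≤ Submodule.span ℂ (Set.range f) := by
    refine Submodule.span_le.2 ?_
    rintro _ ⟨y, rfl⟩
    have : (fun x => φ (S.piecewise x y)) = ∑ l, g l y • f l := by
      funext x
      rw [hφ, Finset.sum_apply]
      refine Finset.sum_congr rfl fun l _ => ?_
      rw [dependsOn_comp_piecewise_left (hf l),
        dependsOn_comp_piecewise_right (hg l) disjoint_compl_right, Pi.smul_apply, smul_eq_mul,
        mul_comm]
    change (fun x => φ (S.piecewise x y)) ∈ _
    rw [this]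
    exact Submodule.sum_mem _ fun l _ =>
      Submodule.smul_mem _ _ (Submodule.subset_span (Set.mem_range_self l))
  calc _ ≤ _ := Submodule.finrank_mono hle
    _ ≤ Fintype.card (Fin M) := finrank_range_le_card f
    _ = M := Fintype.card_fin M

theorem one_le_finrank_sliceSpan {S : Finset V} {φ : (∀ v, κ v) → ℂ} (h : φ ≠ 0) :
    1 ≤ Module.finrank ℂ (sliceSpan S φ) := by
  obtain ⟨x, hx⟩ := Function.ne_iff.1 h
  have : (⟨fun z => φ (S.piecewise z x), Submodule.subset_span ⟨x, rfl⟩⟩ : sliceSpan S φ) ≠ 0 := by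
    intro h0
    have h1 := congrArg (fun w : sliceSpan S φ => (w : (∀ v, κ v) → ℂ) x) h0
    simp only [Finset.piecewise_same] at h1
    exact hx h1
  exact (Module.finrank_pos_iff_exists_ne_zero (R := ℂ)).2 ⟨_, this⟩

/-- If the span of the functions `b i` contains all slices of `f`, then the partial projection
fixes `f`. -/
theorem locProj_eq_self {ι : Type*} [Fintype ι] {S : Finset V}
    {b : ι → (∀ v, κ v) → ℂ} {f : (∀ v, κ v) → ℂ}
    (h : ∀ y x, f (S.piecewise x y) = ∑ i, b i x * ip (b i) (fun z => f (S.piecewise z y))) :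
    locProj S b f = f := by
  funext x
  have := h x x
  rw [Finset.piecewise_same] at this
  rw [this]
  rfl

/-- The projection touches only the left factors of the decomposition. Together with the disjoint
case, where it touches only the right ones, this is why laminar cuts can be truncated one after
another. -/
theorem SchmidtRankLE.locProj_of_subset {ι : Type*} [Fintype ι] {S R : Finset V}
    {b : ι → (∀ v, κ v) → ℂ} (hb : ∀ i, DependsOn (b i) (R : Set V)) {φ : (∀ v, κ v) → ℂ} {M : ℕ}
    (h : SchmidtRankLE S M φ) (hR : R ⊆ S) : SchmidtRankLE S M (locProj R b φ) := by
  obtain ⟨f, g, hf, hg, hφ⟩ := h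
  have hφ' : φ = fun x => ∑ l, f l x * g l x := funext hφ
  refine ⟨fun l => locProj R b (f l), g, fun l => dependsOn_locProj hb (hf l) (by simpa using hR),
    hg, fun x => ?_⟩
  rw [hφ', locProj_sum]
  refine Finset.sum_congr rfl fun l _ => locProj_mul_right _ (hg l) ?_ x
  exact Set.disjoint_compl_right_iff_subset.2 (by simpa using hR)

theorem SchmidtRankLE.locProj_of_disjoint {ι : Type*} [Fintype ι] {S R : Finset V}
    {b : ι → (∀ v, κ v) → ℂ} (hb : ∀ i, DependsOn (b i) (R : Set V)) {φ : (∀ v, κ v) → ℂ} {M : ℕ}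
    (h : SchmidtRankLE S M φ) (hR : Disjoint R S) : SchmidtRankLE S M (locProj R b φ) := by
  obtain ⟨f, g, hf, hg, hφ⟩ := h
  have hd : Disjoint (R : Set V) (S : Set V) := by exact_mod_cast hR
  have hφ' : φ = fun x => ∑ l, g l x * f l x := by
    funext x; rw [hφ]; exact Finset.sum_congr rfl fun _ _ => mul_comm _ _
  refine ⟨f, fun l => locProj R b (g l), hf, fun l => dependsOn_locProj hb (hg l)
    (Set.subset_compl_iff_disjoint_right.2 hd), fun x => ?_⟩
  rw [hφ', locProj_sum]
  refine Finset.sum_congr rfl fun l _ => ?_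
  rw [locProj_mul_right _ (hf l) hd x, mul_comm]

theorem schmidtRankLE_locProj {ι : Type*} [Fintype ι] {S : Finset V}
    {b : ι → (∀ v, κ v) → ℂ} (hb : ∀ i, DependsOn (b i) (S : Set V)) (φ : (∀ v, κ v) → ℂ) :
    SchmidtRankLE S (Fintype.card ι) (locProj S b φ) :=
  SchmidtRankLE.of_fintype hb (fun i => dependsOn_coef_compl S (b i) φ) fun _ => rfl

end Schmidt

/-! ### The cuts of a rooted tree -/

section Graph

variable {V : Type} [Fintype V] [DecidableEq V] {T : SimpleGraph V} {root : V}

theorem root_notMem_lowerSide (e : T.edgeSet) : root ∉ lowerSide T root e := by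
  classical
  simp [lowerSide]

theorem mem_lowerSide_iff_of_ne {e : T.edgeSet} {a b : V} (hab : T.Adj a b)
    (h : s(a, b) ≠ e.1) : a ∈ lowerSide T root e ↔ b ∈ lowerSide T root e := by
  classical
  have hadj : (T.deleteEdges {e.1}).Adj a b := by
    rw [SimpleGraph.deleteEdges_adj]
    exact ⟨hab, by simpa using h⟩
  simp only [lowerSide, Finset.mem_filter, Finset.mem_univ, true_and, not_iff_not]
  exact ⟨fun h => h.trans hadj.reachable, fun h => h.trans hadj.symm.reachable⟩

/-- By connectedness, a set closed under adjacency that misses the root is empty. The facts on cuts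
below apply this to a set of would-be counterexamples. -/
theorem notMem_of_forall_adj (hT : T.IsTree) {Z : Set V} (hr : root ∉ Z)
    (hZ : ∀ a b, T.Adj a b → a ∈ Z → b ∈ Z) (v : V) : v ∉ Z := by
  intro hv
  obtain ⟨w⟩ := hT.connected.preconnected v root
  apply hr
  clear hr
  induction w with
  | nil => exact hv
  | cons h _ ih => exact ih (hZ _ _ h hv)

/-- If both ends were in the lower side, it would be closed under adjacency while missing the root.
If neither were, both would reach the root without `e`, which is a bridge. -/
theorem mem_lowerSide_iff_notMem (hT : T.IsTree) {e : T.edgeSet} {a b : V}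
    (h : s(a, b) = e.1) : a ∈ lowerSide T root e ↔ b ∉ lowerSide T root e := by
  classical
  have hab : T.Adj a b := by
    have := e.2
    rwa [← h] at this
  constructor
  · intro ha hb
    refine notMem_of_forall_adj (root := root) hT (Z := (lowerSide T root e : Set V))
      (by exact_mod_cast root_notMem_lowerSide e) (fun x y hxy hx => ?_) a (by exact_mod_cast ha)
    by_cases hx' : s(x, y) = e.1
    · rw [← h] at hx'
      rcases Sym2.eq_iff.1 hx' with ⟨_, rfl⟩ | ⟨_, rfl⟩
      · exact_mod_cast hb
      · exact_mod_cast ha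
    · exact (mem_lowerSide_iff_of_ne hxy hx').1 hx
  · intro hb
    by_contra ha
    simp only [lowerSide, Finset.mem_filter, Finset.mem_univ, true_and, not_not] at ha hb
    have hbr := (SimpleGraph.isAcyclic_iff_forall_isBridge.1 hT.isAcyclic) e.2
    rw [← h, SimpleGraph.isBridge_iff] at hbr
    rw [← h] at ha hb
    exact hbr (ha.symm.trans hb)

variable (T root) in
/-- The edge that joins `v` to its parent (if `v` is not the root). -/
def upEdges [DecidableRel T.Adj] (v : V) : Finset T.edgeSet :=
  Finset.univ.filter fun e => v ∈ e.1 ∧ v ∈ lowerSide T root e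

variable (T root) in
/-- The edges that join `v` to its children. -/
def downEdges [DecidableRel T.Adj] (v : V) : Finset T.edgeSet :=
  Finset.univ.filter fun e => v ∈ e.1 ∧ v ∉ lowerSide T root e

variable [DecidableRel T.Adj]

theorem mem_upEdges {v : V} {e : T.edgeSet} :
    e ∈ upEdges T root v ↔ v ∈ e.1 ∧ v ∈ lowerSide T root e := by
  simp [upEdges]

theorem mem_downEdges {v : V} {e : T.edgeSet} :
    e ∈ downEdges T root v ↔ v ∈ e.1 ∧ v ∉ lowerSide T root e := by
  simp [downEdges]

theorem upEdges_root : upEdges T root root = ∅ := by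
  ext e
  simp [mem_upEdges, root_notMem_lowerSide]

theorem disjoint_up_down (v : V) : Disjoint (upEdges T root v) (downEdges T root v) := by
  rw [Finset.disjoint_left]
  intro e h h'
  exact (mem_downEdges.1 h').2 (mem_upEdges.1 h).2

theorem mem_up_or_down {v : V} {e : T.edgeSet} (h : v ∈ e.1) :
    e ∈ upEdges T root v ∨ e ∈ downEdges T root v := by
  by_cases hv : v ∈ lowerSide T root e
  · exact Or.inl (mem_upEdges.2 ⟨h, hv⟩)
  · exact Or.inr (mem_downEdges.2 ⟨h, hv⟩)

theorem exists_ends (hT : T.IsTree) (e : T.edgeSet) :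
    ∃ c p, e.1 = s(c, p) ∧ c ∈ lowerSide T root e ∧ p ∉ lowerSide T root e := by
  obtain ⟨a, b, he'⟩ : ∃ a b, s(a, b) = e.1 := by
    induction e.1 using Sym2.ind with
    | _ a b => exact ⟨a, b, rfl⟩
  by_cases ha : a ∈ lowerSide T root e
  · exact ⟨a, b, he'.symm, ha, (mem_lowerSide_iff_notMem hT he').1 ha⟩
  · have hb := (mem_lowerSide_iff_notMem (root := root) hT he').not.1 ha
    exact ⟨b, a, by rw [← he', Sym2.eq_swap], not_not.1 hb, ha⟩

theorem exists_mem_downEdges (hT : T.IsTree) (e : T.edgeSet) :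
    ∃ v, e ∈ downEdges T root v := by
  obtain ⟨c, p, h, _, hp⟩ := exists_ends (root := root) hT e
  exact ⟨p, mem_downEdges.2 ⟨by rw [h]; simp, hp⟩⟩

theorem eq_of_mem_downEdges (hT : T.IsTree) {e : T.edgeSet} {v w : V}
    (hv : e ∈ downEdges T root v) (hw : e ∈ downEdges T root w) : v = w := by
  obtain ⟨c, p, h, hc, hp⟩ := exists_ends (root := root) hT e
  have key : ∀ u, e ∈ downEdges T root u → u = p := fun u hu => by
    obtain ⟨h1, h2⟩ := mem_downEdges.1 hu
    rw [h, Sym2.mem_iff] at h1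
    rcases h1 with rfl | h1
    · exact absurd hc h2
    · exact h1
  rw [key v hv, key w hw]

theorem eq_of_mem_upEdges (hT : T.IsTree) {e : T.edgeSet} {v w : V}
    (hv : e ∈ upEdges T root v) (hw : e ∈ upEdges T root w) : v = w := by
  obtain ⟨c, p, h, hc, hp⟩ := exists_ends (root := root) hT e
  have key : ∀ u, e ∈ upEdges T root u → u = c := fun u hu => by
    obtain ⟨h1, h2⟩ := mem_upEdges.1 hu
    rw [h, Sym2.mem_iff] at h1
    rcases h1 with h1 | rfl
    · exact h1
    · exact absurd h2 hp
  rw [key v hv, key w hw]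

/-- A vertex below `v` and distinct from it lies under some child: the exceptions cannot be left
along an edge, because every edge into `v` is an up or a down edge of `v`. -/
theorem exists_mem_lowerSide_of_ne (hT : T.IsTree) {v w : V} (hw : w ≠ v)
    (hup : ∀ e ∈ upEdges T root v, w ∈ lowerSide T root e)
    (hroot : v ≠ root → ∃ e, e ∈ upEdges T root v) :
    ∃ e ∈ downEdges T root v, w ∈ lowerSide T root e := by
  by_contra! hcon
  refine notMem_of_forall_adj (root := root) hT (Z := {w | w ≠ v ∧
    (∀ e ∈ upEdges T root v, w ∈ lowerSide T root e) ∧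
    ∀ e ∈ downEdges T root v, w ∉ lowerSide T root e}) ?_ ?_ w ⟨hw, hup, hcon⟩
  · rintro ⟨h1, h2, _⟩
    obtain ⟨e, he⟩ := hroot h1.symm
    exact root_notMem_lowerSide e (h2 e he)
  · rintro a b hab ⟨ha, hau, had⟩
    have hb : b ≠ v := by
      rintro rfl
      let f : T.edgeSet := ⟨s(a, b), hab⟩
      have hf : s(a, b) = f.1 := rfl
      have hbf : b ∈ f.1 := by rw [← hf]; simp
      rcases mem_up_or_down (root := root) hbf with h | h
      · exact (mem_lowerSide_iff_notMem hT hf).1 (hau f h) (mem_upEdges.1 h).2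
      · exact had f h ((mem_lowerSide_iff_notMem hT hf).2 (mem_downEdges.1 h).2)
    have hne : ∀ e : T.edgeSet, v ∈ e.1 → s(a, b) ≠ e.1 := fun e he h => by
      rw [← h, Sym2.mem_iff] at he
      rcases he with h | h
      · exact ha h.symm
      · exact hb h.symm
    exact ⟨hb, fun e he => (mem_lowerSide_iff_of_ne hab (hne e (mem_upEdges.1 he).1)).1 (hau e he),
      fun e he h => had e he ((mem_lowerSide_iff_of_ne hab (hne e (mem_downEdges.1 he).1)).2 h)⟩

/-- Otherwise `v` together with everything under its down edges would be closed under adjacency. -/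
theorem exists_mem_upEdges (hT : T.IsTree) {v : V} (hv : v ≠ root) :
    ∃ e, e ∈ upEdges T root v := by
  by_contra! hcon
  refine notMem_of_forall_adj (root := root) hT (Z := {w | w = v ∨
    ∃ e ∈ downEdges T root v, w ∈ lowerSide T root e}) ?_ ?_ v (Or.inl rfl)
  · rintro (h | ⟨e, _, he⟩)
    · exact hv h.symm
    · exact root_notMem_lowerSide e he
  · rintro a b hab (rfl | ⟨e, he, ha⟩)
    · let f : T.edgeSet := ⟨s(a, b), hab⟩
      have hf : s(a, b) = f.1 := rfl
      have hbf : a ∈ f.1 := by rw [← hf]; simp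
      have hd := (mem_up_or_down (root := root) hbf).resolve_left (hcon f)
      refine Or.inr ⟨f, hd, ?_⟩
      by_contra hb
      exact (mem_downEdges.1 hd).2 ((mem_lowerSide_iff_notMem hT hf).2 hb)
    · by_cases h : s(a, b) = e.1
      · obtain ⟨h1, h2⟩ := mem_downEdges.1 he
        rw [← h, Sym2.mem_iff] at h1
        rcases h1 with rfl | rfl
        · exact absurd ha h2
        · exact Or.inl rfl
      · exact Or.inr ⟨e, he, (mem_lowerSide_iff_of_ne hab h).1 ha⟩

/-- With two edges above `v`, leaving one lower side through its edge would lead into the other, so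
their union would be closed under adjacency. -/
theorem upEdges_unique (hT : T.IsTree) {v : V} {e f : T.edgeSet} (he : e ∈ upEdges T root v)
    (hf : f ∈ upEdges T root v) : e = f := by
  by_contra hne
  have key : ∀ {e f : T.edgeSet}, e ∈ upEdges T root v → f ∈ upEdges T root v → e ≠ f →
      ∀ a b, T.Adj a b → a ∈ lowerSide T root e →
        b ∈ lowerSide T root e ∨ b ∈ lowerSide T root f := by
    intro e f he hf hne a b hab ha
    by_cases h : s(a, b) = e.1
    · obtain ⟨h1, h2⟩ := mem_upEdges.1 he
      rw [← h, Sym2.mem_iff] at h1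
      rcases h1 with rfl | rfl
      · refine Or.inr ((mem_lowerSide_iff_of_ne hab fun h' => hne ?_).1 (mem_upEdges.1 hf).2)
        exact Subtype.ext (h.symm.trans h')
      · exact Or.inl h2
    · exact Or.inl ((mem_lowerSide_iff_of_ne hab h).1 ha)
  refine notMem_of_forall_adj (root := root) hT
    (Z := {w | w ∈ lowerSide T root e ∨ w ∈ lowerSide T root f}) ?_ ?_ v
    (Or.inl (mem_upEdges.1 he).2)
  · rintro (h | h) <;> exact root_notMem_lowerSide _ h
  · rintro a b hab (ha | ha)
    · exact key he hf hne a b hab ha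
    · exact (key hf he (Ne.symm hne) a b hab ha).symm

/-- The intersection of the two lower sides is closed under adjacency: the only exit from one of
them leads to `v`, which is outside the other. -/
theorem disjoint_lowerSide (hT : T.IsTree) {v : V} {e f : T.edgeSet}
    (he : e ∈ downEdges T root v) (hf : f ∈ downEdges T root v) (hne : e ≠ f) :
    Disjoint (lowerSide T root e) (lowerSide T root f) := by
  have key : ∀ {e f : T.edgeSet}, e ∈ downEdges T root v → f ∈ downEdges T root v → e ≠ f →
      ∀ a b, T.Adj a b → a ∈ lowerSide T root e → a ∈ lowerSide T root f →
        b ∈ lowerSide T root e := by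
    intro e f he hf hne a b hab ha ha'
    by_cases h : s(a, b) = e.1
    · obtain ⟨h1, h2⟩ := mem_downEdges.1 he
      rw [← h, Sym2.mem_iff] at h1
      rcases h1 with rfl | rfl
      · exact absurd ha h2
      · refine absurd ((mem_lowerSide_iff_of_ne hab fun h' => hne ?_).1 ha') (mem_downEdges.1 hf).2
        exact Subtype.ext (h.symm.trans h')
    · exact (mem_lowerSide_iff_of_ne hab h).1 ha
  rw [Finset.disjoint_left]
  intro w hw hw'
  refine notMem_of_forall_adj (root := root) hT
    (Z := {w | w ∈ lowerSide T root e ∧ w ∈ lowerSide T root f}) ?_ ?_ w ⟨hw, hw'⟩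
  · rintro ⟨h, _⟩; exact root_notMem_lowerSide _ h
  · rintro a b hab ⟨ha, ha'⟩
    exact ⟨key he hf hne a b hab ha ha', key hf he (Ne.symm hne) a b hab ha' ha⟩

theorem lowerSide_subset (hT : T.IsTree) {v : V} {e f : T.edgeSet}
    (he : e ∈ downEdges T root v) (hf : f ∈ upEdges T root v) :
    lowerSide T root e ⊆ lowerSide T root f := by
  intro w hw
  by_contra hw'
  obtain ⟨he1, he2⟩ := mem_downEdges.1 he
  obtain ⟨hf1, hf2⟩ := mem_upEdges.1 hf
  refine notMem_of_forall_adj (root := root) hT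
    (Z := {w | w ∈ lowerSide T root e ∧ w ∉ lowerSide T root f}) ?_ ?_ w ⟨hw, hw'⟩
  · rintro ⟨h, _⟩; exact root_notMem_lowerSide _ h
  · rintro a b hab ⟨ha, ha'⟩
    have hbe : b ∈ lowerSide T root e := by
      by_cases h : s(a, b) = e.1
      · rw [← h, Sym2.mem_iff] at he1
        rcases he1 with rfl | rfl
        · exact absurd ha he2
        · refine absurd ((mem_lowerSide_iff_of_ne hab fun h' => ?_).2 hf2) ha'
          have : e = f := Subtype.ext (h.symm.trans h')
          rw [this] at he2
          exact he2 hf2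
      · exact (mem_lowerSide_iff_of_ne hab h).1 ha
    refine ⟨hbe, fun hbf => ?_⟩
    by_cases h : s(a, b) = f.1
    · rw [← h, Sym2.mem_iff] at hf1
      rcases hf1 with rfl | rfl
      · exact ha' hf2
      · exact he2 hbe
    · exact ha' ((mem_lowerSide_iff_of_ne hab h).2 hbf)

/-- An edge `e ≠ f` has both ends on the same side of `f`, and conversely. Of the four resulting
cases, mutual containment is impossible, as the union of the lower sides would be closed under
adjacency; the others give the two inclusions and disjointness. -/
theorem lowerSide_laminar (hT : T.IsTree) (e f : T.edgeSet) :
    lowerSide T root e ⊆ lowerSide T root f ∨ lowerSide T root f ⊆ lowerSide T root e ∨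
      Disjoint (lowerSide T root e) (lowerSide T root f) := by
  by_cases hne : e = f
  · exact Or.inl (by rw [hne])
  have key : ∀ {e f : T.edgeSet}, e ≠ f → (∀ a ∈ e.1, a ∈ lowerSide T root f) ∨
      ∀ a ∈ e.1, a ∉ lowerSide T root f := by
    intro e f hne
    obtain ⟨c, p, h, _, _⟩ := exists_ends (root := root) hT e
    have hcp : T.Adj c p := by
      have := e.2
      rwa [h] at this
    have := mem_lowerSide_iff_of_ne (root := root) (e := f) hcp
      (fun h' => hne (Subtype.ext (h.trans h')))
    by_cases hc : c ∈ lowerSide T root f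
    · left; intro a ha
      rw [h, Sym2.mem_iff] at ha
      rcases ha with rfl | rfl
      · exact hc
      · exact this.1 hc
    · right; intro a ha
      rw [h, Sym2.mem_iff] at ha
      rcases ha with rfl | rfl
      · exact hc
      · exact this.not.1 hc
  have sub : ∀ {e f : T.edgeSet}, (∀ a ∈ e.1, a ∈ lowerSide T root f) →
      (∀ a ∈ f.1, a ∉ lowerSide T root e) → lowerSide T root e ⊆ lowerSide T root f := by
    intro e f h1 h2 w hw
    by_contra hw'
    refine notMem_of_forall_adj (root := root) hT
      (Z := {w | w ∈ lowerSide T root e ∧ w ∉ lowerSide T root f}) ?_ ?_ w ⟨hw, hw'⟩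
    · rintro ⟨h, _⟩; exact root_notMem_lowerSide _ h
    · rintro a b hab ⟨ha, ha'⟩
      refine ⟨(mem_lowerSide_iff_of_ne hab fun h => ha' (h1 a (by simp [← h]))).1 ha, fun hb => ?_⟩
      exact ha' ((mem_lowerSide_iff_of_ne hab fun h => h2 a (by simp [← h]) ha).2 hb)
  rcases key hne with h1 | h1 <;> rcases key (Ne.symm hne) with h2 | h2
  · obtain ⟨c, p, h, hc, hp⟩ := exists_ends (root := root) hT e
    refine absurd (Or.inl hc) (notMem_of_forall_adj (root := root) hT
      (Z := {w | w ∈ lowerSide T root e ∨ w ∈ lowerSide T root f}) ?_ ?_ c)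
    · rintro (h | h) <;> exact root_notMem_lowerSide _ h
    · rintro a b hab (ha | ha)
      · by_cases h : s(a, b) = e.1
        · exact Or.inr (h1 b (by simp [← h]))
        · exact Or.inl ((mem_lowerSide_iff_of_ne hab h).1 ha)
      · by_cases h : s(a, b) = f.1
        · exact Or.inl (h2 b (by simp [← h]))
        · exact Or.inr ((mem_lowerSide_iff_of_ne hab h).1 ha)
  · exact Or.inl (sub h1 h2)
  · exact Or.inr (Or.inl (sub h2 h1))
  · refine Or.inr (Or.inr (Finset.disjoint_left.2 fun w hw hw' => ?_))
    refine notMem_of_forall_adj (root := root) hT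
      (Z := {w | w ∈ lowerSide T root e ∧ w ∈ lowerSide T root f}) ?_ ?_ w ⟨hw, hw'⟩
    · rintro ⟨h, _⟩; exact root_notMem_lowerSide _ h
    · rintro a b hab ⟨ha, ha'⟩
      exact ⟨(mem_lowerSide_iff_of_ne hab fun h => h1 a (by simp [← h]) ha').1 ha,
        (mem_lowerSide_iff_of_ne hab fun h => h2 a (by simp [← h]) ha).1 ha'⟩

variable (T root) in
/-- The distance of `v` from the root, as the number of edges that separate them. -/
def depth (v : V) : ℕ := (Finset.univ.filter fun e : T.edgeSet => v ∈ lowerSide T root e).card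

/-- The edges that separate `p` from the root also separate its child `c`, and `e` separates only
`c`. -/
theorem depth_lt {c p : V} {e : T.edgeSet} (hc : e ∈ upEdges T root c)
    (hp : e ∈ downEdges T root p) : depth T root p < depth T root c := by
  obtain ⟨hc1, hc2⟩ := mem_upEdges.1 hc
  obtain ⟨hp1, hp2⟩ := mem_downEdges.1 hp
  have hne : p ≠ c := by rintro rfl; exact hp2 hc2
  have he : e.1 = s(p, c) := (Sym2.mem_and_mem_iff hne).1 ⟨hp1, hc1⟩
  have hadj : T.Adj p c := by
    have := e.2
    rwa [he] at this
  refine Finset.card_lt_card (Finset.ssubset_iff_of_subset ?_ |>.2 ⟨e, ?_, ?_⟩)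
  · intro f hf
    simp only [Finset.mem_filter, Finset.mem_univ, true_and] at hf ⊢
    refine (mem_lowerSide_iff_of_ne hadj fun h => ?_).1 hf
    have : e = f := Subtype.ext (he.trans h)
    rw [← this] at hf
    exact hp2 hf
  · simpa using hc2
  · simpa using hp2

end Graph

/-! ### Iterated partial projections -/

section Kernel

variable {V : Type*} [Fintype V] [DecidableEq V] {κ : V → Type*} [∀ v, Fintype (κ v)]

/-- The reproducing kernel of the span of the functions `b i`. -/
def kern {ι X : Type*} [Fintype ι] (b : ι → X → ℂ) (x z : X) : ℂ := ∑ i, b i x * conj (b i z)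

theorem locProj_eq_kern {ι : Type*} [Fintype ι] (S : Finset V) (b : ι → (∀ v, κ v) → ℂ)
    (f : (∀ v, κ v) → ℂ) (x : ∀ v, κ v) :
    locProj S b f x = 𝔼 z, kern b x z * f (S.piecewise z x) := by
  simp only [locProj, coef, kern, Finset.mul_expect, Finset.sum_mul, Finset.expect_sum_comm,
    mul_assoc]

variable {E : Type*} [DecidableEq E] {S : E → Finset V} {ι : E → Type*} [∀ e, Fintype (ι e)]
  {b : ∀ e, ι e → (∀ v, κ v) → ℂ}

theorem kern_left {e : E} (hb : ∀ i, DependsOn (b e i) (S e : Set V))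
    {x y : ∀ v, κ v} (h : ∀ v ∈ S e, x v = y v) (z : ∀ v, κ v) :
    kern (b e) x z = kern (b e) y z :=
  Finset.sum_congr rfl fun i _ => by rw [hb i fun v hv => h v hv]

theorem kern_right {e : E} (hb : ∀ i, DependsOn (b e i) (S e : Set V))
    {x y : ∀ v, κ v} (h : ∀ v ∈ S e, x v = y v) (z : ∀ v, κ v) :
    kern (b e) z x = kern (b e) z y :=
  Finset.sum_congr rfl fun i _ => by rw [hb i fun v hv => h v hv]

/-- Projections on disjoint sets of coordinates act independently, so a function fixed by each of
them is reproduced by the product of their kernels. -/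
theorem eq_expect_kern [∀ v, Nonempty (κ v)] (hb : ∀ e i, DependsOn (b e i) (S e : Set V))
    (C : Finset E)
    (hd : ∀ e ∈ C, ∀ f ∈ C, e ≠ f → Disjoint (S e) (S f)) {f : (∀ v, κ v) → ℂ}
    (hf : ∀ e ∈ C, locProj (S e) (b e) f = f) (x : ∀ v, κ v) :
    f x = 𝔼 z, (∏ e ∈ C, kern (b e) x z) * f ((C.biUnion S).piecewise z x) := by
  induction C using Finset.induction_on with
  | empty =>
    have : ∀ z, ((∅ : Finset E).biUnion S).piecewise z x = x := fun z => by
      funext v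
      exact Finset.piecewise_eq_of_notMem _ _ _ (by rw [Finset.biUnion_empty]; exact Finset.notMem_empty v)
    simp only [Finset.prod_empty, one_mul, this]
    rw [Fintype.expect_const]
  | insert e C he ih =>
    rw [ih (fun e he e' he' => hd e (Finset.mem_insert_of_mem he) e' (Finset.mem_insert_of_mem he'))
      fun e he => hf e (Finset.mem_insert_of_mem he)]
    have hdis : ∀ e' ∈ C, Disjoint (S e) (S e') := fun e' he' =>
      hd e (Finset.mem_insert_self _ _) e' (Finset.mem_insert_of_mem he')
        (fun h => he (h ▸ he'))
    -- Draw the coordinates in `S e` independently of the others, so that the kernel of `e` can be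
    -- integrated out first.
    conv_rhs => rw [← expect_piecewise (S e), Finset.expect_comm]
    refine Finset.expect_congr rfl fun z _ => ?_
    rw [← hf e (Finset.mem_insert_self _ _), locProj_eq_kern, Finset.mul_expect]
    refine Finset.expect_congr rfl fun z' _ => ?_
    rw [hf e (Finset.mem_insert_self _ _), Finset.prod_insert he]
    have h1 : kern (b e) ((C.biUnion S).piecewise z x) z' = kern (b e) x z' :=
      kern_left (S := S) (hb e) (fun v hv => by
        rw [Finset.piecewise_eq_of_notMem]
        simp only [Finset.mem_biUnion, not_exists, not_and]
        intro e' he' hv'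
        exact Finset.disjoint_left.1 (hdis e' he') hv hv') z'
    have h2 : kern (b e) x ((S e).piecewise z' z) = kern (b e) x z' :=
      kern_right (S := S) (hb e) (fun v hv => by
        rw [Finset.piecewise_eq_of_mem _ _ _ hv]) x
    have h3 : ∏ e' ∈ C, kern (b e') x ((S e).piecewise z' z) = ∏ e' ∈ C, kern (b e') x z :=
      Finset.prod_congr rfl fun e' he' => kern_right (S := S) (hb e') (fun v hv => by
        rw [Finset.piecewise_eq_of_notMem]
        exact Finset.disjoint_right.1 (hdis e' he') hv) x
    have h4 : (S e).piecewise z' ((C.biUnion S).piecewise z x)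
        = ((insert e C).biUnion S).piecewise ((S e).piecewise z' z) x := by
      funext v
      by_cases hv : v ∈ S e
      · simp [hv]
      · by_cases hv' : v ∈ C.biUnion S
        · have : v ∈ (insert e C).biUnion S := by
            rw [Finset.biUnion_insert]; exact Finset.mem_union_right _ hv'
          rw [Finset.piecewise_eq_of_notMem _ _ _ hv, Finset.piecewise_eq_of_mem _ _ _ hv',
            Finset.piecewise_eq_of_mem _ _ _ this, Finset.piecewise_eq_of_notMem _ _ _ hv]
        · have : v ∉ (insert e C).biUnion S := by
            rw [Finset.biUnion_insert, Finset.mem_union]; tauto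
          rw [Finset.piecewise_eq_of_notMem _ _ _ hv, Finset.piecewise_eq_of_notMem _ _ _ hv',
            Finset.piecewise_eq_of_notMem _ _ _ this]
    rw [h1, h2, h3, h4]
    ring

theorem dependsOn_prod {C : Finset E} {h : E → (∀ v, κ v) → ℂ} {R : Set V}
    (hh : ∀ e ∈ C, DependsOn (h e) R) : DependsOn (fun x => ∏ e ∈ C, h e x) R :=
  fun _ _ hxy => Finset.prod_congr rfl fun e he => hh e he hxy

theorem expect_prod_of_disjoint [∀ v, Nonempty (κ v)] (C : Finset E)
    (hd : ∀ e ∈ C, ∀ f ∈ C, e ≠ f → Disjoint (S e) (S f)) {h : E → (∀ v, κ v) → ℂ}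
    (hh : ∀ e, DependsOn (h e) (S e : Set V)) :
    𝔼 x, ∏ e ∈ C, h e x = ∏ e ∈ C, 𝔼 x, h e x := by
  induction C using Finset.induction_on with
  | empty => simp
  | insert e C he ih =>
    have hdis : ∀ e' ∈ C, Disjoint (S e) (S e') := fun e' he' =>
      hd e (Finset.mem_insert_self _ _) e' (Finset.mem_insert_of_mem he')
        (fun h => he (h ▸ he'))
    simp only [Finset.prod_insert he]
    rw [← ih (fun e he e' he' => hd e (Finset.mem_insert_of_mem he) e'
      (Finset.mem_insert_of_mem he'))]
    refine expect_mul_of_dependsOn (hh e) (R := (S e : Set V)ᶜ) (dependsOn_prod fun e' he' => ?_)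
      disjoint_compl_right
    refine (hh e').mono (Set.subset_compl_iff_disjoint_left.2 ?_)
    exact_mod_cast hdis e' he'

theorem expect_prod_finset {Λ : E → Type*} [Fintype E] [∀ e, Fintype (Λ e)] [∀ e, Nonempty (Λ e)]
    (C : Finset E) (h : ∀ e, Λ e → ℂ) :
    𝔼 k : (∀ e, Λ e), ∏ e ∈ C, h e (k e) = ∏ e ∈ C, 𝔼 i, h e i := by
  have := expect_prod_eq (κ := Λ) (h := fun e i => if e ∈ C then h e i else 1)
  have h1 : ∀ k : (∀ e, Λ e), ∏ e, (if e ∈ C then h e (k e) else 1) = ∏ e ∈ C, h e (k e) :=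
    fun k => by rw [Finset.prod_ite_mem, Finset.univ_inter]
  simp only [h1] at this
  rw [this, ← Finset.prod_subset (Finset.subset_univ C)]
  · exact Finset.prod_congr rfl fun e he => by simp [he]
  · intro e _ he
    simp [he]

end Kernel

/-! ### Tree tensor decompositions -/

section TreeTensor

variable {V : Type} [Fintype V] [DecidableEq V] (T : SimpleGraph V) [DecidableRel T.Adj] (root : V)
  {κ : V → Type} [∀ v, Fintype (κ v)] {m : T.edgeSet → ℕ}
  (b : ∀ e, Fin (m e) → (∀ v, κ v) → ℂ) (φ : (∀ v, κ v) → ℂ)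

/-- The basis function attached to the edge above `v`, or `φ` if `v` is the root. -/
def topFun (v : V) (l : ∀ e, Fin (m e)) (x : ∀ v, κ v) : ℂ :=
  (if v = root then φ x else 1) * ∏ e ∈ upEdges T root v, b e (l e) x

/-- The product of the basis functions attached to the edges below `v`. -/
def bottomFun (v : V) (l : ∀ e, Fin (m e)) (x : ∀ v, κ v) : ℂ :=
  ∏ e ∈ downEdges T root v, b e (l e) x

/-- The tensor at the vertex `v` of the tree tensor decomposition of `φ`. -/
def treeTensor (v : V) (y : κ v) (l : ∀ e, Fin (m e)) : ℂ :=
  (∏ e ∈ downEdges T root v, (m e : ℂ)) *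
    𝔼 z, conj (bottomFun T root b v l z) * topFun T root b φ v l (Function.update z v y)

/-- Orthonormal bases of the spaces spanned by the slices of `φ` along the edges, each of which
is compatible with those below it. -/
structure IsTreeBasis : Prop where
  dependsOn : ∀ e i, DependsOn (b e i) (lowerSide T root e : Set V)
  orthonormal : ∀ e, OrthonormalFamily (b e)
  locProj_eq : ∀ e, locProj (lowerSide T root e) (b e) φ = φ
  locProj_basis : ∀ e f, lowerSide T root e ⊆ lowerSide T root f → ∀ i,
    locProj (lowerSide T root e) (b e) (b f i) = b f i

variable {T root b φ}

theorem topFun_root (l : ∀ e, Fin (m e)) : topFun T root b φ root l = φ := by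
  funext x
  simp [topFun, upEdges_root]

theorem topFun_of_mem (hT : T.IsTree) {v : V} {e : T.edgeSet} (he : e ∈ upEdges T root v)
    (l : ∀ e, Fin (m e)) : topFun T root b φ v l = b e (l e) := by
  have hv : v ≠ root := by
    rintro rfl
    rw [upEdges_root] at he
    exact absurd he (Finset.notMem_empty _)
  have : upEdges T root v = {e} := Finset.eq_singleton_iff_unique_mem.2
    ⟨he, fun f hf => upEdges_unique hT hf he⟩
  funext x
  simp [topFun, hv, this]

theorem topFun_congr (v : V) {l l' : ∀ e, Fin (m e)} (h : ∀ e ∈ upEdges T root v, l e = l' e) :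
    topFun T root b φ v l = topFun T root b φ v l' := by
  funext x
  unfold topFun
  congr 1
  exact Finset.prod_congr rfl fun e he => by rw [h e he]

theorem bottomFun_congr (v : V) {l l' : ∀ e, Fin (m e)} (h : ∀ e ∈ downEdges T root v, l e = l' e) :
    bottomFun T root b v l = bottomFun T root b v l' := by
  funext x
  exact Finset.prod_congr rfl fun e he => by rw [h e he]

theorem dependsOn_treeTensor (v : V) (y : κ v) :
    DependsOn (treeTensor T root b φ v y) {e | v ∈ e.1} := fun l l' h => by
  unfold treeTensor
  rw [topFun_congr v fun e he => h e (mem_upEdges.1 he).1,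
    bottomFun_congr v fun e he => h e (mem_downEdges.1 he).1]

theorem locProj_topFun (hT : T.IsTree) (hb : IsTreeBasis T root b φ) {v : V} {e : T.edgeSet}
    (he : e ∈ downEdges T root v) (l : ∀ e, Fin (m e)) :
    locProj (lowerSide T root e) (b e) (topFun T root b φ v l) = topFun T root b φ v l := by
  by_cases hv : v = root
  · subst hv
    rw [topFun_root]
    exact hb.locProj_eq e
  · obtain ⟨f, hf⟩ := exists_mem_upEdges hT hv
    rw [topFun_of_mem hT hf]
    exact hb.locProj_basis e f (lowerSide_subset hT he hf) _

/-- The function above `v` sees only `v` and the subtrees of its children; for the root these are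
all the vertices. -/
theorem topFun_eq_of_agree (hT : T.IsTree) (hb : IsTreeBasis T root b φ) {v : V}
    (l : ∀ e, Fin (m e)) {x y : ∀ v, κ v} (hv : x v = y v)
    (h : ∀ w ∈ (downEdges T root v).biUnion (lowerSide T root), x w = y w) :
    topFun T root b φ v l x = topFun T root b φ v l y := by
  by_cases hr : v = root
  · have : x = y := by
      funext w
      by_cases hw : w = v
      · rw [hw, hv]
      · obtain ⟨e, he, hwe⟩ := exists_mem_lowerSide_of_ne (root := root) hT hw
          (fun e he => by
            rw [hr, upEdges_root] at he; exact absurd he (Finset.notMem_empty _))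
          (fun h => absurd hr h)
        exact h w (Finset.mem_biUnion.2 ⟨e, he, hwe⟩)
    rw [this]
  · obtain ⟨f, hf⟩ := exists_mem_upEdges hT hr
    rw [topFun_of_mem hT hf]
    refine hb.dependsOn f _ fun w hw => ?_
    by_cases hwv : w = v
    · rw [hwv, hv]
    · obtain ⟨e, he, hwe⟩ := exists_mem_lowerSide_of_ne (root := root) hT hwv
          (fun e he => by rw [upEdges_unique hT he hf]; exact hw)
          (fun _ => ⟨f, hf⟩)
      exact h w (Finset.mem_biUnion.2 ⟨e, he, hwe⟩)

theorem notMem_biUnion_down (v : V) :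
    v ∉ (downEdges T root v).biUnion (lowerSide T root) := by
  simp only [Finset.mem_biUnion, not_exists, not_and]
  exact fun e he => (mem_downEdges.1 he).2

variable [∀ v, Nonempty (κ v)] [∀ e, NeZero (m e)]

/-- One step of the decomposition: the function above `v` is expanded in products of the basis
functions below `v`, and the coefficients are the tensor at `v`. -/
theorem topFun_eq_expect (hT : T.IsTree) (hb : IsTreeBasis T root b φ) (v : V)
    (l : ∀ e, Fin (m e)) (x : ∀ v, κ v) :
    topFun T root b φ v l x = 𝔼 k : (∀ e, Fin (m e)),
      treeTensor T root b φ v (x v) ((downEdges T root v).piecewise k l) *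
        bottomFun T root b v k x := by
  have h1 : ∀ k : (∀ e, Fin (m e)),
      treeTensor T root b φ v (x v) ((downEdges T root v).piecewise k l) *
        bottomFun T root b v k x = 𝔼 z, (∏ e ∈ downEdges T root v,
          ((m e : ℂ) * (b e (k e) x * conj (b e (k e) z)))) *
            topFun T root b φ v l (Function.update z v (x v)) := by
    intro k
    unfold treeTensor
    rw [topFun_congr v (l' := l) fun e he => Finset.piecewise_eq_of_notMem _ _ _
        (Finset.disjoint_left.1 (disjoint_up_down v) he),
      bottomFun_congr v (l' := k) fun e he => Finset.piecewise_eq_of_mem _ _ _ he,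
      Finset.mul_expect, Finset.expect_mul]
    refine Finset.expect_congr rfl fun z _ => ?_
    simp only [bottomFun, map_prod, Finset.prod_mul_distrib]
    ring
  simp only [h1]
  rw [Finset.expect_comm, eq_expect_kern hb.dependsOn (downEdges T root v)
    (fun e he f hf hne => disjoint_lowerSide hT he hf hne)
    (fun e he => locProj_topFun hT hb he l) x]
  refine Finset.expect_congr rfl fun z _ => ?_
  rw [← Finset.expect_mul, expect_prod_finset (downEdges T root v)
    (fun e i => (m e : ℂ) * (b e i x * conj (b e i z)))]
  congr 1
  -- The factor `m e` in `treeTensor` turns the average over the labels of `e` into the sum that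
  -- defines the kernel.
  · refine Finset.prod_congr rfl fun e _ => ?_
    rw [kern, Fintype.expect_eq_sum_div_card, ← Finset.mul_sum, Fintype.card_fin,
      mul_div_cancel_left₀]
    exact_mod_cast NeZero.ne (m e)
  · refine topFun_eq_of_agree hT hb l ?_ fun w hw => ?_
    · rw [Finset.piecewise_eq_of_notMem _ _ _ (notMem_biUnion_down v), Function.update_self]
    · rw [Finset.piecewise_eq_of_mem _ _ _ hw, Function.update_of_ne]
      rintro rfl
      exact notMem_biUnion_down w hw

theorem ip_topFun (hT : T.IsTree) (hb : IsTreeBasis T root b φ) (hφ : ip φ φ = 1) (v : V)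
    (l l' : ∀ e, Fin (m e)) : ip (topFun T root b φ v l) (topFun T root b φ v l')
      = ∏ e ∈ upEdges T root v, if l e = l' e then 1 else 0 := by
  by_cases hr : v = root
  · subst hr
    rw [topFun_root, topFun_root, upEdges_root, hφ, Finset.prod_empty]
  · obtain ⟨f, hf⟩ := exists_mem_upEdges hT hr
    have : upEdges T root v = {f} := Finset.eq_singleton_iff_unique_mem.2
      ⟨hf, fun f' hf' => upEdges_unique hT hf' hf⟩
    rw [topFun_of_mem hT hf, topFun_of_mem hT hf, this, Finset.prod_singleton, hb.orthonormal f]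

theorem ip_bottomFun (hT : T.IsTree) (hb : IsTreeBasis T root b φ) (v : V)
    (k k' : ∀ e, Fin (m e)) : ip (bottomFun T root b v k) (bottomFun T root b v k')
      = ∏ e ∈ downEdges T root v, if k e = k' e then 1 else 0 := by
  have h1 : ∀ x, conj (bottomFun T root b v k x) * bottomFun T root b v k' x
      = ∏ e ∈ downEdges T root v, (conj (b e (k e) x) * b e (k' e) x) := fun x => by
    rw [Finset.prod_mul_distrib, bottomFun, bottomFun, map_prod]
  simp only [ip, h1]
  rw [expect_prod_of_disjoint (S := lowerSide T root) (h := fun e x => conj (b e (k e) x) * b e (k' e) x) (downEdges T root v)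
    (fun e he f hf hne => disjoint_lowerSide hT he hf hne)
    (fun e => dependsOn_mul (dependsOn_conj (hb.dependsOn e _)) (hb.dependsOn e _))]
  exact Finset.prod_congr rfl fun e _ => hb.orthonormal e _ _

theorem dependsOn_bottomFun (hb : IsTreeBasis T root b φ) (v : V) (k : ∀ e, Fin (m e)) :
    DependsOn (bottomFun T root b v k) ({v}ᶜ : Set V) := by
  refine dependsOn_prod fun e he => (hb.dependsOn e _).mono fun w hw => ?_
  rintro rfl
  exact (mem_downEdges.1 he).2 (Finset.mem_coe.1 hw)

theorem expect_delta_mul {E : Type*} [Fintype E] [DecidableEq E] {n : E → ℕ} [∀ e, NeZero (n e)]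
    (C : Finset E) (k l : ∀ e, Fin (n e)) (B : (∀ e, Fin (n e)) → ℂ) :
    𝔼 k' : (∀ e, Fin (n e)), (∏ e ∈ C, if k e = k' e then 1 else 0) * B (C.piecewise k' l)
      = (∏ e ∈ C, (n e : ℂ))⁻¹ * B (C.piecewise k l) := by
  have h1 : ∀ k' : (∀ e, Fin (n e)),
      (∏ e ∈ C, if k e = k' e then (1 : ℂ) else 0) * B (C.piecewise k' l)
      = (∏ e ∈ C, if k e = k' e then (1 : ℂ) else 0) * B (C.piecewise k l) := by
    intro k'
    by_cases h : ∀ e ∈ C, k e = k' e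
    · congr 2
      exact Finset.piecewise_congr _ (fun e he => (h e he).symm) fun _ _ => rfl
    · push Not at h
      obtain ⟨e, he, hne⟩ := h
      rw [Finset.prod_eq_zero he (by simp [hne])]
      simp
  simp only [h1]
  rw [← Finset.expect_mul, expect_prod_finset C (fun e i => if k e = i then (1 : ℂ) else 0)]
  congr 1
  rw [← Finset.prod_inv_distrib]
  refine Finset.prod_congr rfl fun e _ => ?_
  rw [Fintype.expect_eq_sum_div_card]
  simp

/-- Expand the inner product of two functions above `v`. The coordinate `v` is independent of the
subtrees below it, and the products of basis functions on those are orthonormal, which leaves the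
Gram matrix of the tensor. The constant appears because labels are averaged rather than summed. -/
theorem treeTensor_isometry (hT : T.IsTree) (hb : IsTreeBasis T root b φ) (hφ : ip φ φ = 1) (v : V)
    (l l' : ∀ e, Fin (m e)) :
    𝔼 y : κ v, 𝔼 k : (∀ e, Fin (m e)),
      conj (treeTensor T root b φ v y ((downEdges T root v).piecewise k l)) *
        treeTensor T root b φ v y ((downEdges T root v).piecewise k l')
      = (∏ e ∈ downEdges T root v, (m e : ℂ)) *
        ∏ e ∈ upEdges T root v, if l e = l' e then 1 else 0 := by
  have h0 : (∏ e ∈ downEdges T root v, (m e : ℂ)) ≠ 0 :=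
    Finset.prod_ne_zero_iff.2 fun e _ => by exact_mod_cast NeZero.ne (m e)
  rw [← ip_topFun hT hb hφ v l l', ip]
  have h1 : ∀ x, conj (topFun T root b φ v l x) * topFun T root b φ v l' x
      = 𝔼 k, 𝔼 k', (conj (treeTensor T root b φ v (x v) ((downEdges T root v).piecewise k l)) *
        treeTensor T root b φ v (x v) ((downEdges T root v).piecewise k' l')) *
        (conj (bottomFun T root b v k x) * bottomFun T root b v k' x) := by
    intro x
    rw [topFun_eq_expect hT hb v l, topFun_eq_expect hT hb v l', conj_expect,
      Finset.expect_mul_expect]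
    refine Finset.expect_congr rfl fun k _ => Finset.expect_congr rfl fun k' _ => ?_
    rw [map_mul]; ring
  simp only [h1]
  conv_rhs => rw [Finset.expect_comm]
  have h2 : ∀ k, 𝔼 x : (∀ v, κ v), 𝔼 k' : (∀ e, Fin (m e)),
      (conj (treeTensor T root b φ v (x v) ((downEdges T root v).piecewise k l)) *
        treeTensor T root b φ v (x v) ((downEdges T root v).piecewise k' l')) *
        (conj (bottomFun T root b v k x) * bottomFun T root b v k' x)
      = (∏ e ∈ downEdges T root v, (m e : ℂ))⁻¹ * 𝔼 y : κ v,
        conj (treeTensor T root b φ v y ((downEdges T root v).piecewise k l)) *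
        treeTensor T root b φ v y ((downEdges T root v).piecewise k l') := by
    intro k
    rw [Finset.expect_comm]
    have h3 : ∀ k' : (∀ e, Fin (m e)), 𝔼 x : (∀ v, κ v),
        (conj (treeTensor T root b φ v (x v) ((downEdges T root v).piecewise k l)) *
        treeTensor T root b φ v (x v) ((downEdges T root v).piecewise k' l')) *
        (conj (bottomFun T root b v k x) * bottomFun T root b v k' x)
      = (∏ e ∈ downEdges T root v, if k e = k' e then 1 else 0) * 𝔼 y : κ v,
        conj (treeTensor T root b φ v y ((downEdges T root v).piecewise k l)) *
        treeTensor T root b φ v y ((downEdges T root v).piecewise k' l') := by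
      intro k'
      rw [expect_mul_of_dependsOn (S := {v}) (R := {v}ᶜ), mul_comm]
      · congr 1
        · exact ip_bottomFun hT hb v k k'
        · exact expect_eval v (fun y =>
            conj (treeTensor T root b φ v y ((downEdges T root v).piecewise k l)) *
            treeTensor T root b φ v y ((downEdges T root v).piecewise k' l'))
      · intro x y h
        have : x v = y v := h v (by simp)
        simp only [this]
      · exact dependsOn_mul (dependsOn_conj (dependsOn_bottomFun hb v k))
          (dependsOn_bottomFun hb v k')
      · simp
    simp only [h3]
    exact expect_delta_mul (downEdges T root v) k l' (fun q => 𝔼 y : κ v,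
        conj (treeTensor T root b φ v y ((downEdges T root v).piecewise k l)) *
        treeTensor T root b φ v y q)
  simp only [h2]
  rw [← Finset.mul_expect, mul_inv_cancel_left₀ h0, Finset.expect_comm]

end TreeTensor

/-! ### Contraction of the tree tensors, and existence of compatible bases. -/

section TreeTensor

variable {V : Type} [Fintype V] [DecidableEq V] {T : SimpleGraph V} [DecidableRel T.Adj] {root : V}
  {κ : V → Type} [∀ v, Fintype (κ v)] {m : T.edgeSet → ℕ}
  {b : ∀ e, Fin (m e) → (∀ v, κ v) → ℂ} {φ : (∀ v, κ v) → ℂ}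

variable (root b) in
/-- What is left of the edge `e` when the tensors of the vertices in `s` have been split off. -/
def edgeRest (s : Finset V) (l : ∀ e, Fin (m e)) (x : ∀ v, κ v) (e : T.edgeSet) : ℂ :=
  open Classical in
  if ∃ v ∈ s, e ∈ upEdges T root v then 1
  else if ∃ v ∈ s, e ∈ downEdges T root v then b e (l e) x else 1

/-- Tensors are split off from the root downwards. The closure condition says that `s` contains the
parents of its vertices; then what remains is one basis function per edge leaving `s` downwards, or
`φ` itself as long as the root has not been treated. -/
theorem eq_expect_prod_treeTensor_aux [∀ v, Nonempty (κ v)] [∀ e, NeZero (m e)]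
    (hT : T.IsTree) (hb : IsTreeBasis T root b φ) (x : ∀ v, κ v) (s : Finset V) :
    (∀ e v w, e ∈ upEdges T root v → e ∈ downEdges T root w → v ∈ s → w ∈ s) →
    φ x = 𝔼 l : (∀ e, Fin (m e)), (∏ v ∈ s, treeTensor T root b φ v (x v) l) *
      ((if root ∈ s then 1 else φ x) * ∏ e, edgeRest root b s l x e) := by
  -- The deepest vertex is added last, so that none of its children has been treated yet.
  induction s using Finset.induction_on_max_value (depth T root) with
  | empty =>
    intro _
    simp [edgeRest]
  | insert a s ha hmax ih =>
    intro hcl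
    have hs : ∀ e v w, e ∈ upEdges T root v → e ∈ downEdges T root w → v ∈ s → w ∈ s := by
      intro e v w hv hw hvs
      rcases Finset.mem_insert.1 (hcl e v w hv hw (Finset.mem_insert_of_mem hvs)) with rfl | h
      · exact absurd (hmax v hvs) (not_le.2 (depth_lt hv hw))
      · exact h
    refine (ih hs).trans ?_
    set D := downEdges T root a with hD
    set U := upEdges T root a with hU
    have hUD : Disjoint U D := disjoint_up_down a
    let C : (∀ e, Fin (m e)) → ℂ := fun l => (if root ∈ s ∨ root = a then 1 else φ x) *
      ∏ e ∈ (U ∪ D)ᶜ, edgeRest root b s l x e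
    have hsplit : ∀ r : T.edgeSet → ℂ, ∏ e, r e = (∏ e ∈ (U ∪ D)ᶜ, r e) *
        ((∏ e ∈ U, r e) * ∏ e ∈ D, r e) := fun r => by
      rw [← Finset.prod_union hUD, mul_comm, Finset.prod_mul_prod_compl]
    -- children of `a` are not in `s`
    have hchild : ∀ e ∈ D, ¬ ∃ v ∈ s, e ∈ upEdges T root v := by
      rintro e he ⟨v, hv, hev⟩
      exact absurd (hmax v hv) (not_le.2 (depth_lt hev he))
    have hold : ∀ l, (if root ∈ s then 1 else φ x) * ∏ e, edgeRest root b s l x e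
        = C l * topFun T root b φ a l x := by
      intro l
      have hDone : ∏ e ∈ D, edgeRest root b s l x e = 1 := Finset.prod_eq_one fun e he => by
        rw [edgeRest, if_neg (hchild e he), if_neg]
        rintro ⟨v, hv, hev⟩
        exact ha (eq_of_mem_downEdges hT he hev ▸ hv)
      have hUone : ∏ e ∈ U, edgeRest root b s l x e = ∏ e ∈ U, b e (l e) x :=
        Finset.prod_congr rfl fun e he => by
          rw [edgeRest, if_neg, if_pos]
          · obtain ⟨p, hp⟩ := exists_mem_downEdges (root := root) hT e
            refine ⟨p, ?_, hp⟩
            rcases Finset.mem_insert.1 (hcl e a p he hp (Finset.mem_insert_self _ _)) with h | h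
            · rw [h] at hp
              exact absurd hp (Finset.disjoint_left.1 hUD he)
            · exact h
          · rintro ⟨v, hv, hev⟩
            exact ha (eq_of_mem_upEdges hT he hev ▸ hv)
      rw [hsplit, hDone, hUone, topFun]
      have hr : (if root ∈ s then 1 else φ x) = (if root ∈ s ∨ root = a then 1 else φ x) *
          (if a = root then φ x else 1) := by
        by_cases h : a = root
        · subst h; simp [ha]
        · simp [h, Ne.symm h]
      rw [hr]
      simp only [C]
      ring
    have hnew : ∀ l, (if root ∈ insert a s then 1 else φ x) *
        ∏ e, edgeRest root b (insert a s) l x e = C l * bottomFun T root b a l x := by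
      intro l
      have hDone : ∏ e ∈ D, edgeRest root b (insert a s) l x e = ∏ e ∈ D, b e (l e) x :=
        Finset.prod_congr rfl fun e he => by
          rw [edgeRest, if_neg, if_pos]
          · exact ⟨a, Finset.mem_insert_self _ _, he⟩
          · rintro ⟨v, hv, hev⟩
            rcases Finset.mem_insert.1 hv with rfl | hv
            · exact Finset.disjoint_left.1 hUD hev he
            · exact hchild e he ⟨v, hv, hev⟩
      have hUone : ∏ e ∈ U, edgeRest root b (insert a s) l x e = 1 :=
        Finset.prod_eq_one fun e he => by
          rw [edgeRest, if_pos ⟨a, Finset.mem_insert_self _ _, he⟩]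
      have hrest : ∏ e ∈ (U ∪ D)ᶜ, edgeRest root b (insert a s) l x e
          = ∏ e ∈ (U ∪ D)ᶜ, edgeRest root b s l x e :=
        Finset.prod_congr rfl fun e he => by
          have he' : e ∉ U ∧ e ∉ D := by simpa using he
          have h1 : (∃ v ∈ insert a s, e ∈ upEdges T root v) ↔ ∃ v ∈ s, e ∈ upEdges T root v := by
            simp [← hU, he'.1]
          have h2 : (∃ v ∈ insert a s, e ∈ downEdges T root v)
              ↔ ∃ v ∈ s, e ∈ downEdges T root v := by
            simp [← hD, he'.2]
          simp only [edgeRest, h1, h2]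
      rw [hsplit, hDone, hUone, hrest, bottomFun]
      have hr : (root ∈ insert a s) ↔ (root ∈ s ∨ root = a) := by
        rw [Finset.mem_insert, or_comm]
      simp only [hr, C]
      ring
    let H : (∀ e, Fin (m e)) → ℂ := fun l => (∏ v ∈ s, treeTensor T root b φ v (x v) l) * C l
    -- The labels of the edges below `a` occur in none of the other factors, so they can be averaged
    -- separately.
    have hH : ∀ k l : (∀ e, Fin (m e)), H (D.piecewise k l) = H l := by
      intro k l
      refine congrArg₂ (· * ·) ?_ (congrArg₂ (· * ·) rfl ?_)
      · refine Finset.prod_congr rfl fun v hv => dependsOn_treeTensor v (x v) fun e he => ?_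
        refine Finset.piecewise_eq_of_notMem _ _ _ fun heD => ?_
        have he' : v ∈ e.1 := he
        rcases mem_up_or_down (root := root) he' with h | h
        · exact hchild e heD ⟨v, hv, h⟩
        · exact ha (eq_of_mem_downEdges hT heD h ▸ hv)
      · refine Finset.prod_congr rfl fun e he => ?_
        have he' : e ∉ U ∧ e ∉ D := by simpa using he
        simp only [edgeRest, Finset.piecewise_eq_of_notMem _ _ _ he'.2]
    have hmid : 𝔼 l, H l * topFun T root b φ a l x
        = 𝔼 l, H l * (treeTensor T root b φ a (x a) l * bottomFun T root b a l x) := by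
      rw [← expect_piecewise D (fun l => H l * (treeTensor T root b φ a (x a) l *
            bottomFun T root b a l x)), Finset.expect_comm]
      refine Finset.expect_congr rfl fun l _ => ?_
      rw [topFun_eq_expect hT hb a l x, Finset.mul_expect]
      refine Finset.expect_congr rfl fun k _ => ?_
      rw [hH, bottomFun_congr a (l := D.piecewise k l) (l' := k)
        fun e he => Finset.piecewise_eq_of_mem _ _ _ he]
    refine Eq.trans (Finset.expect_congr rfl fun l _ => ?_)
      (hmid.trans (Finset.expect_congr rfl fun l _ => ?_))
    · rw [hold l, ← mul_assoc]
    · rw [hnew l, Finset.prod_insert ha]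
      change (∏ v ∈ s, treeTensor T root b φ v (x v) l) * C l * _ = _
      ring

theorem exists_mem_upEdges_edge (hT : T.IsTree) (e : T.edgeSet) :
    ∃ v, e ∈ upEdges T root v := by
  obtain ⟨c, p, h, hc, _⟩ := exists_ends (root := root) hT e
  exact ⟨c, mem_upEdges.2 ⟨by rw [h]; simp, hc⟩⟩

theorem eq_expect_prod_treeTensor [∀ v, Nonempty (κ v)] [∀ e, NeZero (m e)]
    (hT : T.IsTree) (hb : IsTreeBasis T root b φ) (x : ∀ v, κ v) :
    φ x = 𝔼 l : (∀ e, Fin (m e)), ∏ v, treeTensor T root b φ v (x v) l := by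
  rw [eq_expect_prod_treeTensor_aux hT hb x Finset.univ fun _ _ w _ _ _ => Finset.mem_univ w]
  refine Finset.expect_congr rfl fun l _ => ?_
  have : ∀ e, edgeRest root b Finset.univ l x e = 1 := fun e => by
    obtain ⟨v, hv⟩ := exists_mem_upEdges_edge (root := root) hT e
    rw [edgeRest, if_pos ⟨v, Finset.mem_univ v, hv⟩]
  simp [this]

variable (T root) in
-- Bases of the slice spaces are automatically compatible, because a slice of a slice of `φ` is a
-- slice of `φ`.
theorem exists_isTreeBasis (φ : (∀ v, κ v) → ℂ) :
    ∃ b : ∀ e : T.edgeSet, Fin (Module.finrank ℂ (sliceSpan (lowerSide T root e) φ)) →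
      (∀ v, κ v) → ℂ, IsTreeBasis T root b φ := by
  choose b hbm hbo hbs using fun e : T.edgeSet =>
    exists_orthonormalFamily (sliceSpan (lowerSide T root e) φ)
  have hslice : ∀ e y, (fun x => φ ((lowerSide T root e).piecewise x y))
      ∈ sliceSpan (lowerSide T root e) φ := fun e y => Submodule.subset_span ⟨y, rfl⟩
  refine ⟨b, fun e i => dependsOn_of_mem_sliceSpan (hbm e i), hbo, fun e => ?_, ?_⟩
  · exact locProj_eq_self fun y x => hbs e _ (hslice e y) x
  · intro e f hef i
    have key : ∀ y, ∀ g ∈ sliceSpan (lowerSide T root f) φ,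
        (fun x => g ((lowerSide T root e).piecewise x y)) ∈ sliceSpan (lowerSide T root e) φ := by
      intro y g hg
      induction hg using Submodule.span_induction with
      | mem g hg =>
        obtain ⟨z, rfl⟩ := hg
        -- Outside the smaller side, the fixed coordinates come from `y` within the larger side and
        -- from `z` beyond it.
        have := hslice e ((lowerSide T root f).piecewise y z)
        convert this using 3 with x
        funext v
        by_cases hv : v ∈ lowerSide T root e
        · simp [hv, hef hv]
        · by_cases hv' : v ∈ lowerSide T root f <;> simp [hv, hv']
      | zero => exact Submodule.zero_mem _
      | add g h _ _ hg hh => exact Submodule.add_mem _ hg hh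
      | smul c g _ hg => exact Submodule.smul_mem _ c hg
    exact locProj_eq_self fun y x =>
      hbs e (fun z => b f i ((lowerSide T root e).piecewise z y)) (key y _ (hbm f i)) x

end TreeTensor

/-! ### Product operators and LOCC -/

section LOCC

variable {V : Type} [Fintype V] [DecidableEq V]

theorem localOp_mul {ι κ μ : V → Type} [∀ v, Fintype (κ v)]
    (C : ∀ v, Matrix (μ v) (κ v) ℂ) (B : ∀ v, Matrix (κ v) (ι v) ℂ) :
    localOp C * localOp B = localOp fun v => C v * B v := by
  ext y x
  simp only [localOp, Matrix.mul_apply, Matrix.of_apply, ← Finset.prod_mul_distrib]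
  rw [Finset.prod_univ_sum, Fintype.piFinset_univ]

theorem localOp_conjTranspose {ι κ : V → Type} (A : ∀ v, Matrix (κ v) (ι v) ℂ) :
    (localOp A).conjTranspose = localOp fun v => (A v).conjTranspose := by
  ext y x
  simp [localOp, Matrix.conjTranspose_apply]

theorem sum_localOp {ι κ J : V → Type} [∀ v, Fintype (J v)]
    (F : ∀ v, J v → Matrix (κ v) (ι v) ℂ) :
    ∑ j : (∀ v, J v), localOp (fun v => F v (j v)) = localOp fun v => ∑ i, F v i := by
  ext y x
  simp only [localOp, Matrix.sum_apply, Matrix.of_apply]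
  rw [Finset.prod_univ_sum, Fintype.piFinset_univ]

theorem localOp_one {ι : V → Type} [∀ v, DecidableEq (ι v)] :
    localOp (fun v => (1 : Matrix (ι v) (ι v) ℂ)) = 1 := by
  ext y x
  simp only [localOp, Matrix.of_apply, Matrix.one_apply]
  by_cases h : y = x
  · subst h; simp
  · rw [if_neg h]
    obtain ⟨v, hv⟩ := Function.ne_iff.1 h
    exact Finset.prod_eq_zero (Finset.mem_univ v) (if_neg hv)

theorem sum_localOp_measurement {ι κ J : V → Type} [∀ v, Fintype (ι v)] [∀ v, DecidableEq (ι v)]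
    [∀ v, Fintype (κ v)] [∀ v, Fintype (J v)]
    {A : ∀ v, J v → Matrix (κ v) (ι v) ℂ} (hA : ∀ v, IsMeasurement (A v)) :
    ∑ j : (∀ v, J v), (localOp fun v => A v (j v)).conjTranspose * localOp (fun v => A v (j v))
      = 1 := by
  have : ∀ j : (∀ v, J v), (localOp fun v => A v (j v)).conjTranspose *
      localOp (fun v => A v (j v)) = localOp fun v => (A v (j v)).conjTranspose * A v (j v) :=
    fun j => by rw [localOp_conjTranspose, localOp_mul]
  simp only [this]
  rw [sum_localOp (fun v i => (A v i).conjTranspose * A v i), ← localOp_one]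
  congr 1
  funext v
  exact hA v

/-- LOCC operations are separable. -/
theorem IsLOCCRounds.exists_separable (r : ℕ) : ∀ {ι κ : V → Type} [∀ v, Fintype (ι v)]
    [∀ v, DecidableEq (ι v)] [∀ v, Fintype (κ v)]
    {Γ : Matrix (∀ v, ι v) (∀ v, ι v) ℂ → Matrix (∀ v, κ v) (∀ v, κ v) ℂ},
    IsLOCCRounds r ι κ Γ → ∃ (I : Type) (_ : Fintype I) (A : I → ∀ v, Matrix (κ v) (ι v) ℂ),
      (∑ i, (localOp (A i)).conjTranspose * localOp (A i) = 1) ∧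
      ∀ ρ, Γ ρ = ∑ i, localOp (A i) * ρ * (localOp (A i)).conjTranspose := by
  induction r with
  | zero =>
    rintro ι κ _ _ _ Γ ⟨J, A, hA, hΓ⟩
    exact ⟨∀ v, Fin (J v), inferInstance, fun j v => A v (j v), sum_localOp_measurement hA, hΓ⟩
  | succ r ih =>
    rintro ι κ _ _ _ Γ ⟨J, k, A, Λ, hA, hΛ, hΓ⟩
    choose I hI B hB hBΛ using fun j => ih (hΛ j)
    refine ⟨Σ j, I j, inferInstance, fun p v => B p.1 p.2 v * A v (p.1 v), ?_, fun ρ => ?_⟩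
    · rw [← sum_localOp_measurement hA, Fintype.sum_sigma]
      refine Finset.sum_congr rfl fun j _ => ?_
      have : ∀ i, (localOp fun v => B j i v * A v (j v)).conjTranspose *
          localOp (fun v => B j i v * A v (j v)) = (localOp fun v => A v (j v)).conjTranspose *
            ((localOp (B j i)).conjTranspose * localOp (B j i)) *
              localOp (fun v => A v (j v)) := fun i => by
        rw [← localOp_mul, Matrix.conjTranspose_mul]
        simp only [Matrix.mul_assoc]
      simp only [this]
      rw [← Matrix.sum_mul, ← Matrix.mul_sum, hB, Matrix.mul_one]
    · rw [hΓ, Fintype.sum_sigma]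
      refine Finset.sum_congr rfl fun j _ => ?_
      rw [hBΛ]
      refine Finset.sum_congr rfl fun i _ => ?_
      rw [← localOp_mul, Matrix.conjTranspose_mul]
      simp only [Matrix.mul_assoc]

/-- If each party performs one measurement, which depends on the outcomes of the parties of
smaller rank only, then the resulting operation is LOCC. -/
theorem isLOCCRounds_of_adaptive (r : ℕ) : ∀ {ι κ : V → Type} [∀ v, Fintype (ι v)]
    [∀ v, DecidableEq (ι v)] [∀ v, Fintype (κ v)] (J rank : V → ℕ) [∀ v, NeZero (J v)]
    (A : ∀ v, (∀ w, Fin (J w)) → Fin (J v) → Matrix (κ v) (ι v) ℂ), (∀ v, rank v ≤ r) →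
    (∀ v j j', (∀ w, rank w < rank v → j w = j' w) → A v j = A v j') →
    (∀ v j, IsMeasurement (A v j)) →
    IsLOCCRounds r ι κ fun ρ => ∑ j : (∀ v, Fin (J v)),
      localOp (fun v => A v j (j v)) * ρ * (localOp fun v => A v j (j v)).conjTranspose := by
  induction r with
  | zero =>
    intro ι κ _ _ _ J rank _ A hr hdep hA
    -- No party has smaller rank, so the dependence on earlier outcomes is void and `0` can serve as
    -- the outcome tuple.
    have h0 : ∀ v j, A v j = A v 0 := fun v j => hdep v j 0 fun w hw =>
      absurd (Nat.le_zero.1 (hr v)) (Nat.ne_of_gt (Nat.zero_lt_of_lt hw))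
    refine ⟨J, fun v => A v 0, fun v => hA v 0, fun ρ => ?_⟩
    simp only [h0]
  | succ r ih =>
    intro ι κ _ _ _ J rank _ A hr hdep hA
    -- Split each measurement into a part `B` made in this round and a part `C` made later. For rank
    -- `0`, `B` is the whole measurement and `C` the identity; otherwise it is the other way round.
    -- Relabelling bases by `Fin k` fits the intermediate spaces to the definition of LOCC.
    have hex : ∀ v, ∃ (J₁ J₂ k : ℕ) (e : Fin J₁ × Fin J₂ ≃ Fin (J v))
        (B : Fin J₁ → Matrix (Fin k) (ι v) ℂ)
        (C : (∀ w, Fin (J w)) → Fin J₂ → Matrix (κ v) (Fin k) ℂ), J₂ ≠ 0 ∧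
        IsMeasurement B ∧ (∀ j, IsMeasurement (C j)) ∧
        (∀ j i₁ i₂, C j i₂ * B i₁ = A v j (e (i₁, i₂))) ∧
        (∀ j j', (∀ w, rank w < rank v → j w = j' w) → C j = C j') ∧
        (rank v = 0 → J₂ = 1 ∧ ∀ j j', C j = C j') := by
      intro v
      by_cases hv : rank v = 0
      · let eκ := Fintype.equivFin (κ v)
        have h0 : ∀ j, A v j = A v 0 := fun j => hdep v j 0 fun w hw =>
          absurd hv (Nat.ne_of_gt (Nat.zero_lt_of_lt hw))
        refine ⟨J v, 1, Fintype.card (κ v), Equiv.prodUnique _ _,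
          fun i => (A v 0 i).submatrix eκ.symm id,
          fun _ _ => (1 : Matrix (Fin (Fintype.card (κ v))) (Fin (Fintype.card (κ v))) ℂ).submatrix
            eκ id, one_ne_zero, ?_, ?_, ?_, fun _ _ _ => rfl, fun _ => ⟨rfl, fun _ _ => rfl⟩⟩
        · have := hA v 0
          unfold IsMeasurement at this ⊢
          rw [← this]
          refine Finset.sum_congr rfl fun i _ => ?_
          rw [Matrix.conjTranspose_submatrix, Matrix.submatrix_mul_equiv, Matrix.submatrix_id_id]
        · intro j
          unfold IsMeasurement
          rw [Fintype.sum_unique, Matrix.conjTranspose_submatrix, Matrix.submatrix_mul_equiv]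
          simp
        · intro j i₁ i₂
          rw [h0 j]
          ext y x
          simp [Matrix.mul_apply, Matrix.one_apply]
      · let eι := Fintype.equivFin (ι v)
        refine ⟨1, J v, Fintype.card (ι v), Equiv.uniqueProd _ _,
          fun _ => (1 : Matrix (ι v) (ι v) ℂ).submatrix eι.symm id,
          fun j i => (A v j i).submatrix id eι.symm, NeZero.ne _, ?_, ?_, ?_,
          fun j j' h => by simp only [hdep v j j' h], fun h => absurd h hv⟩
        · unfold IsMeasurement
          rw [Fintype.sum_unique, Matrix.conjTranspose_submatrix, Matrix.submatrix_mul_equiv]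
          simp
        · intro j
          have := hA v j
          unfold IsMeasurement at this ⊢
          have h1 : ∀ i, ((A v j i).submatrix id eι.symm).conjTranspose *
              (A v j i).submatrix id eι.symm
              = ((A v j i).conjTranspose * A v j i).submatrix eι.symm eι.symm := fun i => by
            rw [Matrix.conjTranspose_submatrix]; rfl
          simp only [h1]
          have h2 : ∑ i, ((A v j i).conjTranspose * A v j i).submatrix eι.symm eι.symm
              = (∑ i, (A v j i).conjTranspose * A v j i).submatrix eι.symm eι.symm := by
            ext a b
            simp [Matrix.sum_apply]
          rw [h2, this]
          simp
        · intro j i₁ i₂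
          rw [Matrix.submatrix_mul_equiv]
          simp
    choose J₁ J₂ k e B C hJ₂ hB hC hCB hCdep hC0 using hex
    have : ∀ v, NeZero (J₂ v) := fun v => ⟨hJ₂ v⟩
    let comb : (∀ v, Fin (J₁ v)) → (∀ v, Fin (J₂ v)) → ∀ v, Fin (J v) :=
      fun j₁ j₂ v => e v (j₁ v, j₂ v)
    refine ⟨J₁, k, B, fun j₁ ρ => ∑ j₂ : (∀ v, Fin (J₂ v)),
      localOp (fun v => C v (comb j₁ j₂) (j₂ v)) * ρ *
        (localOp fun v => C v (comb j₁ j₂) (j₂ v)).conjTranspose, hB, fun j₁ => ?_, fun ρ => ?_⟩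
    -- Truncated subtraction merges ranks `0` and `1`. This is harmless, since a party of rank `0`
    -- has only one outcome left to announce.
    · refine ih J₂ (fun v => rank v - 1) (fun v j₂ => C v (comb j₁ j₂))
        (fun v => by have := hr v; omega) (fun v j j' h => ?_) (fun v j => hC v _)
      by_cases hv : rank v = 0
      · exact (hC0 v hv).2 _ _
      · refine hCdep v _ _ fun w hw => ?_
        have : j w = j' w := by
          by_cases hw0 : rank w = 0
          · have h1 := (hC0 w hw0).1
            have : Subsingleton (Fin (J₂ w)) := by rw [h1]; infer_instance
            exact Subsingleton.elim _ _
          · exact h w (by omega)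
        simp only [comb, this]
    · let E : ((∀ v, Fin (J₁ v)) × (∀ v, Fin (J₂ v))) ≃ (∀ v, Fin (J v)) :=
        { toFun := fun p => comb p.1 p.2
          invFun := fun j => (fun v => ((e v).symm (j v)).1, fun v => ((e v).symm (j v)).2)
          left_inv := fun p => by simp [comb]
          right_inv := fun j => by simp [comb] }
      beta_reduce
      rw [← Equiv.sum_comp E, Fintype.sum_prod_type]
      refine Finset.sum_congr rfl fun j₁ _ => Finset.sum_congr rfl fun j₂ _ => ?_
      have h1 : localOp (fun v => A v (comb j₁ j₂) (comb j₁ j₂ v))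
          = localOp (fun v => C v (comb j₁ j₂) (j₂ v)) * localOp (fun v => B v (j₁ v)) := by
        rw [localOp_mul]
        congr 1
        funext v
        exact (hCB v _ _ _).symm
      change localOp (fun v => A v (comb j₁ j₂) (comb j₁ j₂ v)) * ρ *
        (localOp fun v => A v (comb j₁ j₂) (comb j₁ j₂ v)).conjTranspose = _
      rw [h1, Matrix.conjTranspose_mul]
      simp only [Matrix.mul_assoc]

theorem isLOCC_of_adaptive {ι κ : V → Type} [∀ v, Fintype (ι v)]
    [∀ v, DecidableEq (ι v)] [∀ v, Fintype (κ v)] {O : Type} [Fintype O] [Nonempty O]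
    (rank : V → ℕ) (A : ∀ v, (V → O) → O → Matrix (κ v) (ι v) ℂ)
    (hdep : ∀ v j j', (∀ w, rank w < rank v → j w = j' w) → A v j = A v j')
    (hA : ∀ v j, IsMeasurement (A v j)) :
    IsLOCC (ι := ι) (κ := κ) fun ρ => ∑ j : V → O,
      localOp (fun v => A v j (j v)) * ρ * (localOp fun v => A v j (j v)).conjTranspose := by
  let e := Fintype.equivFin O
  have : ∀ v : V, NeZero (Fintype.card O) := fun _ => ⟨Fintype.card_ne_zero⟩
  refine ⟨Finset.univ.sup rank, ?_⟩
  have := isLOCCRounds_of_adaptive (Finset.univ.sup rank) (fun _ : V => Fintype.card O) rank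
    (fun v j i => A v (fun w => e.symm (j w)) (e.symm i))
    (fun v => Finset.le_sup (Finset.mem_univ v))
    (fun v j j' h => by
      rw [hdep v (fun w => e.symm (j w)) (fun w => e.symm (j' w)) fun w hw => by rw [h w hw]])
    (fun v j => by
      have := hA v fun w => e.symm (j w)
      unfold IsMeasurement at this ⊢
      rw [← this]
      exact Equiv.sum_comp e.symm fun i => (A v (fun w => e.symm (j w)) i).conjTranspose *
        A v (fun w => e.symm (j w)) i)
  convert this using 1
  funext ρ
  exact (Equiv.sum_comp (Equiv.arrowCongr (Equiv.refl V) e.symm) fun j : V → O =>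
    localOp (fun v => A v j (j v)) * ρ * (localOp fun v => A v j (j v)).conjTranspose).symm

end LOCC

/-! ### Exact construction of states by teleportation -/

/-- The characters of the cyclic group of order `m`: the phases of a measurement in maximally
entangled states. -/
theorem exists_phase (m : ℕ) [NeZero m] : ∃ χ : Fin m → Fin m → ℂ,
    (∀ t a, conj (χ t a) * χ t a = 1) ∧
    ∀ a a', 𝔼 t, χ t a * conj (χ t a') = if a = a' then 1 else 0 := by
  have hm := NeZero.ne m
  let ζ : ℂ := Complex.exp (2 * Real.pi * Complex.I / m)
  have hζ : IsPrimitiveRoot ζ m := Complex.isPrimitiveRoot_exp m hm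
  have hn : ‖ζ‖ = 1 := hζ.norm'_eq_one hm
  have hc : ∀ k : ℕ, conj (ζ ^ k) * ζ ^ k = 1 := fun k => by
    rw [← Complex.normSq_eq_conj_mul_self, Complex.normSq_eq_norm_sq, norm_pow, hn]
    simp
  refine ⟨fun t a => ζ ^ (a.1 * t.1), fun t a => hc _, fun a a' => ?_⟩
  rw [Fintype.expect_eq_sum_div_card, Fintype.card_fin]
  have hm' : (m : ℂ) ≠ 0 := by exact_mod_cast hm
  split_ifs with h
  · subst h
    simp only [mul_comm _ (conj _), hc]
    simp [hm']
  · set w : ℂ := ζ ^ a.1 * conj (ζ ^ a'.1) with hw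
    have h1 : ∀ t : Fin m, ζ ^ (a.1 * t.1) * conj (ζ ^ (a'.1 * t.1)) = w ^ t.1 := fun t => by
      rw [hw, mul_pow, pow_mul, pow_mul, map_pow]
    -- A primitive root has distinct powers below its order, so the geometric sum is nontrivial and
    -- vanishes.
    have hw1 : w ≠ 1 := by
      intro hw1
      apply h
      have : ζ ^ a.1 = ζ ^ a'.1 := by
        calc ζ ^ a.1 = ζ ^ a.1 * (conj (ζ ^ a'.1) * ζ ^ a'.1) := by rw [hc, mul_one]
          _ = w * ζ ^ a'.1 := by rw [hw]; ring
          _ = ζ ^ a'.1 := by rw [hw1, one_mul]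
      exact Fin.ext (hζ.pow_inj a.2 a'.2 this)
    have hwm : w ^ m = 1 := by
      rw [hw, mul_pow, ← map_pow, ← pow_mul, ← pow_mul, mul_comm a.1, mul_comm a'.1, pow_mul,
        pow_mul, hζ.pow_eq_one]
      simp
    simp only [h1]
    rw [Fin.sum_univ_eq_sum_range (fun k => w ^ k) m]
    have := mul_geom_sum w m
    rw [hwm, sub_self] at this
    rcases mul_eq_zero.1 this with h2 | h2
    · exact absurd (sub_eq_zero.1 h2) hw1
    · rw [h2, zero_div]

theorem pureDensity_mulVec {ι κ : Type} [Fintype ι] (A : Matrix κ ι ℂ) (φ : ι → ℂ) :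
    A * pureDensity φ * A.conjTranspose = pureDensity (A.mulVec φ) := by
  rw [pureDensity, pureDensity, Matrix.mul_vecMulVec, Matrix.vecMulVec_mul, Matrix.star_mulVec]

theorem pureDensity_smul {ι : Type} (c : ℂ) (φ : ι → ℂ) :
    pureDensity (fun x => c * φ x) = (c * conj c) • pureDensity φ := by
  ext x y
  simp [pureDensity, Matrix.vecMulVec_apply]
  ring

theorem SchmidtRankLE.const_mul {V : Type*} [Fintype V] [DecidableEq V] {κ : V → Type*}
    {S : Finset V} {M : ℕ} {φ : (∀ v, κ v) → ℂ} (h : SchmidtRankLE S M φ) (c : ℂ) :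
    SchmidtRankLE S M fun x => c * φ x := by
  obtain ⟨f, g, hf, hg, hφ⟩ := h
  refine ⟨fun l x => c * f l x, g, fun l x y hxy => by simp only [hf l hxy], hg, fun x => ?_⟩
  simp only [hφ, Finset.mul_sum, mul_assoc]

section Construction

variable {V : Type} [Fintype V] [DecidableEq V] {T : SimpleGraph V} [DecidableRel T.Adj] {root : V}
  {κ : V → Type} [∀ v, Fintype (κ v)] {m : T.edgeSet → ℕ}

theorem prod_downEdges (hT : T.IsTree) {M : Type*} [CommMonoid M] (f : T.edgeSet → M) :
    ∏ v, ∏ e ∈ downEdges T root v, f e = ∏ e, f e := by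
  have h1 : ∀ v, ∏ e ∈ downEdges T root v, f e
      = ∏ e, if e ∈ downEdges T root v then f e else 1 := fun v => by
    rw [Finset.prod_ite_mem, Finset.univ_inter]
  simp only [h1]
  rw [Finset.prod_comm]
  refine Finset.prod_congr rfl fun e _ => ?_
  obtain ⟨v, hv⟩ := exists_mem_downEdges (root := root) hT e
  rw [Finset.prod_eq_single_of_mem v (Finset.mem_univ v), if_pos hv]
  intro w _ hw
  exact if_neg fun h => hw (eq_of_mem_downEdges hT h hv)

theorem prod_upEdges (hT : T.IsTree) {M : Type*} [CommMonoid M] (f : T.edgeSet → M) :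
    ∏ v, ∏ e ∈ upEdges T root v, f e = ∏ e, f e := by
  have h1 : ∀ v, ∏ e ∈ upEdges T root v, f e
      = ∏ e, if e ∈ upEdges T root v then f e else 1 := fun v => by
    rw [Finset.prod_ite_mem, Finset.univ_inter]
  simp only [h1]
  rw [Finset.prod_comm]
  refine Finset.prod_congr rfl fun e _ => ?_
  obtain ⟨v, hv⟩ := exists_mem_upEdges_edge (root := root) hT e
  rw [Finset.prod_eq_single_of_mem v (Finset.mem_univ v), if_pos hv]
  intro w _ hw
  exact if_neg fun h => hw (eq_of_mem_upEdges hT h hv)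

/-- A sum against the resource state is a sum over the common basis states of the edges. -/
theorem sum_mul_resourceVec (hT : T.IsTree) (f : (∀ v, ResourceIndex T m v) → ℂ) :
    ∑ z, f z * resourceVec T m z = (∏ e, (((Real.sqrt (m e))⁻¹ : ℝ) : ℂ)) *
      ∑ l : (∀ e, Fin (m e)), f fun _ e => l e.1 := by
  rw [Finset.mul_sum]
  symm
  refine Fintype.sum_of_injective (fun (l : ∀ e, Fin (m e)) (v : V)
    (e : {e : T.edgeSet // v ∈ e.1}) => l e.1) ?_ _ _ ?_ ?_
  · intro l l' h
    funext e
    obtain ⟨r⟩ := hT.connected.nonempty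
    obtain ⟨a, _, he, -⟩ := exists_ends (root := r) hT e
    have ha : a ∈ e.1 := by rw [he]; simp
    exact congrFun (congrFun h a) ⟨e, ha⟩
  · intro z hz
    rw [resourceVec, mul_eq_zero]
    right
    by_contra hne
    rw [← ne_eq, Finset.prod_ne_zero_iff] at hne
    apply hz
    have hall : ∀ (e : T.edgeSet) (v v' : V) (h : v ∈ e.1) (h' : v' ∈ e.1),
        z v ⟨e, h⟩ = z v' ⟨e, h'⟩ := by
      intro e
      by_contra hcon
      exact hne e (Finset.mem_univ e) (if_neg hcon)
    have hex : ∀ e : T.edgeSet, ∃ a, a ∈ e.1 := fun e => by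
      obtain ⟨r⟩ := hT.connected.nonempty
      obtain ⟨a, _, he, -⟩ := exists_ends (root := r) hT e
      exact ⟨a, by rw [he]; simp⟩
    choose a ha using hex
    refine ⟨fun e => z (a e) ⟨e, ha e⟩, ?_⟩
    funext v e
    exact hall e.1 (a e.1) v (ha e.1) e.2
  · intro l
    rw [resourceVec, mul_comm]
    congr 1
    exact Finset.prod_congr rfl fun e _ => (if_pos fun _ _ _ _ => rfl).symm

/-! ### The teleportation protocol. -/

section Protocol

variable [∀ e, NeZero (m e)]

/-- The basis state of all edges that agrees with `a` on the edges at `v`. -/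
def extendIndex (v : V) (a : ResourceIndex T m v) (e : T.edgeSet) : Fin (m e) :=
  if h : v ∈ e.1 then a ⟨e, h⟩ else 0

/-- The outcome announced by a party: a shift and a phase for each edge. -/
abbrev Outcome (m : T.edgeSet → ℕ) : Type := (∀ e, Fin (m e)) × (∀ e, Fin (m e))

variable (root) in
/-- The operator by which `v` corrects the leg above it, applies the tensor `W v`, and measures the
legs below it in a basis of maximally entangled states. -/
def teleportOp (W : ∀ v, κ v → (∀ e, Fin (m e)) → ℂ) (χ : ∀ e, Fin (m e) → Fin (m e) → ℂ)
    (c : V → ℂ) (top : T.edgeSet → V) (v : V) (j : V → Outcome m) (o : Outcome m) :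
    Matrix (κ v) (ResourceIndex T m v) ℂ :=
  Matrix.of fun x a =>
    let q := extendIndex v a - (downEdges T root v).piecewise o.1 fun e => (j (top e)).1 e
    c v * (W v x q * ((∏ e ∈ downEdges T root v, conj (χ e (o.2 e) (q e))) *
      ∏ e ∈ upEdges T root v, χ e ((j (top e)).2 e) (q e)))

/-- Averaging over the phases forces agreement on the legs below `v`. The average over the shifts
and over the system of `v` is then the Gram matrix of the tensor, and its isometry forces agreement
on the leg above. Outcome components of edges not below `v` merely repeat operators, hence the full
`card (Outcome m)` in the normalization. -/
theorem teleportOp_isMeasurement {W : ∀ v, κ v → (∀ e, Fin (m e)) → ℂ}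
    {χ : ∀ e, Fin (m e) → Fin (m e) → ℂ} {c : V → ℂ} {top : T.edgeSet → V} (v : V)
    [Nonempty (κ v)]
    (hW : ∀ l l', 𝔼 y : κ v, 𝔼 k : (∀ e, Fin (m e)),
      conj (W v y ((downEdges T root v).piecewise k l)) *
        W v y ((downEdges T root v).piecewise k l')
      = (∏ e ∈ downEdges T root v, (m e : ℂ)) *
        ∏ e ∈ upEdges T root v, if l e = l' e then 1 else 0)
    (hχ1 : ∀ e t a, conj (χ e t a) * χ e t a = 1)
    (hχ2 : ∀ e a a', 𝔼 t, χ e t a * conj (χ e t a') = if a = a' then 1 else 0)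
    (hc : conj (c v) * c v * (Fintype.card (Outcome m) * Fintype.card (κ v) *
      ∏ e ∈ downEdges T root v, (m e : ℂ)) = 1) (j : V → Outcome m) :
    IsMeasurement (teleportOp root W χ c top v j) := by
  unfold IsMeasurement
  ext a a'
  set D := downEdges T root v with hD
  set U := upEdges T root v with hU
  have hUD : Disjoint U D := disjoint_up_down v
  set l := extendIndex v a with hl
  set l' := extendIndex v a' with hl'
  let σ : ∀ e, Fin (m e) := fun e => (j (top e)).1 e
  let τ : ∀ e, Fin (m e) := fun e => (j (top e)).2 e
  -- the entry as an average
  have hentry : (∑ o, (teleportOp root W χ c top v j o).conjTranspose *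
      teleportOp root W χ c top v j o) a a'
      = conj (c v) * c v * (Fintype.card (Outcome m) * Fintype.card (κ v) *
        𝔼 s : (∀ e, Fin (m e)), 𝔼 t : (∀ e, Fin (m e)), 𝔼 x : κ v,
        (∏ e ∈ D, χ e (t e) ((l - D.piecewise s σ) e) *
            conj (χ e (t e) ((l' - D.piecewise s σ) e))) *
        ((∏ e ∈ U, conj (χ e (τ e) ((l - σ) e)) * χ e (τ e) ((l' - σ) e)) *
        (conj (W v x (l - D.piecewise s σ)) * W v x (l' - D.piecewise s σ)))) := by
    have hE : ∀ F : Outcome m → κ v → ℂ, ∑ o, ∑ x, F o x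
        = Fintype.card (Outcome m) * Fintype.card (κ v) *
          𝔼 s : (∀ e, Fin (m e)), 𝔼 t : (∀ e, Fin (m e)), 𝔼 x : κ v, F (s, t) x := by
      intro F
      calc ∑ o, ∑ x, F o x = Fintype.card (Outcome m) * 𝔼 o : Outcome m, ∑ x, F o x :=
            (Fintype.card_mul_expect fun o : Outcome m => ∑ x, F o x).symm
        _ = Fintype.card (Outcome m) * 𝔼 o : Outcome m, (Fintype.card (κ v) * 𝔼 x, F o x) := by
            simp only [Fintype.card_mul_expect]
        _ = _ := by
            rw [← Finset.mul_expect, mul_assoc, ← Finset.univ_product_univ, Finset.expect_product]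
    rw [Matrix.sum_apply]
    simp only [Matrix.mul_apply]
    rw [hE]
    conv_rhs => rw [mul_left_comm, Finset.mul_expect]
    refine congrArg _ ?_
    refine Finset.expect_congr rfl fun s _ => ?_
    rw [Finset.mul_expect]
    refine Finset.expect_congr rfl fun t _ => ?_
    rw [Finset.mul_expect]
    refine Finset.expect_congr rfl fun x _ => ?_
    have hq : ∀ (r : ∀ e, Fin (m e)), ∏ e ∈ U, χ e (τ e) ((r - D.piecewise s σ) e)
        = ∏ e ∈ U, χ e (τ e) ((r - σ) e) := fun r => by
      refine Finset.prod_congr rfl fun e he => ?_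
      rw [Pi.sub_apply, Pi.sub_apply, Finset.piecewise_eq_of_notMem _ _ _
        (Finset.disjoint_left.1 hUD he)]
    simp only [teleportOp, Matrix.conjTranspose_apply, Matrix.of_apply, RCLike.star_def, map_mul,
      map_prod, Complex.conj_conj, Finset.prod_mul_distrib]
    rw [← hl, ← hl', ← hD, ← hU]
    have h1 := hq l
    have h2 := hq l'
    have h3 := congrArg conj h1
    rw [map_prod, map_prod] at h3
    simp only [σ, τ] at h2 h3 ⊢
    rw [h2, h3]
    ring
  rw [hentry, Matrix.one_apply]
  have hDsum : ∀ s : (∀ e, Fin (m e)), 𝔼 t : (∀ e, Fin (m e)), 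
      (∏ e ∈ D, χ e (t e) ((l - D.piecewise s σ) e) *
            conj (χ e (t e) ((l' - D.piecewise s σ) e)))
      = ∏ e ∈ D, if l e = l' e then 1 else 0 := fun s => by
    rw [expect_prod_finset D (fun e i => χ e i ((l - D.piecewise s σ) e) *
            conj (χ e i ((l' - D.piecewise s σ) e)))]
    refine Finset.prod_congr rfl fun e _ => ?_
    rw [hχ2]
    simp only [Pi.sub_apply, sub_left_inj]
  have hmain : 𝔼 s : (∀ e, Fin (m e)), 𝔼 t : (∀ e, Fin (m e)), 𝔼 x : κ v,
        (∏ e ∈ D, χ e (t e) ((l - D.piecewise s σ) e) *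
            conj (χ e (t e) ((l' - D.piecewise s σ) e))) *
        ((∏ e ∈ U, conj (χ e (τ e) ((l - σ) e)) * χ e (τ e) ((l' - σ) e)) *
        (conj (W v x (l - D.piecewise s σ)) * W v x (l' - D.piecewise s σ)))
      = (∏ e ∈ D, if l e = l' e then 1 else 0) *
        ((∏ e ∈ U, conj (χ e (τ e) ((l - σ) e)) * χ e (τ e) ((l' - σ) e)) *
          𝔼 s : (∀ e, Fin (m e)), 𝔼 x : κ v,
          conj (W v x (l - D.piecewise s σ)) * W v x (l' - D.piecewise s σ)) := by
    rw [Finset.mul_expect, Finset.mul_expect]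
    refine Finset.expect_congr rfl fun s _ => ?_
    rw [← hDsum s, Finset.expect_mul]
    refine Finset.expect_congr rfl fun t _ => ?_
    rw [Finset.mul_expect, Finset.mul_expect]
  rw [hmain]
  by_cases hDl : ∀ e ∈ D, l e = l' e
  -- On `D`, where `l = l'`, the map `s ↦ l - s` makes the shifted labels uniform; off `D` both
  -- labels are shifted by the same `σ`, which does not affect their equality.
  · have hshift : 𝔼 s : (∀ e, Fin (m e)), 𝔼 x : κ v,
          conj (W v x (l - D.piecewise s σ)) * W v x (l' - D.piecewise s σ)
        = (∏ e ∈ D, (m e : ℂ)) * ∏ e ∈ U, if l e = l' e then 1 else 0 := by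
      have h1 := hW (l - σ) (l' - σ)
      simp only [Pi.sub_apply, sub_left_inj] at h1
      rw [← h1, Finset.expect_comm]
      refine Finset.expect_congr rfl fun x _ => ?_
      refine Fintype.expect_equiv (Equiv.subLeft l) _ _ fun s => ?_
      have h2 : ∀ r : (∀ e, Fin (m e)), (∀ e ∈ D, l e = r e) →
          r - D.piecewise s σ = D.piecewise (l - s) (r - σ) := fun r hr => by
        funext e
        by_cases he : e ∈ D
        · simp [he, hr e he]
        · simp [he]
      rw [Equiv.subLeft_apply, ← h2 l fun _ _ => rfl, ← h2 l' hDl]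
    rw [hshift, Finset.prod_eq_one fun e he => if_pos (hDl e he)]
    by_cases hUl : ∀ e ∈ U, l e = l' e
    · have haa : a = a' := by
        funext e
        have : l e.1 = l' e.1 := by
          rcases mem_up_or_down (root := root) e.2 with h | h
          · exact hUl _ h
          · exact hDl _ h
        simpa [hl, hl', extendIndex, e.2] using this
      rw [if_pos haa, Finset.prod_eq_one (s := U) fun e he => if_pos (hUl e he),
        Finset.prod_eq_one (s := U) fun e he => ?_]
      · refine Eq.trans ?_ hc
        ring
      · rw [Pi.sub_apply, Pi.sub_apply, hUl e he]
        exact hχ1 _ _ _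
    · push Not at hUl
      obtain ⟨e, he, hne⟩ := hUl
      rw [Finset.prod_eq_zero (f := fun e => if l e = l' e then (1 : ℂ) else 0) he (if_neg hne),
        if_neg]
      · ring
      · rintro rfl; exact hne rfl
  · push Not at hDl
    obtain ⟨e, he, hne⟩ := hDl
    rw [Finset.prod_eq_zero (f := fun e => if l e = l' e then (1 : ℂ) else 0) he (if_neg hne),
      if_neg]
    · ring
    · rintro rfl; exact hne rfl

/-- Every outcome yields the same vector: the two ends of an edge use the shift announced by its
upper end, which a translation of the summed labels absorbs, and their phases are conjugate. This is
the correction step of teleportation. -/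
theorem teleportOp_mulVec (hT : T.IsTree) {W : ∀ v, κ v → (∀ e, Fin (m e)) → ℂ}
    {χ : ∀ e, Fin (m e) → Fin (m e) → ℂ} {c : V → ℂ} {top : T.edgeSet → V}
    (htop : ∀ e, e ∈ downEdges T root (top e))
    (hW : ∀ v y, DependsOn (W v y) {e | v ∈ e.1})
    (hχ : ∀ e t a, conj (χ e t a) * χ e t a = 1) (j : V → Outcome m) (x : ∀ v, κ v) :
    (localOp fun v => teleportOp root W χ c top v j (j v)).mulVec (resourceVec T m) x
      = (∏ e, (((Real.sqrt (m e))⁻¹ : ℝ) : ℂ)) * ((∏ v, c v) *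
        ∑ l : (∀ e, Fin (m e)), ∏ v, W v (x v) l) := by
  have h0 : (localOp fun v => teleportOp root W χ c top v j (j v)).mulVec (resourceVec T m) x
      = ∑ z, (∏ v, teleportOp root W χ c top v j (j v) (x v) (z v)) * resourceVec T m z := rfl
  rw [h0, sum_mul_resourceVec hT (fun z : ∀ v, ResourceIndex T m v =>
    ∏ v, teleportOp root W χ c top v j (j v) (x v) (z v))]
  congr 1
  rw [Finset.mul_sum]
  let σ : ∀ e, Fin (m e) := fun e => (j (top e)).1 e
  refine Fintype.sum_equiv (Equiv.subRight σ) _ _ fun l => ?_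
  rw [Equiv.subRight_apply]
  have hext : ∀ v (e : T.edgeSet), v ∈ e.1 → (extendIndex v (fun e : {e : T.edgeSet // v ∈ e.1} =>
      l e.1) - (downEdges T root v).piecewise (j v).1 fun e => (j (top e)).1 e) e
      = (l - σ) e := by
    intro v e he
    have h1 : extendIndex v (fun e : {e : T.edgeSet // v ∈ e.1} => l e.1) e = l e := by
      simp [extendIndex, he]
    rw [Pi.sub_apply, Pi.sub_apply, h1]
    congr 1
    by_cases hd : e ∈ downEdges T root v
    · rw [Finset.piecewise_eq_of_mem _ _ _ hd, eq_of_mem_downEdges hT hd (htop e)]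
    · rw [Finset.piecewise_eq_of_notMem _ _ _ hd]
  have hop : ∀ v, teleportOp root W χ c top v j (j v) (x v) (fun e => l e.1)
      = c v * W v (x v) (l - σ) *
        ((∏ e ∈ downEdges T root v, conj (χ e ((j (top e)).2 e) ((l - σ) e))) *
          ∏ e ∈ upEdges T root v, χ e ((j (top e)).2 e) ((l - σ) e)) := by
    intro v
    simp only [teleportOp, Matrix.of_apply]
    rw [mul_assoc]
    congr 2
    · exact hW v (x v) fun e he => hext v e he
    · congr 1
      · refine Finset.prod_congr rfl fun e he => ?_
        rw [hext v e (mem_downEdges.1 he).1, eq_of_mem_downEdges hT he (htop e)]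
      · refine Finset.prod_congr rfl fun e he => ?_
        rw [hext v e (mem_upEdges.1 he).1]
  simp only [hop, Finset.prod_mul_distrib]
  have hphase : (∏ e, conj (χ e ((j (top e)).2 e) ((l - σ) e))) *
      ∏ e, χ e ((j (top e)).2 e) ((l - σ) e) = 1 := by
    rw [← Finset.prod_mul_distrib]
    exact Finset.prod_eq_one fun e _ => hχ _ _ _
  rw [prod_downEdges hT (fun e => conj (χ e ((j (top e)).2 e) ((l - σ) e))),
    prod_upEdges hT (fun e => χ e ((j (top e)).2 e) ((l - σ) e)), hphase, mul_one]

/-- The operator of `v` uses only the outcome of its parent, which is closer to the root. This is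
the adaptivity that LOCC allows. -/
theorem teleportOp_congr {W : ∀ v, κ v → (∀ e, Fin (m e)) → ℂ}
    {χ : ∀ e, Fin (m e) → Fin (m e) → ℂ} {c : V → ℂ} {top : T.edgeSet → V}
    (htop : ∀ e, e ∈ downEdges T root (top e))
    (hW : ∀ v y, DependsOn (W v y) {e | v ∈ e.1}) (v : V) {j j' : V → Outcome m}
    (h : ∀ w, depth T root w < depth T root v → j w = j' w) :
    teleportOp root W χ c top v j = teleportOp root W χ c top v j' := by
  have hup : ∀ e ∈ upEdges T root v, j (top e) = j' (top e) := fun e he =>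
    h _ (depth_lt he (htop e))
  funext o
  ext x a
  have hq : ∀ e : T.edgeSet, v ∈ e.1 → (extendIndex v a - (downEdges T root v).piecewise o.1
      fun e => (j (top e)).1 e) e = (extendIndex v a - (downEdges T root v).piecewise o.1
      fun e => (j' (top e)).1 e) e := by
    intro e he
    rw [Pi.sub_apply, Pi.sub_apply]
    congr 1
    by_cases hd : e ∈ downEdges T root v
    · rw [Finset.piecewise_eq_of_mem _ _ _ hd, Finset.piecewise_eq_of_mem _ _ _ hd]
    · rw [Finset.piecewise_eq_of_notMem _ _ _ hd, Finset.piecewise_eq_of_notMem _ _ _ hd,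
        hup e ((mem_up_or_down he).resolve_right hd)]
  simp only [teleportOp, Matrix.of_apply]
  refine congrArg (c v * ·) (congrArg₂ (· * ·) (hW v x hq) (congrArg₂ (· * ·) ?_ ?_))
  · exact Finset.prod_congr rfl fun e he => by rw [hq e (mem_downEdges.1 he).1]
  · exact Finset.prod_congr rfl fun e he => by rw [hq e (mem_upEdges.1 he).1, hup e he]

end Protocol

/-- Every state can be prepared exactly by LOCC from the resource state whose local dimensions are
the Schmidt ranks across the edges. -/
theorem exists_isLOCC_pureDensity (hT : T.IsTree) (root : V) (φ : (∀ v, κ v) → ℂ)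
    (hφ : ∑ x, ‖φ x‖ ^ 2 = 1) : ∃ m : T.edgeSet → ℕ, (∀ e, 1 ≤ m e) ∧
      (∀ e M, SchmidtRankLE (lowerSide T root e) M φ → m e ≤ M) ∧
      ∃ Γ : Matrix (∀ v, ResourceIndex T m v) (∀ v, ResourceIndex T m v) ℂ →
        Matrix (∀ v, κ v) (∀ v, κ v) ℂ, IsLOCC Γ ∧
          Γ (pureDensity (resourceVec T m)) = pureDensity φ := by
  have hne : ∃ x, φ x ≠ 0 := by
    by_contra! h
    simp [h] at hφ
  obtain ⟨x₀, hx₀⟩ := hne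
  have : ∀ v, Nonempty (κ v) := fun v => ⟨x₀ v⟩
  have hX : (0 : ℝ) < Fintype.card (∀ v, κ v) := by exact_mod_cast Fintype.card_pos
  -- `φ` is a unit vector for the counting measure; multiplying by `r` makes it one for the uniform
  -- probability measure.
  let r : ℂ := ((Real.sqrt (Fintype.card (∀ v, κ v)) : ℝ) : ℂ)
  have hr : r * r = Fintype.card (∀ v, κ v) := by
    rw [← Complex.ofReal_mul, Real.mul_self_sqrt hX.le]; simp
  have hr0 : r ≠ 0 := by
    intro h
    rw [h] at hr
    have : (Fintype.card (∀ v, κ v) : ℂ) ≠ 0 := by exact_mod_cast hX.ne'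
    exact this (by rw [← hr, zero_mul])
  let φ' : (∀ v, κ v) → ℂ := fun x => r * φ x
  have hφ' : ip φ' φ' = 1 := by
    have h1 : ip φ φ = (Fintype.card (∀ v, κ v) : ℂ)⁻¹ := by
      rw [ip_self, nsq_eq, hφ]; simp
    have h2 : conj r = r := Complex.conj_ofReal _
    rw [ip_mul_left, ip_mul_right, h1, h2, ← mul_assoc, hr, mul_inv_cancel₀]
    exact_mod_cast hX.ne'
  have hφ0 : φ' ≠ 0 := Function.ne_iff.2 ⟨x₀, mul_ne_zero hr0 hx₀⟩
  obtain ⟨b, hb⟩ := exists_isTreeBasis T root φ'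
  set m : T.edgeSet → ℕ := fun e => Module.finrank ℂ (sliceSpan (lowerSide T root e) φ') with hm
  have hm1 : ∀ e, 1 ≤ m e := fun e => one_le_finrank_sliceSpan hφ0
  have : ∀ e, NeZero (m e) := fun e => ⟨Nat.one_le_iff_ne_zero.1 (hm1 e)⟩
  refine ⟨m, hm1, fun e M h => (h.const_mul r).finrank_sliceSpan_le, ?_⟩
  choose χ hχ1 hχ2 using fun e => exists_phase (m e)
  choose top htop using exists_mem_downEdges (T := T) (root := root) hT
  let W := treeTensor T root b φ'
  let N : V → ℝ := fun v => Fintype.card (Outcome m) * Fintype.card (κ v) *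
      ∏ e ∈ downEdges T root v, (m e : ℝ)
  have hm0 : ∀ e, (0 : ℝ) < m e := fun e => by exact_mod_cast hm1 e
  have hO : (0 : ℝ) < Fintype.card (Outcome m) := by exact_mod_cast Fintype.card_pos
  have hN : ∀ v, 0 < N v := fun v => by
    have : (0 : ℝ) < Fintype.card (κ v) := by exact_mod_cast Fintype.card_pos
    have := Finset.prod_pos fun e (_ : e ∈ downEdges T root v) => hm0 e
    positivity
  let c : V → ℂ := fun v => (((Real.sqrt (N v))⁻¹ : ℝ) : ℂ)
  have hc : ∀ v, conj (c v) * c v = ((N v)⁻¹ : ℝ) := fun v => by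
    rw [Complex.conj_ofReal, ← Complex.ofReal_mul, ← mul_inv, Real.mul_self_sqrt (hN v).le]
  let A : ∀ v, (V → Outcome m) → Outcome m → Matrix (κ v) (ResourceIndex T m v) ℂ :=
    teleportOp root W χ c top
  refine ⟨_, isLOCC_of_adaptive (depth T root) A
    (fun v j j' h => teleportOp_congr (W := W) htop (fun v y => dependsOn_treeTensor v y) v h)
    (fun v j => teleportOp_isMeasurement (W := W) v (treeTensor_isometry hT hb hφ' v) hχ1 hχ2 ?_ j), ?_⟩
  · rw [hc]
    have h1 : ((N v : ℝ) : ℂ) = Fintype.card (Outcome m) * Fintype.card (κ v) *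
      ∏ e ∈ downEdges T root v, (m e : ℂ) := by simp [N]
    rw [← h1, ← Complex.ofReal_mul, inv_mul_cancel₀ (hN v).ne', Complex.ofReal_one]
  · let P : ℂ := ∏ e, (((Real.sqrt (m e))⁻¹ : ℝ) : ℂ)
    let C : ℂ := P * ((∏ v, c v) * ((∏ e, (m e : ℂ)) * r))
    have hvec : ∀ j : V → Outcome m,
        (localOp fun v => A v j (j v)).mulVec (resourceVec T m) = fun x => C * φ x := by
      intro j
      funext x
      rw [teleportOp_mulVec (W := W) hT htop (fun v y => dependsOn_treeTensor v y) hχ1 j x]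
      have h1 := eq_expect_prod_treeTensor hT hb x
      have h2 : ∑ l : (∀ e, Fin (m e)), ∏ v, W v (x v) l = (∏ e, (m e : ℂ)) * (r * φ x) := by
        change _ = _ * φ' x
        rw [h1, ← Fintype.card_mul_expect, Fintype.card_pi]
        simp only [Fintype.card_fin, Nat.cast_prod]
        rfl
      rw [h2]
      simp only [C, P]
      ring
    have hP : conj P * P = ((∏ e, (m e : ℝ))⁻¹ : ℝ) := by
      simp only [P, map_prod, Complex.conj_ofReal]
      rw [← Finset.prod_mul_distrib, ← Finset.prod_inv_distrib, Complex.ofReal_prod]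
      refine Finset.prod_congr rfl fun e _ => ?_
      rw [← Complex.ofReal_mul, ← mul_inv, Real.mul_self_sqrt (hm0 e).le]
    have hprodN : ∏ v, N v = Fintype.card (V → Outcome m) * Fintype.card (∀ v, κ v) *
        ∏ e, (m e : ℝ) := by
      simp only [N, Finset.prod_mul_distrib]
      rw [prod_downEdges hT (fun e => (m e : ℝ)), Fintype.card_pi, Fintype.card_pi]
      push_cast
      rfl
    have hcc : conj (∏ v, c v) * ∏ v, c v = ((∏ v, N v)⁻¹ : ℝ) := by
      rw [map_prod, ← Finset.prod_mul_distrib, ← Finset.prod_inv_distrib, Complex.ofReal_prod]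
      exact Finset.prod_congr rfl fun v _ => hc v
    have hmm : (0 : ℝ) < ∏ e, (m e : ℝ) := Finset.prod_pos fun e _ => hm0 e
    have hV : (0 : ℝ) < Fintype.card (V → Outcome m) := by exact_mod_cast Fintype.card_pos
    -- Each outcome tuple has the same probability, so the sum over all of them is exactly
    -- `pureDensity φ`.
    have hC : C * conj C = ((Fintype.card (V → Outcome m) : ℝ)⁻¹ : ℝ) := by
      have h1 : C * conj C = (conj P * P) * (conj (∏ v, c v) * ∏ v, c v) *
          (((∏ e, (m e : ℝ)) * (∏ e, (m e : ℝ)) * Fintype.card (∀ v, κ v) : ℝ) : ℂ) := by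
        simp only [C]
        push_cast
        rw [← hr]
        simp only [map_mul, map_prod, map_natCast]
        have h2 : conj r = r := Complex.conj_ofReal _
        rw [h2]
        ring
      rw [h1, hP, hcc, hprodN, ← Complex.ofReal_mul, ← Complex.ofReal_mul]
      congr 1
      field_simp
    simp only [pureDensity_mulVec, hvec, pureDensity_smul, hC]
    rw [Finset.sum_const, Finset.card_univ, ← Nat.cast_smul_eq_nsmul ℂ, smul_smul]
    have : (Fintype.card (V → Outcome m) : ℂ) * ((Fintype.card (V → Outcome m) : ℝ)⁻¹ : ℝ) = 1 := by
      rw [← Complex.ofReal_natCast, ← Complex.ofReal_mul, mul_inv_cancel₀ hV.ne',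
        Complex.ofReal_one]
    rw [this, one_smul]

end Construction

/-! ### The trace norm -/

section TraceNorm

variable {ι : Type} [Fintype ι] [DecidableEq ι]

/-- Expand `u` in an eigenbasis of `A† A`: its coefficients are at most `1` in modulus, and `A` maps
the basis vectors to vectors whose norms are the singular values. -/
theorem norm_dotProduct_mulVec_le_traceNorm (A : Matrix ι ι ℂ) {u : ι → ℂ}
    (hu : ∑ i, ‖u i‖ ^ 2 = 1) : ‖star u ⬝ᵥ A.mulVec u‖ ≤ traceNorm A := by
  let hH := Matrix.isHermitian_conjTranspose_mul_self A
  let v := hH.eigenvectorBasis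
  let w : EuclideanSpace ℂ ι := WithLp.toLp 2 u
  have hw : ‖w‖ = 1 := by
    rw [EuclideanSpace.norm_eq, Real.sqrt_eq_one]
    exact hu
  have h1 : star u ⬝ᵥ A.mulVec u = inner ℂ w (WithLp.toLp 2 (A.mulVec u) : EuclideanSpace ℂ ι) := by
    rw [EuclideanSpace.inner_eq_star_dotProduct, dotProduct_comm]
  have hAv : ∀ i, ‖(WithLp.toLp 2 (A.mulVec (v i)) : EuclideanSpace ℂ ι)‖
      = Real.sqrt (hH.eigenvalues i) := by
    intro i
    rw [← Real.sqrt_sq (norm_nonneg (WithLp.toLp 2 (A.mulVec (v i)) : EuclideanSpace ℂ ι))]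
    congr 1
    have h2 : (inner ℂ (WithLp.toLp 2 (A.mulVec (v i)) : EuclideanSpace ℂ ι)
        (WithLp.toLp 2 (A.mulVec (v i)) : EuclideanSpace ℂ ι) : ℂ) = hH.eigenvalues i := by
      rw [EuclideanSpace.inner_eq_star_dotProduct]
      simp only
      rw [Matrix.star_mulVec, dotProduct_comm, ← Matrix.dotProduct_mulVec, Matrix.mulVec_mulVec,
        hH.mulVec_eigenvectorBasis, dotProduct_smul]
      have h3 : (inner ℂ (v i) (v i) : ℂ) = 1 := by
        rw [inner_self_eq_norm_sq_to_K, v.orthonormal.1 i]; simp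
      rw [EuclideanSpace.inner_eq_star_dotProduct, dotProduct_comm] at h3
      rw [h3]; simp
    rw [inner_self_eq_norm_sq_to_K] at h2
    exact Complex.ofReal_injective (by simpa using h2)
  have hexp : (WithLp.toLp 2 (A.mulVec u) : EuclideanSpace ℂ ι)
      = ∑ i, inner ℂ (v i) w • (WithLp.toLp 2 (A.mulVec (v i)) : EuclideanSpace ℂ ι) := by
    have h4 := v.sum_repr' w
    have h5 := congrArg (fun z : EuclideanSpace ℂ ι => Matrix.toEuclideanLin A z) h4
    simp only [map_sum, map_smul] at h5
    exact h5.symm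
  rw [h1]
  calc _ ≤ ‖w‖ * ‖(WithLp.toLp 2 (A.mulVec u) : EuclideanSpace ℂ ι)‖ := norm_inner_le_norm _ _
    _ = ‖(WithLp.toLp 2 (A.mulVec u) : EuclideanSpace ℂ ι)‖ := by rw [hw, one_mul]
    _ ≤ ∑ i, ‖inner ℂ (v i) w • (WithLp.toLp 2 (A.mulVec (v i)) : EuclideanSpace ℂ ι)‖ := by
        rw [hexp]; exact norm_sum_le _ _
    _ ≤ ∑ i, Real.sqrt (hH.eigenvalues i) := by
        refine Finset.sum_le_sum fun i _ => ?_
        rw [norm_smul, hAv]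
        have : ‖(inner ℂ (v i) w : ℂ)‖ ≤ 1 := by
          have := norm_inner_le_norm (𝕜 := ℂ) (v i) w
          rwa [v.orthonormal.1 i, hw, one_mul] at this
        exact mul_le_of_le_one_left (Real.sqrt_nonneg _) this

open scoped ComplexOrder in
-- Cauchy–Schwarz over the nonzero singular values, whose number is the rank.
theorem traceNorm_sq_le (A : Matrix ι ι ℂ) :
    traceNorm A ^ 2 ≤ A.rank * ∑ i, ∑ j, ‖A i j‖ ^ 2 := by
  let hH := Matrix.isHermitian_conjTranspose_mul_self A
  have hpos : ∀ i, 0 ≤ hH.eigenvalues i :=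
    (Matrix.posSemidef_conjTranspose_mul_self A).eigenvalues_nonneg
  have hrank : A.rank = (Finset.univ.filter fun i => hH.eigenvalues i ≠ 0).card := by
    rw [← Matrix.rank_conjTranspose_mul_self, hH.rank_eq_card_non_zero_eigs, Fintype.card_subtype]
  have htr : ∑ i, hH.eigenvalues i = ∑ i, ∑ j, ‖A i j‖ ^ 2 := by
    have h1 := hH.trace_eq_sum_eigenvalues
    have h2 : (A.conjTranspose * A).trace = ((∑ i, ∑ j, ‖A i j‖ ^ 2 : ℝ) : ℂ) := by
      rw [Matrix.trace]
      simp only [Matrix.diag_apply, Matrix.mul_apply, Matrix.conjTranspose_apply]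
      rw [Finset.sum_comm]
      push_cast
      refine Finset.sum_congr rfl fun i _ => Finset.sum_congr rfl fun j _ => ?_
      rw [RCLike.star_def, ← Complex.normSq_eq_conj_mul_self, Complex.normSq_eq_norm_sq]
      push_cast; rfl
    rw [h2] at h1
    have h3 : ((∑ i, ∑ j, ‖A i j‖ ^ 2 : ℝ) : ℂ) = ((∑ i, hH.eigenvalues i : ℝ) : ℂ) := by
      rw [h1]; push_cast; rfl
    exact (Complex.ofReal_injective h3).symm
  have hsum : traceNorm A = ∑ i ∈ Finset.univ.filter fun i => hH.eigenvalues i ≠ 0,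
      Real.sqrt (hH.eigenvalues i) := by
    rw [traceNorm, Finset.sum_filter]
    refine Finset.sum_congr rfl fun i _ => ?_
    split_ifs with h
    · rfl
    · rw [not_not] at h
      change Real.sqrt (hH.eigenvalues i) = 0
      rw [h, Real.sqrt_zero]
  rw [hsum, hrank, ← htr]
  refine (sq_sum_le_card_mul_sum_sq).trans ?_
  gcongr
  calc _ = ∑ i ∈ Finset.univ.filter fun i => hH.eigenvalues i ≠ 0, hH.eigenvalues i :=
        Finset.sum_congr rfl fun i _ => Real.sq_sqrt (hpos i)
    _ ≤ _ := Finset.sum_le_sum_of_subset_of_nonneg (Finset.filter_subset _ _)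
        fun i _ _ => hpos i

/-- The constant is `2 · 4`: the difference has rank at most `2`, and its squared Frobenius norm is
at most `4` times the squared distance of the vectors. -/
theorem traceNorm_pureDensity_sub_sq_le {φ ψ : ι → ℂ} (hφ : ∑ i, ‖φ i‖ ^ 2 = 1)
    (hψ : ∑ i, ‖ψ i‖ ^ 2 = 1) :
    traceNorm (pureDensity φ - pureDensity ψ) ^ 2 ≤ 8 * ∑ i, ‖φ i - ψ i‖ ^ 2 := by
  set δ := ∑ i, ‖φ i - ψ i‖ ^ 2 with hδ
  have hrank : (pureDensity φ - pureDensity ψ).rank ≤ 2 := by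
    have h1 : pureDensity φ - pureDensity ψ
        = (Matrix.of fun i (k : Fin 2) => if k = 0 then φ i else -ψ i) *
          Matrix.of fun (k : Fin 2) j => if k = 0 then conj (φ j) else conj (ψ j) := by
      ext i j
      simp [pureDensity, Matrix.vecMulVec_apply, Matrix.mul_apply, Fin.sum_univ_two, sub_eq_add_neg]
    rw [h1]
    exact (Matrix.rank_mul_le_left _ _).trans ((Matrix.rank_le_card_width _).trans (by simp))
  have hent : ∀ i j, ‖(pureDensity φ - pureDensity ψ) i j‖ ^ 2
      ≤ 2 * (‖φ i‖ ^ 2 * ‖φ j - ψ j‖ ^ 2 + ‖φ i - ψ i‖ ^ 2 * ‖ψ j‖ ^ 2) := by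
    intro i j
    have h1 : (pureDensity φ - pureDensity ψ) i j
        = φ i * conj (φ j - ψ j) + (φ i - ψ i) * conj (ψ j) := by
      simp only [pureDensity, Matrix.sub_apply, Matrix.vecMulVec_apply, Pi.star_apply,
        RCLike.star_def, map_sub]
      ring
    have h2 : ‖(pureDensity φ - pureDensity ψ) i j‖
        ≤ ‖φ i‖ * ‖φ j - ψ j‖ + ‖φ i - ψ i‖ * ‖ψ j‖ := by
      rw [h1]
      refine (norm_add_le _ _).trans ?_
      rw [norm_mul, norm_mul, RCLike.norm_conj, RCLike.norm_conj]
    calc _ ≤ (‖φ i‖ * ‖φ j - ψ j‖ + ‖φ i - ψ i‖ * ‖ψ j‖) ^ 2 := by gcongr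
      _ ≤ _ := by
        nlinarith [sq_nonneg (‖φ i‖ * ‖φ j - ψ j‖ - ‖φ i - ψ i‖ * ‖ψ j‖)]
  have hsum : ∑ i, ∑ j, ‖(pureDensity φ - pureDensity ψ) i j‖ ^ 2 ≤ 4 * δ := by
    calc _ ≤ ∑ i, ∑ j, 2 * (‖φ i‖ ^ 2 * ‖φ j - ψ j‖ ^ 2 + ‖φ i - ψ i‖ ^ 2 * ‖ψ j‖ ^ 2) :=
          Finset.sum_le_sum fun i _ => Finset.sum_le_sum fun j _ => hent i j
      _ = 2 * ((∑ i, ‖φ i‖ ^ 2) * δ + ∑ i, ‖φ i - ψ i‖ ^ 2) := by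
          rw [Finset.sum_mul, ← Finset.sum_add_distrib, Finset.mul_sum]
          refine Finset.sum_congr rfl fun i _ => ?_
          rw [← Finset.mul_sum, Finset.sum_add_distrib, ← Finset.mul_sum, ← Finset.mul_sum, hψ, mul_one, hδ]
      _ = 4 * δ := by rw [hφ, ← hδ]; ring
  calc _ ≤ _ := traceNorm_sq_le _
    _ ≤ (2 : ℝ) * (4 * δ) :=
        mul_le_mul (by exact_mod_cast hrank) hsum
          (Finset.sum_nonneg fun _ _ => Finset.sum_nonneg fun _ _ => sq_nonneg _) zero_le_two
    _ = 8 * δ := by ring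

end TraceNorm

/-! ### Schmidt decompositions -/

section SchmidtDecomposition

variable {V : Type} [Fintype V] [DecidableEq V] {κ : V → Type} [∀ v, Fintype (κ v)]
  {I : Type} [Fintype I] [DecidableEq I]

/-- `Ψ` has a Schmidt decomposition across the cut `S` with Schmidt coefficients `√(p i)`. -/
def HasSchmidtDecomp (S : Finset V) (p : I → ℝ) (Ψ : (∀ v, κ v) → ℂ) : Prop :=
  ∃ u w : I → (∀ v, κ v) → ℂ, (∀ i, DependsOn (u i) (S : Set V)) ∧
    (∀ i, DependsOn (w i) (S : Set V)ᶜ) ∧ OrthonormalFamily u ∧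
    (∀ i j, ip (w i) (w j) = if i = j then (p i : ℂ) else 0) ∧ ∀ x, Ψ x = ∑ i, u i x * w i x

theorem nsq_sum_mul {w : I → (∀ v, κ v) → ℂ} {p : I → ℝ}
    (hw : ∀ i j, ip (w i) (w j) = if i = j then (p i : ℂ) else 0) (s : Finset I) (a : I → ℂ) :
    nsq (fun x => ∑ i ∈ s, a i * w i x) = ∑ i ∈ s, ‖a i‖ ^ 2 * p i := by
  have h : ((nsq (fun x => ∑ i ∈ s, a i * w i x) : ℝ) : ℂ)
      = ((∑ i ∈ s, ‖a i‖ ^ 2 * p i : ℝ) : ℂ) := by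
    rw [← ip_self, ip_sum_left, Complex.ofReal_sum]
    refine Finset.sum_congr rfl fun i hi => ?_
    rw [ip_mul_left, ip_sum_right]
    simp only [ip_mul_right, hw]
    simp only [mul_ite, mul_zero, Finset.sum_ite_eq, hi, if_true]
    rw [← mul_assoc, ← Complex.normSq_eq_conj_mul_self, Complex.normSq_eq_norm_sq]
    push_cast; rfl
  exact Complex.ofReal_injective h

variable {S : Finset V} {p : I → ℝ} {Ψ : (∀ v, κ v) → ℂ}

/-- Keeping the terms in `t` of a Schmidt decomposition is a partial projection. -/
theorem HasSchmidtDecomp.exists_truncation (h : HasSchmidtDecomp S p Ψ) (t : Finset I) :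
    ∃ b : t → (∀ v, κ v) → ℂ, (∀ i, DependsOn (b i) (S : Set V)) ∧ OrthonormalFamily b ∧
      nsq (fun x => Ψ x - locProj S b Ψ x) = ∑ i ∈ tᶜ, p i := by
  obtain ⟨u, w, hu, hw, ho, hp, hΨ⟩ := h
  have hc : ∀ j, coef S (u j) Ψ = w j := fun j => by
    funext x
    have := coef_sum_mul hu ho Finset.univ hw j x
    rw [if_pos (Finset.mem_univ _)] at this
    rw [← this, funext hΨ]
  refine ⟨fun i => u i, fun i => hu i, fun i j => ?_, ?_⟩
  · rw [ho i j]
    simp only [Subtype.ext_iff]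
  · have h1 : (fun x => Ψ x - locProj S (fun i : t => u i) Ψ x)
        = fun x => ∑ i ∈ tᶜ, u i x * w i x := by
      funext x
      simp only [locProj, hc]
      rw [Finset.sum_coe_sort t (fun i => u i x * w i x), hΨ, ← Finset.sum_add_sum_compl t]
      ring
    have h2 : ((nsq (fun x => ∑ i ∈ tᶜ, u i x * w i x) : ℝ) : ℂ) = ((∑ i ∈ tᶜ, p i : ℝ) : ℂ) := by
      rw [← ip_self, ip_sum_left, Complex.ofReal_sum]
      refine Finset.sum_congr rfl fun i hi => ?_
      rw [ip_mul_coef (hu i) (hw i)]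
      have : coef S (u i) (fun x => ∑ i ∈ tᶜ, u i x * w i x) = w i := by
        funext x
        rw [coef_sum_mul hu ho _ hw i x, if_pos hi]
      rw [this, hp, if_pos rfl]
    rw [h1]
    exact Complex.ofReal_injective h2

theorem HasSchmidtDecomp.nonneg (h : HasSchmidtDecomp S p Ψ) (i : I) : 0 ≤ p i := by
  obtain ⟨u, w, hu, hw, ho, hp, hΨ⟩ := h
  have := hp i i
  rw [ip_self, if_pos rfl] at this
  rw [← Complex.ofReal_injective this]
  exact nsq_nonneg _

theorem HasSchmidtDecomp.sum_eq (h : HasSchmidtDecomp S p Ψ) : ∑ i, p i = nsq Ψ := by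
  -- Keeping no term makes the projection zero, so the truncation error is the whole of `nsq Ψ`.
  obtain ⟨b, _, _, hb⟩ := h.exists_truncation ∅
  rw [Finset.compl_empty] at hb
  rw [← hb]
  congr 1
  funext x
  simp [locProj]

/-- The overlap of `Ψ` with a state of small Schmidt rank. -/
theorem HasSchmidtDecomp.norm_ip_sq_le (h : HasSchmidtDecomp S p Ψ) {M : ℕ}
    {χ : (∀ v, κ v) → ℂ} (hχ : SchmidtRankLE S M χ) (t : Finset I) {τ : ℝ}
    (ht : ∀ i ∈ t, p i ≤ τ) (hτ : 0 ≤ τ) :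
    ‖ip χ Ψ‖ ^ 2 ≤ nsq χ * (∑ i ∈ tᶜ, p i + τ * M) := by
  have hp0 := h.nonneg
  obtain ⟨u, w, hu, hw, ho, hp, hΨ⟩ := h
  obtain ⟨q, hqm, hqo, hqs⟩ := exists_orthonormalFamily (sliceSpan S χ)
  have hqd : ∀ i, DependsOn (q i) (S : Set V) := fun i => dependsOn_of_mem_sliceSpan (hqm i)
  have hLχ : locProj S q χ = χ :=
    locProj_eq_self fun y x => hqs _ (Submodule.subset_span ⟨y, rfl⟩) x
  -- Projecting `Ψ` on the slice space of `χ` weights `p i` by the squared length of the projection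
  -- of `u i`.
  have hLΨ : nsq (locProj S q Ψ) = ∑ i, (∑ k, ‖ip (q k) (u i)‖ ^ 2) * p i := by
    rw [nsq_locProj hqd hqo]
    have h1 : ∀ k, coef S (q k) Ψ = fun x => ∑ i, ip (q k) (u i) * w i x := fun k => by
      funext x
      rw [funext hΨ, coef_sum]
      refine Finset.sum_congr rfl fun i _ => ?_
      rw [coef_mul_right _ _ (hw i) disjoint_compl_right, coef_of_dependsOn _ (hu i)]
    simp only [h1, nsq_sum_mul hp, Finset.sum_mul]
    rw [Finset.sum_comm]
  have hW1 : ∀ i, ∑ k, ‖ip (q k) (u i)‖ ^ 2 ≤ 1 := fun i => by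
    rw [← ho.nsq_eq_one i]
    exact hqo.bessel (u i)
  -- Each weight is at most `1` by Bessel for `q`; the weights sum to at most `M` by Bessel for `u`,
  -- applied to each of the at most `M` vectors `q k`.
  have hW2 : ∑ i, ∑ k, ‖ip (q k) (u i)‖ ^ 2 ≤ M := by
    rw [Finset.sum_comm]
    calc _ ≤ ∑ _k : Fin (Module.finrank ℂ (sliceSpan S χ)), (1 : ℝ) := by
          refine Finset.sum_le_sum fun k _ => ?_
          rw [← hqo.nsq_eq_one k]
          refine le_trans (le_of_eq ?_) (ho.bessel (q k))
          refine Finset.sum_congr rfl fun i _ => ?_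
          rw [← ip_conj_symm, RCLike.norm_conj]
      _ = Module.finrank ℂ (sliceSpan S χ) := by simp
      _ ≤ M := by exact_mod_cast hχ.finrank_sliceSpan_le
  have hW0 : ∀ i, 0 ≤ ∑ k, ‖ip (q k) (u i)‖ ^ 2 := fun i => by positivity
  have hbound : nsq (locProj S q Ψ) ≤ ∑ i ∈ tᶜ, p i + τ * M := by
    rw [hLΨ, ← Finset.sum_add_sum_compl t, add_comm]
    refine add_le_add (Finset.sum_le_sum fun i _ => mul_le_of_le_one_left (hp0 i) (hW1 i)) ?_
    calc _ ≤ ∑ i ∈ t, (∑ k, ‖ip (q k) (u i)‖ ^ 2) * τ :=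
          Finset.sum_le_sum fun i hi => mul_le_mul_of_nonneg_left (ht i hi) (hW0 i)
      _ ≤ ∑ i, (∑ k, ‖ip (q k) (u i)‖ ^ 2) * τ :=
          Finset.sum_le_sum_of_subset_of_nonneg (Finset.subset_univ _)
            fun i _ _ => mul_nonneg (hW0 i) hτ
      _ = τ * ∑ i, ∑ k, ‖ip (q k) (u i)‖ ^ 2 := by rw [← Finset.sum_mul, mul_comm]
      _ ≤ τ * M := mul_le_mul_of_nonneg_left hW2 hτ
  -- `χ` lies in the range of the projection, so only the projected part of `Ψ` overlaps with it.
  calc ‖ip χ Ψ‖ ^ 2 = ‖ip χ (locProj S q Ψ)‖ ^ 2 := by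
        conv_lhs => rw [← hLχ, ← ip_locProj_locProj hqd hqo, hLχ]
    _ ≤ nsq χ * nsq (locProj S q Ψ) := TreeCost.norm_ip_sq_le _ _
    _ ≤ _ := mul_le_mul_of_nonneg_left hbound (nsq_nonneg _)

/-! ### Many copies -/

theorem expect_prod_copies (n : ℕ) (h : Fin n → (∀ v, κ v) → ℂ) :
    𝔼 x : (∀ v, Fin n → κ v), ∏ k, h k (fun v => x v k) = ∏ k, 𝔼 y, h k y := by
  rw [← expect_prod_eq (κ := fun _ : Fin n => ∀ v, κ v)]
  exact Fintype.expect_equiv (Equiv.piComm fun v (_ : Fin n) => κ v) _ _ fun x => rfl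

theorem HasSchmidtDecomp.copies (h : HasSchmidtDecomp S p Ψ) (n : ℕ) :
    HasSchmidtDecomp (κ := fun v => Fin n → κ v) S (fun i : Fin n → I => ∏ k, p (i k))
      (fun x => ∏ k, Ψ fun v => x v k) := by
  obtain ⟨u, w, hu, hw, ho, hp, hΨ⟩ := h
  refine ⟨fun i x => ∏ k, u (i k) fun v => x v k, fun i x => ∏ k, w (i k) fun v => x v k,
    fun i x y hxy => ?_, fun i x y hxy => ?_, fun i j => ?_, fun i j => ?_, fun x => ?_⟩
  · exact Finset.prod_congr rfl fun k _ => hu (i k) fun v hv => by rw [hxy v hv]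
  · exact Finset.prod_congr rfl fun k _ => hw (i k) fun v hv => by rw [hxy v hv]
  · simp only [ip, map_prod, ← Finset.prod_mul_distrib]
    rw [expect_prod_copies n fun k y => conj (u (i k) y) * u (j k) y]
    have : ∀ k, 𝔼 y, conj (u (i k) y) * u (j k) y = if i k = j k then 1 else 0 :=
      fun k => ho (i k) (j k)
    simp only [this]
    split_ifs with hij
    · subst hij; simp
    · obtain ⟨k, hk⟩ := Function.ne_iff.1 hij
      exact Finset.prod_eq_zero (Finset.mem_univ k) (if_neg hk)
  · simp only [ip, map_prod, ← Finset.prod_mul_distrib]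
    rw [expect_prod_copies n fun k y => conj (w (i k) y) * w (j k) y]
    have : ∀ k, 𝔼 y, conj (w (i k) y) * w (j k) y = if i k = j k then (p (i k) : ℂ) else 0 :=
      fun k => hp (i k) (j k)
    simp only [this]
    split_ifs with hij
    · subst hij; simp
    · obtain ⟨k, hk⟩ := Function.ne_iff.1 hij
      exact Finset.prod_eq_zero (Finset.mem_univ k) (if_neg hk)
  · simp only [hΨ, ← Finset.prod_mul_distrib]
    rw [Finset.prod_univ_sum, Fintype.piFinset_univ]

/-! ### The reduced state -/

theorem expect_restrict (S : Finset V) (F : (∀ v : {v // v ∈ S}, κ v) →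
    (∀ v : {v // ¬ v ∈ S}, κ v) → ℂ) :
    𝔼 x : (∀ v, κ v), F (fun v => x v) (fun v => x v) = 𝔼 a, 𝔼 y, F a y := by
  have h1 := Fintype.expect_equiv (Equiv.piEquivPiSubtypeProd (fun v => v ∈ S) κ)
    (fun x => F (fun v => x v) (fun v => x v)) (fun q => F q.1 q.2) fun x => rfl
  rw [h1, ← Finset.univ_product_univ, Finset.expect_product]

/-- The eigenvectors of the reduced state are the Schmidt vectors on `S`, and the partial inner
products with `ψ` are their partners. The factor `√card` splits into one for each side of the cut.
-/
theorem hasSchmidtDecomp_partialTrace [∀ v, DecidableEq (κ v)] [∀ v, Nonempty (κ v)]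
    (S : Finset V) (ψ : (∀ v, κ v) → ℂ)
    (hρ : (partialTrace S (pureDensity ψ)).IsHermitian) :
    HasSchmidtDecomp S hρ.eigenvalues
      (fun x => ((Real.sqrt (Fintype.card (∀ v, κ v)) : ℝ) : ℂ) * ψ x) := by
  set A := ∀ v : {v // v ∈ S}, κ v with hA
  set B := ∀ v : {v // ¬ v ∈ S}, κ v with hB
  let M : A → B → ℂ := fun a y => ψ ((Equiv.piEquivPiSubtypeProd (fun v => v ∈ S) κ).symm (a, y))
  have hMx : ∀ x : (∀ v, κ v), M (fun v => x v) (fun v => x v) = ψ x := fun x => by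
    change ψ ((Equiv.piEquivPiSubtypeProd (fun v => v ∈ S) κ).symm
      (Equiv.piEquivPiSubtypeProd (fun v => v ∈ S) κ x)) = ψ x
    rw [Equiv.symm_apply_apply]
  have hρM : ∀ a a', partialTrace S (pureDensity ψ) a a' = ∑ y, M a y * conj (M a' y) :=
    fun a a' => by
      simp only [partialTrace, Matrix.of_apply, pureDensity, Matrix.vecMulVec_apply]
      rfl
  let ev := hρ.eigenvectorBasis
  let rA : ℂ := ((Real.sqrt (Fintype.card A) : ℝ) : ℂ)
  let rB : ℂ := ((Real.sqrt (Fintype.card B) : ℝ) : ℂ)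
  have hrA : rA * rA = Fintype.card A := by
    rw [← Complex.ofReal_mul, Real.mul_self_sqrt (Nat.cast_nonneg _)]; simp
  have hrB : rB * rB = Fintype.card B := by
    rw [← Complex.ofReal_mul, Real.mul_self_sqrt (Nat.cast_nonneg _)]; simp
  have hcA : conj rA = rA := Complex.conj_ofReal _
  have hcB : conj rB = rB := Complex.conj_ofReal _
  have hrX : ((Real.sqrt (Fintype.card (∀ v, κ v)) : ℝ) : ℂ) = rA * rB := by
    rw [← Complex.ofReal_mul, ← Real.sqrt_mul (Nat.cast_nonneg _), ← Nat.cast_mul,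
      ← Fintype.card_prod, Fintype.card_congr (Equiv.piEquivPiSubtypeProd (fun v => v ∈ S) κ)]
  let c : A → B → ℂ := fun i y => ∑ a, conj (ev i a) * M a y
  refine ⟨fun i x => rA * ev i (fun v => x v), fun i x => rB * c i (fun v => x v),
    fun i x y h => ?_, fun i x y h => ?_, fun i j => ?_, fun i j => ?_, fun x => ?_⟩
  · have : (fun v : {v // v ∈ S} => x v) = fun v : {v // v ∈ S} => y v :=
      funext fun v => h v v.2
    simp only [this]
  · have : (fun v : {v // ¬ v ∈ S} => x v) = fun v : {v // ¬ v ∈ S} => y v :=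
      funext fun v => h v (by simp)
    simp only [this]
  · rw [ip_mul_left, ip_mul_right, hcA, ← mul_assoc, hrA, ip,
      expect_restrict S (fun a _ => conj (ev i a) * ev j a)]
    simp only [Fintype.expect_const]
    rw [Fintype.card_mul_expect]
    have := orthonormal_iff_ite.1 ev.orthonormal i j
    rw [← this, PiLp.inner_apply]
    exact Finset.sum_congr rfl fun a _ => by rw [RCLike.inner_apply, mul_comm]
  · rw [ip_mul_left, ip_mul_right, hcB, ← mul_assoc, hrB, ip,
      expect_restrict S (fun _ y => conj (c i y) * c j y)]
    rw [Fintype.expect_const, Fintype.card_mul_expect]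
    -- The Gram matrix of the partners is the matrix of the reduced state in its own eigenbasis,
    -- hence diagonal.
    have h1 : ∑ y, conj (c i y) * c j y
        = star (ev j : A → ℂ) ⬝ᵥ (partialTrace S (pureDensity ψ)).mulVec (ev i) := by
      simp only [dotProduct, Matrix.mulVec, hρM, c, Pi.star_apply, RCLike.star_def, map_sum,
        map_mul, Complex.conj_conj, Finset.sum_mul, Finset.mul_sum]
      rw [Finset.sum_comm]
      have h2 : ∀ a', ∑ y, ∑ a, ev i a * conj (M a y) * (conj (ev j a') * M a' y)
          = ∑ a, ∑ y, conj (ev j a') * (M a' y * conj (M a y) * ev i a) := fun a' => by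
        rw [Finset.sum_comm]
        exact Finset.sum_congr rfl fun a _ => Finset.sum_congr rfl fun y _ => by ring
      rw [← Finset.sum_congr rfl fun a' _ => h2 a']
    rw [h1, hρ.mulVec_eigenvectorBasis, dotProduct_smul]
    have h3 := orthonormal_iff_ite.1 ev.orthonormal j i
    rw [EuclideanSpace.inner_eq_star_dotProduct, dotProduct_comm] at h3
    rw [h3]
    by_cases hij : i = j
    · subst hij; simp
    · simp [hij, Ne.symm hij]
  · have h4 := ev.sum_repr' (WithLp.toLp 2 fun a => M a fun v => x v)
    have h5 := congrArg (fun z : EuclideanSpace ℂ A => z fun v => x v) h4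
    simp only at h5
    rw [WithLp.ofLp_sum, Finset.sum_apply] at h5
    rw [hMx] at h5
    beta_reduce
    rw [← h5, hrX, Finset.mul_sum]
    refine Finset.sum_congr rfl fun i _ => ?_
    have h6 : (inner ℂ (ev i) (WithLp.toLp 2 fun a => M a fun v => x v : EuclideanSpace ℂ A) : ℂ)
        = c i fun v => x v := by
      rw [PiLp.inner_apply]
      exact Finset.sum_congr rfl fun a _ => by rw [RCLike.inner_apply, mul_comm]
    rw [h6]
    simp only [PiLp.smul_apply, smul_eq_mul]
    ring

end SchmidtDecomposition

/-! ### Typical sequences -/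

section AEP

variable {I : Type} [Fintype I]

theorem sum_pi_succ {M : Type*} [AddCommMonoid M] {n : ℕ} (F : (Fin (n + 1) → I) → M) :
    ∑ i, F i = ∑ a, ∑ i : Fin n → I, F (Fin.cons a i) := by
  rw [← Equiv.sum_comp (Fin.consEquiv fun _ : Fin (n + 1) => I), Fintype.sum_prod_type]
  rfl

theorem sum_prod_eq_one {p : I → ℝ} (hp : ∑ i, p i = 1) (n : ℕ) :
    ∑ i : Fin n → I, ∏ k, p (i k) = 1 := by
  rw [← Fintype.piFinset_univ, ← Finset.prod_univ_sum, hp, Finset.prod_const_one]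

/-- A sum of independent centred variables is centred. -/
theorem sum_prod_mul_sum {p g : I → ℝ} (hp : ∑ i, p i = 1) (hg : ∑ i, p i * g i = 0) (n : ℕ) :
    ∑ i : Fin n → I, (∏ k, p (i k)) * ∑ k, g (i k) = 0 := by
  induction n with
  | zero => simp
  | succ n ih =>
    rw [sum_pi_succ]
    simp only [Fin.prod_univ_succ, Fin.sum_univ_succ, Fin.cons_zero, Fin.cons_succ]
    have : ∀ a, ∑ i : Fin n → I, p a * (∏ k, p (i k)) * (g a + ∑ k, g (i k)) = p a * g a := by
      intro a
      have h1 : ∀ i : Fin n → I, p a * (∏ k, p (i k)) * (g a + ∑ k, g (i k))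
          = p a * g a * (∏ k, p (i k)) + p a * ((∏ k, p (i k)) * ∑ k, g (i k)) := fun i => by ring
      simp only [h1, Finset.sum_add_distrib, ← Finset.mul_sum, ih, sum_prod_eq_one hp]
      ring
    simp only [this, hg]

/-- Variances of independent centred variables add up: the cross term vanishes. -/
theorem sum_prod_mul_sum_sq {p g : I → ℝ} (hp : ∑ i, p i = 1) (hg : ∑ i, p i * g i = 0) (n : ℕ) :
    ∑ i : Fin n → I, (∏ k, p (i k)) * (∑ k, g (i k)) ^ 2 = n * ∑ i, p i * g i ^ 2 := by
  induction n with
  | zero => simp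
  | succ n ih =>
    rw [sum_pi_succ]
    simp only [Fin.prod_univ_succ, Fin.sum_univ_succ, Fin.cons_zero, Fin.cons_succ]
    have : ∀ a, ∑ i : Fin n → I, p a * (∏ k, p (i k)) * (g a + ∑ k, g (i k)) ^ 2
        = p a * g a ^ 2 + p a * (n * ∑ i, p i * g i ^ 2) := by
      intro a
      have h1 : ∀ i : Fin n → I, p a * (∏ k, p (i k)) * (g a + ∑ k, g (i k)) ^ 2
          = p a * g a ^ 2 * (∏ k, p (i k)) + 2 * p a * g a * ((∏ k, p (i k)) * ∑ k, g (i k))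
            + p a * ((∏ k, p (i k)) * (∑ k, g (i k)) ^ 2) := fun i => by ring
      simp only [h1, Finset.sum_add_distrib, ← Finset.mul_sum, ih, sum_prod_eq_one hp,
        sum_prod_mul_sum hp hg]
      ring
    simp only [this, Finset.sum_add_distrib, ← Finset.sum_mul, hp]
    push_cast
    ring

/-- The Shannon entropy, in bits. -/
def shannon (p : I → ℝ) : ℝ := -∑ i, p i * Real.logb 2 (p i)

/-- The sequences whose probability is `2 ^ (-n (H ± δ))`. -/
def typical (p : I → ℝ) (n : ℕ) (δ : ℝ) : Finset (Fin n → I) :=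
  open Classical in
  Finset.univ.filter fun i => (2 : ℝ) ^ (-(n * (shannon p + δ))) ≤ ∏ k, p (i k) ∧
    ∏ k, p (i k) ≤ (2 : ℝ) ^ (-(n * (shannon p - δ)))

theorem mem_typical {p : I → ℝ} {n : ℕ} {δ : ℝ} {i : Fin n → I} :
    i ∈ typical p n δ ↔ (2 : ℝ) ^ (-(n * (shannon p + δ))) ≤ ∏ k, p (i k) ∧
    ∏ k, p (i k) ≤ (2 : ℝ) ^ (-(n * (shannon p - δ))) := by
  simp [typical]

/-- Each typical sequence has at least the stated probability, and the total is `1`. -/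
theorem card_typical_le {p : I → ℝ} (hp0 : ∀ i, 0 ≤ p i) (hp : ∑ i, p i = 1) (n : ℕ) (δ : ℝ) :
    ((typical p n δ).card : ℝ) ≤ (2 : ℝ) ^ (n * (shannon p + δ)) := by
  have h1 : ((typical p n δ).card : ℝ) * (2 : ℝ) ^ (-(n * (shannon p + δ))) ≤ 1 := by
    rw [← nsmul_eq_mul, ← sum_prod_eq_one hp n]
    refine (Finset.card_nsmul_le_sum _ _ _ fun i hi => (mem_typical.1 hi).1).trans ?_
    exact Finset.sum_le_sum_of_subset_of_nonneg (Finset.subset_univ _)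
      fun i _ _ => Finset.prod_nonneg fun k _ => hp0 _
  rw [Real.rpow_neg zero_le_two, ← div_eq_mul_inv, div_le_one (by positivity)] at h1
  exact h1

/-- Chebyshev's inequality for the sum of the centred variables `g = -log₂ p - H`, whose variance
serves as `C`. -/
theorem exists_sum_compl_typical_le [DecidableEq I] {p : I → ℝ} (hp0 : ∀ i, 0 ≤ p i)
    (hp : ∑ i, p i = 1) : ∃ C : ℝ, 0 ≤ C ∧ ∀ (n : ℕ) (δ : ℝ), 0 < n → 0 < δ →
      ∑ i ∈ (typical p n δ)ᶜ, ∏ k, p (i k) ≤ C / (n * δ ^ 2) := by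
  let g : I → ℝ := fun i => -Real.logb 2 (p i) - shannon p
  have hg : ∑ i, p i * g i = 0 := by
    simp only [g, mul_sub, Finset.sum_sub_distrib, ← Finset.sum_mul, hp, mul_neg,
      Finset.sum_neg_distrib]
    rw [shannon]; ring
  have hC : 0 ≤ ∑ i, p i * g i ^ 2 := Finset.sum_nonneg fun i _ => mul_nonneg (hp0 i) (sq_nonneg _)
  refine ⟨∑ i, p i * g i ^ 2, hC, fun n δ hn hδ => ?_⟩
  have hn' : (0 : ℝ) < n := by exact_mod_cast hn
  have hkey : ∀ i ∈ (typical p n δ)ᶜ, (∏ k, p (i k)) * (n * δ) ^ 2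
      ≤ (∏ k, p (i k)) * (∑ k, g (i k)) ^ 2 := by
    intro i hi
    -- Sequences of probability zero contribute nothing. They are set aside because the logarithm of
    -- the product is a sum only for nonzero factors.
    rcases (Finset.prod_nonneg fun k (_ : k ∈ Finset.univ) => hp0 (i k)).eq_or_lt with h0 | h0
    · rw [← h0, zero_mul, zero_mul]
    · refine mul_le_mul_of_nonneg_left ?_ h0.le
      have hpos : ∀ k, p (i k) ≠ 0 := fun k h => h0.ne' (Finset.prod_eq_zero (Finset.mem_univ k) h)
      have hlog : Real.logb 2 (∏ k, p (i k)) = -(∑ k, g (i k)) - n * shannon p := by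
        rw [Real.logb_prod _ _ fun k _ => hpos k]
        simp only [g, Finset.sum_sub_distrib, Finset.sum_neg_distrib, Finset.sum_const,
          Finset.card_univ, Fintype.card_fin, nsmul_eq_mul]
        ring
      have hprod : ∏ k, p (i k) = (2 : ℝ) ^ (-(∑ k, g (i k)) - n * shannon p) := by
        rw [← hlog, Real.rpow_logb zero_lt_two (by norm_num) h0]
      rw [Finset.mem_compl, mem_typical, hprod, Real.rpow_le_rpow_left_iff one_lt_two,
        Real.rpow_le_rpow_left_iff one_lt_two] at hi
      have habs : n * δ ≤ |∑ k, g (i k)| := by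
        by_contra! h
        rw [abs_lt] at h
        exact hi ⟨by nlinarith [h.2], by nlinarith [h.1]⟩
      rw [← sq_abs (∑ k, g (i k))]
      have : 0 ≤ n * δ := by positivity
      gcongr
  have hsum : (∑ i ∈ (typical p n δ)ᶜ, ∏ k, p (i k)) * (n * δ) ^ 2
      ≤ n * ∑ i, p i * g i ^ 2 := by
    rw [← sum_prod_mul_sum_sq hp hg n, Finset.sum_mul]
    refine (Finset.sum_le_sum hkey).trans ?_
    exact Finset.sum_le_sum_of_subset_of_nonneg (Finset.subset_univ _)
      fun i _ _ => mul_nonneg (Finset.prod_nonneg fun k _ => hp0 _) (sq_nonneg _)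
  rw [le_div_iff₀ (by positivity)]
  have h2 : n * ((∑ i ∈ (typical p n δ)ᶜ, ∏ k, p (i k)) * (n * δ ^ 2)) ≤ n * ∑ i, p i * g i ^ 2 := by
    refine le_trans (le_of_eq ?_) hsum
    ring
  exact le_of_mul_le_mul_left h2 hn'

theorem tendsto_sum_compl_typical [DecidableEq I] {p : I → ℝ} (hp0 : ∀ i, 0 ≤ p i)
    (hp : ∑ i, p i = 1) {δ : ℝ} (hδ : 0 < δ) :
    Tendsto (fun n : ℕ => ∑ i ∈ (typical p n δ)ᶜ, ∏ k, p (i k)) atTop (𝓝 0) := by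
  obtain ⟨C, hC, h⟩ := exists_sum_compl_typical_le hp0 hp
  have h1 : Tendsto (fun n : ℕ => C / (n * δ ^ 2)) atTop (𝓝 0) := by
    have h2 := tendsto_const_div_atTop_nhds_zero_nat (C / δ ^ 2)
    refine h2.congr fun n => ?_
    rw [div_div, mul_comm]
  refine tendsto_of_tendsto_of_tendsto_of_le_of_le' tendsto_const_nhds h1 ?_ ?_
  · exact Eventually.of_forall fun n =>
      Finset.sum_nonneg fun i _ => Finset.prod_nonneg fun k _ => hp0 _
  · filter_upwards [eventually_gt_atTop 0] with n hn
    exact h n δ hn hδ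

end AEP

/-! ### Approximation by states of small Schmidt ranks -/

section Norm

variable {X : Type*} [Fintype X]

theorem sqrt_nsq_eq (f : X → ℂ) :
    Real.sqrt (nsq f) = ‖(WithLp.toLp 2 f : EuclideanSpace ℂ X)‖ / Real.sqrt (Fintype.card X) := by
  rw [nsq_eq, Real.sqrt_div (by positivity), EuclideanSpace.norm_eq]

theorem sqrt_nsq_add_le (f g : X → ℂ) :
    Real.sqrt (nsq fun x => f x + g x) ≤ Real.sqrt (nsq f) + Real.sqrt (nsq g) := by
  simp only [sqrt_nsq_eq, ← add_div]
  gcongr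
  exact norm_add_le (WithLp.toLp 2 f : EuclideanSpace ℂ X) (WithLp.toLp 2 g)

theorem nsq_const_mul (c : ℂ) (f : X → ℂ) : nsq (fun x => c * f x) = ‖c‖ ^ 2 * nsq f := by
  simp only [nsq, norm_mul, mul_pow, Finset.mul_expect]

theorem sqrt_nsq_const_mul (c : ℂ) (f : X → ℂ) :
    Real.sqrt (nsq fun x => c * f x) = ‖c‖ * Real.sqrt (nsq f) := by
  rw [nsq_const_mul, Real.sqrt_mul (by positivity), Real.sqrt_sq (norm_nonneg c)]

/-- The norm of `φ` differs from `1` by at most `η`, so normalizing moves `φ` by at most another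
`η`; `η < 1` keeps `φ` nonzero. -/
theorem exists_normalized {Ψ φ : X → ℂ} (hΨ : nsq Ψ = 1) {η : ℝ} (hη : η < 1)
    (h : Real.sqrt (nsq fun x => Ψ x - φ x) ≤ η) :
    ∃ c : ℂ, nsq (fun x => c * φ x) = 1 ∧
      Real.sqrt (nsq fun x => Ψ x - c * φ x) ≤ 2 * η := by
  set r := Real.sqrt (nsq φ) with hr
  have h1 : 1 ≤ η + r := by
    have := sqrt_nsq_add_le (fun x => Ψ x - φ x) φ
    simp only [sub_add_cancel] at this
    rw [show (fun x => Ψ x) = Ψ from rfl, hΨ, Real.sqrt_one] at this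
    linarith
  have h2 : r ≤ η + 1 := by
    have := sqrt_nsq_add_le (fun x => (-1 : ℂ) * (Ψ x - φ x)) Ψ
    rw [sqrt_nsq_const_mul, hΨ] at this
    have h3 : (fun x => (-1 : ℂ) * (Ψ x - φ x) + Ψ x) = φ := by funext x; ring
    rw [h3] at this
    simp only [norm_neg, norm_one, one_mul, Real.sqrt_one] at this
    linarith
  have hr0 : 0 < r := by linarith
  refine ⟨((r⁻¹ : ℝ) : ℂ), ?_, ?_⟩
  · rw [nsq_const_mul, Complex.norm_real, Real.norm_eq_abs, sq_abs, inv_pow, hr,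
      Real.sq_sqrt (nsq_nonneg φ), inv_mul_cancel₀]
    exact (Real.sqrt_pos.1 hr0).ne'
  · have h3 := sqrt_nsq_add_le (fun x => Ψ x - φ x) (fun x => ((1 - r⁻¹ : ℝ) : ℂ) * φ x)
    have h4 : (fun x => Ψ x - φ x + ((1 - r⁻¹ : ℝ) : ℂ) * φ x)
        = fun x => Ψ x - ((r⁻¹ : ℝ) : ℂ) * φ x := by
      funext x; push_cast; ring
    rw [h4, sqrt_nsq_const_mul, Complex.norm_real, Real.norm_eq_abs, ← hr] at h3
    have h5 : |1 - r⁻¹| * r = |r - 1| := by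
      rw [← abs_of_pos hr0, ← abs_mul, abs_of_pos hr0, sub_mul, one_mul,
        inv_mul_cancel₀ hr0.ne']
    have h6 : |r - 1| ≤ η := abs_le.2 ⟨by linarith, by linarith⟩
    linarith [h5 ▸ h3]

end Norm

theorem locProj_sub {V : Type*} [Fintype V] [DecidableEq V] {κ : V → Type*} [∀ v, Fintype (κ v)]
    {ι : Type*} [Fintype ι] (S : Finset V) (b : ι → (∀ v, κ v) → ℂ) (f g : (∀ v, κ v) → ℂ)
    (x : ∀ v, κ v) : locProj S b (fun x => f x - g x) x = locProj S b f x - locProj S b g x := by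
  simp only [locProj, coef, mul_sub, Finset.expect_sub_distrib, Finset.sum_sub_distrib]

/-! ### Simultaneous truncation along all edges. -/

section Tree

variable {V : Type} [Fintype V] [DecidableEq V] {T : SimpleGraph V} {root : V}

/-- Projecting on all the lower sides, larger ones first, approximates `Ψ` by a function
whose Schmidt rank is small across all edges. -/
theorem exists_schmidtRankLE_approx {κ : V → Type*} [∀ v, Fintype (κ v)] (hT : T.IsTree)
    (Ψ : (∀ v, κ v) → ℂ) {t : T.edgeSet → Type*} [∀ e, Fintype (t e)] [∀ e, DecidableEq (t e)]
    {b : ∀ e, t e → (∀ v, κ v) → ℂ}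
    (hb : ∀ e i, DependsOn (b e i) (lowerSide T root e : Set V))
    (ho : ∀ e, OrthonormalFamily (b e)) (s : Finset T.edgeSet) :
    ∃ φ : (∀ v, κ v) → ℂ, Real.sqrt (nsq fun x => Ψ x - φ x) ≤
        ∑ e ∈ s, Real.sqrt (nsq fun x => Ψ x - locProj (lowerSide T root e) (b e) Ψ x) ∧
      ∀ e ∈ s, SchmidtRankLE (lowerSide T root e) (Fintype.card (t e)) φ := by
  classical
  -- The projection on the smallest lower side is applied last. It lies within each earlier side or
  -- is disjoint from it, and so preserves the ranks obtained there.
  induction s using Finset.induction_on_min_value (fun e => (lowerSide T root e).card) with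
  | empty => exact ⟨Ψ, by simp [nsq], by simp⟩
  | insert a s ha hmin ih =>
    obtain ⟨φ, h1, h2⟩ := ih
    let L := locProj (lowerSide T root a) (b a)
    refine ⟨L φ, ?_, fun e he => ?_⟩
    · rw [Finset.sum_insert ha]
      -- Since `L` is a contraction, the earlier error does not grow, and the new error is that of
      -- `L` on `Ψ` itself.
      have h3 := sqrt_nsq_add_le (fun x => Ψ x - L Ψ x) (L fun x => Ψ x - φ x)
      have h4 : (fun x => Ψ x - L Ψ x + L (fun x => Ψ x - φ x) x) = fun x => Ψ x - L φ x := by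
        funext x
        have := locProj_sub (lowerSide T root a) (b a) Ψ φ x
        simp only [L, this]
        ring
      rw [h4] at h3
      have h5 := Real.sqrt_le_sqrt (nsq_locProj_le (hb a) (ho a) fun x => Ψ x - φ x)
      exact h3.trans (add_le_add le_rfl (h5.trans h1))
    · rcases Finset.mem_insert.1 he with rfl | he'
      · exact schmidtRankLE_locProj (hb e) φ
      rcases lowerSide_laminar (root := root) hT e a with h | h | h
      -- An inclusion in the wrong direction is an equality, by minimality of the cardinality.
      · exact (h2 e he').locProj_of_subset (hb a)
          (Finset.eq_of_subset_of_card_le h (hmin e he')).ge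
      · exact (h2 e he').locProj_of_subset (hb a) h
      · exact (h2 e he').locProj_of_disjoint (hb a) h.symm

end Tree

/-! ### Achievable configurations -/

section Achievable

variable {V : Type} [Fintype V] [DecidableEq V] {T : SimpleGraph V} [DecidableRel T.Adj]
  {root : V} {d : V → ℕ} {ψ : EuclideanSpace ℂ (∀ v, Fin (d v))}

theorem sum_norm_sq_eq_one (hψ : ‖ψ‖ = 1) : ∑ x, ‖ψ x‖ ^ 2 = 1 := by
  rw [← EuclideanSpace.norm_sq_eq, hψ, one_pow]

theorem nonempty_fin_of_norm_eq_one (hψ : ‖ψ‖ = 1) (v : V) : Nonempty (Fin (d v)) := by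
  by_contra h
  have hE : IsEmpty (∀ v, Fin (d v)) := ⟨fun x => h ⟨x v⟩⟩
  have := sum_norm_sq_eq_one hψ
  simp at this

theorem sum_norm_sq_copies (hψ : ‖ψ‖ = 1) (n : ℕ) : ∑ x, ‖copies ψ n x‖ ^ 2 = 1 := by
  have h := sum_norm_sq_eq_one hψ
  rw [← Equiv.sum_comp (Equiv.piComm fun v (_ : Fin n) => Fin (d v)).symm]
  have h1 : ∀ y : Fin n → ∀ v, Fin (d v),
      ‖copies ψ n ((Equiv.piComm fun v (_ : Fin n) => Fin (d v)).symm y)‖ ^ 2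
        = ∏ k, ‖ψ (y k)‖ ^ 2 := fun y => by
    simp only [copies, norm_prod, Finset.prod_pow]
    rfl
  simp only [h1]
  exact sum_prod_eq_one h n

theorem nsq_sqrt_card_mul {X : Type*} [Fintype X] [Nonempty X] (f : X → ℂ) :
    nsq (fun x => ((Real.sqrt (Fintype.card X) : ℝ) : ℂ) * f x) = ∑ x, ‖f x‖ ^ 2 := by
  rw [nsq_const_mul, Complex.norm_real, Real.norm_eq_abs, sq_abs, Real.sq_sqrt (by positivity),
    nsq_eq, mul_div_cancel₀]
  exact_mod_cast Fintype.card_ne_zero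

theorem hasSchmidtDecomp_copies (hψ : ‖ψ‖ = 1) (e : T.edgeSet) (n : ℕ) :
    HasSchmidtDecomp (κ := fun v => Fin n → Fin (d v)) (lowerSide T root e)
      (fun i : Fin n → _ => ∏ k, (edgeState_isHermitian T root ψ e).eigenvalues (i k))
      (fun x => ((Real.sqrt (Fintype.card (∀ v, Fin n → Fin (d v))) : ℝ) : ℂ) * copies ψ n x) := by
  have hne := nonempty_fin_of_norm_eq_one hψ
  have h := (hasSchmidtDecomp_partialTrace (κ := fun v => Fin (d v)) (lowerSide T root e) ψ
    (edgeState_isHermitian T root ψ e)).copies n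
  have hcard : (Fintype.card (∀ v, Fin n → Fin (d v)) : ℝ) = (Fintype.card (∀ v, Fin (d v))) ^ n := by
    rw [Fintype.card_congr (Equiv.piComm fun v (_ : Fin n) => Fin (d v))]
    simp
  have hsqrt : ∀ a : ℝ, 0 ≤ a → Real.sqrt (a ^ n) = Real.sqrt a ^ n := fun a ha => by
    rw [← Real.sqrt_sq (pow_nonneg (Real.sqrt_nonneg a) n), ← pow_mul, mul_comm, pow_mul,
      Real.sq_sqrt ha]
  have hΨ : (fun x => ((Real.sqrt (Fintype.card (∀ v, Fin n → Fin (d v))) : ℝ) : ℂ) *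
      copies ψ n x) = fun x => ∏ k : Fin n, ((Real.sqrt (Fintype.card (∀ v, Fin (d v))) : ℝ) : ℂ) *
        ψ fun v => x v k := by
    funext x
    rw [Finset.prod_mul_distrib, hcard, Finset.prod_const, Finset.card_univ, Fintype.card_fin,
      hsqrt _ (Nat.cast_nonneg _), Complex.ofReal_pow]
    rfl
  rw [hΨ]
  exact h

theorem eigenvalues_nonneg (hψ : ‖ψ‖ = 1) (e : T.edgeSet) (i) :
    0 ≤ (edgeState_isHermitian T root ψ e).eigenvalues i := by
  have hne := nonempty_fin_of_norm_eq_one hψ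
  exact (hasSchmidtDecomp_partialTrace (κ := fun v => Fin (d v)) (lowerSide T root e) ψ
    (edgeState_isHermitian T root ψ e)).nonneg i

theorem sum_eigenvalues (hψ : ‖ψ‖ = 1) (e : T.edgeSet) :
    ∑ i, (edgeState_isHermitian T root ψ e).eigenvalues i = 1 := by
  have hne := nonempty_fin_of_norm_eq_one hψ
  have := (hasSchmidtDecomp_partialTrace (κ := fun v => Fin (d v)) (lowerSide T root e) ψ
    (edgeState_isHermitian T root ψ e)).sum_eq
  rw [nsq_sqrt_card_mul, sum_norm_sq_eq_one hψ] at this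
  exact this

/-- A state close to `ψ^{⊗ n}` yields an achievable configuration, with costs bounded by the
Schmidt ranks of the state. -/
theorem exists_mem_achievable (hT : T.IsTree) (root : V) (hψ : ‖ψ‖ = 1) {n : ℕ} {ε : ℝ}
    (hε : 0 ≤ ε) {φ : (∀ v, Fin n → Fin (d v)) → ℂ} (hφ : ∑ x, ‖φ x‖ ^ 2 = 1)
    (h : 8 * ∑ x, ‖φ x - copies ψ n x‖ ^ 2 ≤ ε ^ 2) :
    ∃ m ∈ achievable T ψ n ε, ∀ e M, SchmidtRankLE (lowerSide T root e) M φ → m e ≤ M := by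
  obtain ⟨m, h1, h2, Γ, hΓ, h3⟩ := exists_isLOCC_pureDensity hT root φ hφ
  refine ⟨m, ⟨h1, Γ, hΓ, ?_⟩, h2⟩
  rw [h3]
  exact abs_le_of_sq_le_sq' ((traceNorm_pureDensity_sub_sq_le hφ (sum_norm_sq_copies hψ n)).trans h)
    hε |>.2

/-- Exact preparation of `ψ^{⊗ n}` makes the set of achievable configurations nonempty. Minimizing
the sum of logarithms amounts to minimizing the product of the dimensions, which is a natural
number. -/
theorem exists_isOptimalConfig (hT : T.IsTree) (root : V) (hψ : ‖ψ‖ = 1) (n : ℕ) {ε : ℝ}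
    (hε : 0 ≤ ε) : ∃ m, IsOptimalConfig T ψ n ε m := by
  obtain ⟨m₀, hm₀, _⟩ := exists_mem_achievable hT root hψ hε (sum_norm_sq_copies hψ n)
    (by simpa using sq_nonneg ε)
  obtain ⟨m, hm, hmin⟩ := exists_minimalFor_of_wellFoundedLT (fun m => m ∈ achievable T ψ n ε)
    (fun m => ∏ e, m e) ⟨m₀, hm₀⟩
  refine ⟨m, hm, fun m' hm' => ?_⟩
  have hlog : ∀ k ∈ achievable T ψ n ε, totalEntanglement T k = Real.logb 2 ((∏ e, k e : ℕ) : ℝ) ∧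
      0 < ∏ e, k e := fun k hk => by
    have h0 : ∀ e, 0 < k e := hk.1
    refine ⟨?_, Finset.prod_pos fun e _ => h0 e⟩
    rw [Nat.cast_prod, Real.logb_prod _ _ fun e _ => Nat.cast_ne_zero.2 (h0 e).ne']
    rfl
  rw [(hlog m hm).1, (hlog m' hm').1]
  refine Real.logb_le_logb_of_le one_lt_two (by exact_mod_cast (hlog m hm).2) ?_
  rcases le_total (∏ e, m e) (∏ e, m' e) with h | h
  · exact_mod_cast h
  · exact_mod_cast hmin hm' h

/-- The typical truncations along the finitely many edges have a total error tending to zero, and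
the resulting Schmidt ranks are at most the numbers of typical sequences. -/
theorem eventually_exists_mem_achievable (hT : T.IsTree) (root : V) (hψ : ‖ψ‖ = 1) {ε δ : ℝ}
    (hε : 0 < ε) (hδ : 0 < δ) : ∀ᶠ n in atTop, ∃ m ∈ achievable T ψ n ε, ∀ e,
      (m e : ℝ) ≤ 2 ^ (n * (vonNeumannEntropy (edgeState T root ψ e)
        (edgeState_isHermitian T root ψ e) + δ)) := by
  classical
  let p := fun e => (edgeState_isHermitian T root ψ e).eigenvalues
  have hp0 : ∀ e i, 0 ≤ p e i := fun e => eigenvalues_nonneg hψ e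
  have hp : ∀ e, ∑ i, p e i = 1 := fun e => sum_eigenvalues hψ e
  have hlim : Tendsto (fun n : ℕ => ∑ e, Real.sqrt (∑ i ∈ (typical (p e) n δ)ᶜ, ∏ k, p e (i k)))
      atTop (𝓝 0) := by
    have : (0 : ℝ) = ∑ e : T.edgeSet, Real.sqrt 0 := by simp
    rw [this]
    exact tendsto_finsetSum _ fun e _ =>
      (Real.continuous_sqrt.tendsto 0).comp (tendsto_sum_compl_typical (hp0 e) (hp e) hδ)
  -- The bound `1/2` permits normalization; after doubling, `ε/6` gives distance at most `ε/3`, and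
  -- `8 (ε/3)² ≤ ε²`.
  have hη : (0 : ℝ) < min (1 / 2) (ε / 6) := by positivity
  filter_upwards [hlim.eventually_le_const hη] with n hn
  have hne := nonempty_fin_of_norm_eq_one hψ
  choose b hb ho hb2 using fun e => (hasSchmidtDecomp_copies (root := root) hψ e n).exists_truncation
    (typical (p e) n δ)
  let c : ℂ := ((Real.sqrt (Fintype.card (∀ v, Fin n → Fin (d v))) : ℝ) : ℂ)
  have hc : c ≠ 0 := by
    have : (0 : ℝ) < Fintype.card (∀ v, Fin n → Fin (d v)) := by exact_mod_cast Fintype.card_pos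
    exact Complex.ofReal_ne_zero.2 (Real.sqrt_pos.2 this).ne'
  have hΨ : nsq (fun x => c * copies ψ n x) = 1 := by
    rw [nsq_sqrt_card_mul, sum_norm_sq_copies hψ]
  obtain ⟨φ, h1, h2⟩ := exists_schmidtRankLE_approx hT (fun x => c * copies ψ n x) hb ho
    Finset.univ
  simp only [c, hb2] at h1
  have h3 := h1.trans hn
  obtain ⟨a, ha1, ha2⟩ := exists_normalized hΨ (lt_of_le_of_lt (min_le_left _ _) (by norm_num)) h3
  -- Undo the factor `√card` to return to a unit vector for the counting measure.
  let χ : (∀ v, Fin n → Fin (d v)) → ℂ := fun x => c⁻¹ * (a * φ x)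
  have hχ : ∀ x, c * χ x = a * φ x := fun x => mul_inv_cancel_left₀ hc _
  have hχ1 : ∑ x, ‖χ x‖ ^ 2 = 1 := by
    rw [← nsq_sqrt_card_mul, ← ha1]
    exact congrArg nsq (funext hχ)
  have hχ2 : ∑ x, ‖χ x - copies ψ n x‖ ^ 2
      = nsq fun x => c * copies ψ n x - a * φ x := by
    simp only [norm_sub_rev (χ _)]
    rw [← nsq_sqrt_card_mul]
    congr 1
    funext x
    rw [← hχ]
    exact mul_sub _ _ _
  obtain ⟨m, hm, hr⟩ := exists_mem_achievable hT root hψ hε.le hχ1 (by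
    rw [hχ2]
    have h4 : Real.sqrt (nsq fun x => c * copies ψ n x - a * φ x) ≤ ε / 3 :=
      ha2.trans (by linarith [min_le_right (1 / 2) (ε / 6)])
    rw [Real.sqrt_le_left (by positivity)] at h4
    nlinarith [sq_nonneg ε])
  refine ⟨m, hm, fun e => le_trans ?_ (card_typical_le (hp0 e) (hp e) n δ)⟩
  have h5 := hr e _ (((h2 e (Finset.mem_univ e)).const_mul a).const_mul c⁻¹)
  rw [Fintype.card_coe] at h5
  exact_mod_cast h5

end Achievable

/-! ### The converse bound -/

section Converse

variable {V : Type} [Fintype V] [DecidableEq V]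

theorem dependsOn_finset_prod {κ : V → Type*} {ι : Type*} {s : Finset ι}
    {f : ι → (∀ v, κ v) → ℂ} {R : Set V} (h : ∀ i ∈ s, DependsOn (f i) R) :
    DependsOn (fun x => ∏ i ∈ s, f i x) R :=
  fun _ _ hxy => Finset.prod_congr rfl fun i hi => h i hi hxy

/-- Product operators do not increase the Schmidt rank. -/
theorem SchmidtRankLE.localOp_mulVec {ι κ : V → Type} [∀ v, Fintype (ι v)] {S : Finset V} {M : ℕ}
    {φ : (∀ v, ι v) → ℂ} (h : SchmidtRankLE S M φ) (A : ∀ v, Matrix (κ v) (ι v) ℂ) :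
    SchmidtRankLE S M ((localOp A).mulVec φ) := by
  obtain ⟨f, g, hf, hg, hφ⟩ := h
  -- The sum over the inputs is `card` times an average, which factorizes over the cut; the left
  -- factor absorbs `card`.
  refine ⟨fun l y => (Fintype.card (∀ v, ι v) : ℂ) * 𝔼 x, f l x * ∏ v ∈ S, A v (y v) (x v),
    fun l y => 𝔼 x, g l x * ∏ v ∈ Sᶜ, A v (y v) (x v), fun l y y' hy => ?_, fun l y y' hy => ?_,
    fun y => ?_⟩
  · have : ∀ x : (∀ v, ι v), ∏ v ∈ S, A v (y v) (x v) = ∏ v ∈ S, A v (y' v) (x v) :=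
      fun x => Finset.prod_congr rfl fun v hv => by rw [hy v hv]
    simp only [this]
  · have : ∀ x : (∀ v, ι v), ∏ v ∈ Sᶜ, A v (y v) (x v) = ∏ v ∈ Sᶜ, A v (y' v) (x v) :=
      fun x => Finset.prod_congr rfl fun v hv => by
        rw [hy v (by simpa using hv)]
    simp only [this]
  · have h1 : ∀ l, 𝔼 x, (f l x * ∏ v ∈ S, A v (y v) (x v)) * (g l x * ∏ v ∈ Sᶜ, A v (y v) (x v))
        = (𝔼 x, f l x * ∏ v ∈ S, A v (y v) (x v)) * 𝔼 x, g l x * ∏ v ∈ Sᶜ, A v (y v) (x v) :=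
      fun l => expect_mul_of_dependsOn (S := S) (R := (S : Set V)ᶜ)
        (dependsOn_mul (hf l) (dependsOn_finset_prod fun v hv x x' hx => by
          simp only [hx v hv]))
        (dependsOn_mul (hg l) (dependsOn_finset_prod fun v hv x x' hx => by
          simp only [hx v (by simpa using hv)])) disjoint_compl_right
    have h2 : ∀ l, (Fintype.card (∀ v, ι v) : ℂ) * (𝔼 x, f l x * ∏ v ∈ S, A v (y v) (x v)) *
        (𝔼 x, g l x * ∏ v ∈ Sᶜ, A v (y v) (x v)) = ∑ x, (f l x * ∏ v ∈ S, A v (y v) (x v)) *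
          (g l x * ∏ v ∈ Sᶜ, A v (y v) (x v)) := fun l => by
      rw [mul_assoc, ← h1, Fintype.card_mul_expect]
    simp only [h2]
    rw [Finset.sum_comm, Matrix.mulVec, dotProduct]
    refine Finset.sum_congr rfl fun x _ => ?_
    rw [hφ, Finset.mul_sum]
    refine Finset.sum_congr rfl fun l _ => ?_
    rw [localOp, Matrix.of_apply, ← Finset.prod_mul_prod_compl S]
    ring

variable {T : SimpleGraph V} [DecidableRel T.Adj] {root : V} {m : T.edgeSet → ℕ}

/-- Only `e` crosses its own cut; its common basis state is the Schmidt index. Every other edge has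
both ends on one side, and its factor goes to that side. -/
theorem schmidtRankLE_resourceVec (hT : T.IsTree) (e : T.edgeSet) :
    SchmidtRankLE (lowerSide T root e) (m e) (resourceVec T m) := by
  classical
  set S := lowerSide T root e with hS
  obtain ⟨c, p, he, hc, hp⟩ := exists_ends (root := root) hT e
  have hce : c ∈ e.1 := by rw [he]; simp
  have hpe : p ∈ e.1 := by rw [he]; simp
  let F : T.edgeSet → (∀ v, ResourceIndex T m v) → ℂ := fun e' x =>
    if ∀ (v v' : V) (h : v ∈ e'.1) (h' : v' ∈ e'.1), x v ⟨e', h⟩ = x v' ⟨e', h'⟩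
    then (((Real.sqrt (m e'))⁻¹ : ℝ) : ℂ) else 0
  have hF : ∀ (e' : T.edgeSet) (R : Set V), (∀ v ∈ e'.1, v ∈ R) → DependsOn (F e') R := by
    intro e' R h x y hxy
    have : ∀ (v v' : V) (h : v ∈ e'.1) (h' : v' ∈ e'.1),
        (x v ⟨e', h⟩ = x v' ⟨e', h'⟩ ↔ y v ⟨e', h⟩ = y v' ⟨e', h'⟩) := fun v v' hv hv' => by
      rw [hxy v (h v hv), hxy v' (h v' hv')]
    simp only [F, this]
  have hside : ∀ e' : T.edgeSet, e' ≠ e → (∀ v ∈ e'.1, v ∈ (S : Set V)) ∨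
      ∀ v ∈ e'.1, v ∈ (S : Set V)ᶜ := by
    intro e' hne
    obtain ⟨a, b, hab, -, -⟩ := exists_ends (root := root) hT e'
    have hadj : T.Adj a b := by
      have := e'.2
      rwa [hab] at this
    have hiff := mem_lowerSide_iff_of_ne (root := root) (e := e) hadj
      (fun h => hne (Subtype.ext (hab.trans h)))
    rw [hab]
    simp only [Sym2.mem_iff, forall_eq_or_imp, forall_eq, Finset.mem_coe, Set.mem_compl_iff]
    by_cases ha : a ∈ S
    · exact Or.inl ⟨ha, hiff.1 ha⟩
    · exact Or.inr ⟨ha, fun hb => ha (hiff.2 hb)⟩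
  let s : Finset T.edgeSet := (Finset.univ.erase e).filter fun e' => ∀ v ∈ e'.1, v ∈ (S : Set V)
  let s' : Finset T.edgeSet := (Finset.univ.erase e).filter fun e' => ¬ ∀ v ∈ e'.1, v ∈ (S : Set V)
  refine ⟨fun l x => (if x c ⟨e, hce⟩ = l then 1 else 0) * ∏ e' ∈ s, F e' x,
    fun l x => (if x p ⟨e, hpe⟩ = l then (((Real.sqrt (m e))⁻¹ : ℝ) : ℂ) else 0) *
      ∏ e' ∈ s', F e' x, fun l => ?_, fun l => ?_, fun x => ?_⟩
  · refine dependsOn_mul (fun x y hxy => by simp only [hxy c hc]) (dependsOn_finset_prod ?_)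
    exact fun e' he' => hF e' _ (Finset.mem_filter.1 he').2
  · refine dependsOn_mul (fun x y hxy => by simp only [hxy p hp]) (dependsOn_finset_prod ?_)
    intro e' he'
    obtain ⟨h1, h2⟩ := Finset.mem_filter.1 he'
    exact hF e' _ ((hside e' (Finset.ne_of_mem_erase h1)).resolve_left h2)
  · have h1 : resourceVec T m x = ∏ e', F e' x := rfl
    have h2 : F e x = if x c ⟨e, hce⟩ = x p ⟨e, hpe⟩ then (((Real.sqrt (m e))⁻¹ : ℝ) : ℂ)
        else 0 := by
      refine if_congr ⟨fun h => h c p hce hpe, fun h v v' hv hv' => ?_⟩ rfl rfl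
      have key : ∀ w (hw : w ∈ e.1), x w ⟨e, hw⟩ = x c ⟨e, hce⟩ := by
        intro w hw
        have : w = c ∨ w = p := by rwa [he, Sym2.mem_iff] at hw
        rcases this with rfl | rfl
        · rfl
        · exact h.symm
      rw [key v hv, key v' hv']
    rw [h1, ← Finset.mul_prod_erase _ _ (Finset.mem_univ e),
      ← Finset.prod_filter_mul_prod_filter_not (Finset.univ.erase e)
        (fun e' => ∀ v ∈ e'.1, v ∈ (S : Set V)), h2]
    rw [Finset.sum_eq_single (x c ⟨e, hce⟩)]
    · simp only [if_true, one_mul, eq_comm (a := x p ⟨e, hpe⟩), s, s']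
      ring
    · intro l _ hl
      beta_reduce
      rw [if_neg hl.symm, zero_mul, zero_mul]
    · simp

theorem sum_norm_sq_resourceVec (hT : T.IsTree) (hm : ∀ e, 1 ≤ m e) :
    ∑ x, ‖resourceVec T m x‖ ^ 2 = 1 := by
  have h : ((∑ x, ‖resourceVec T m x‖ ^ 2 : ℝ) : ℂ) = 1 := by
    push_cast
    simp only [← Complex.conj_mul']
    rw [sum_mul_resourceVec hT fun x => conj (resourceVec T m x)]
    have h1 : ∀ l : (∀ e, Fin (m e)), conj (resourceVec T m fun _ e => l e.1)
        = ∏ e, (((Real.sqrt (m e))⁻¹ : ℝ) : ℂ) := by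
      intro l
      rw [resourceVec, map_prod]
      refine Finset.prod_congr rfl fun e _ => ?_
      rw [if_pos fun _ _ _ _ => rfl, Complex.conj_ofReal]
    simp only [h1, Finset.sum_const, Finset.card_univ, Fintype.card_pi, Fintype.card_fin,
      nsmul_eq_mul, Nat.cast_prod]
    rw [← Finset.prod_mul_distrib, ← Finset.prod_mul_distrib]
    refine Finset.prod_eq_one fun e _ => ?_
    have h2 : (0 : ℝ) < m e := by exact_mod_cast hm e
    rw [← Complex.ofReal_natCast, ← Complex.ofReal_mul, ← Complex.ofReal_mul,
      ← Complex.ofReal_one]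
    congr 1
    rw [mul_left_comm, ← mul_inv, Real.mul_self_sqrt h2.le, mul_inv_cancel₀ h2.ne']
  exact_mod_cast h

theorem star_dotProduct_pureDensity_mulVec {ι : Type} [Fintype ι] (χ u : ι → ℂ) :
    star u ⬝ᵥ (pureDensity χ).mulVec u = ((‖star χ ⬝ᵥ u‖ ^ 2 : ℝ) : ℂ) := by
  rw [pureDensity, Matrix.vecMulVec_mulVec, dotProduct_smul, Matrix.star_dotProduct u,
    MulOpposite.smul_eq_mul_unop]
  push_cast
  rw [← Complex.conj_mul']
  rfl

theorem star_dotProduct_self {ι : Type} [Fintype ι] (u : ι → ℂ) :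
    star u ⬝ᵥ u = ((∑ i, ‖u i‖ ^ 2 : ℝ) : ℂ) := by
  push_cast
  simp only [← Complex.conj_mul']
  rfl

variable {d : V → ℕ} {ψ : EuclideanSpace ℂ (∀ v, Fin (d v))}

/-- Every achievable configuration has a cost at `e` that supports the Schmidt coefficients of
`ψ^{⊗ n}` across `e`. -/
theorem one_sub_le_of_mem_achievable (hT : T.IsTree) (hψ : ‖ψ‖ = 1) {n : ℕ} {ε : ℝ}
    (hm : m ∈ achievable T ψ n ε) (e : T.edgeSet) {I : Type} [Fintype I] [DecidableEq I]
    {p : I → ℝ} (hdec : HasSchmidtDecomp (κ := fun v => Fin n → Fin (d v)) (lowerSide T root e) p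
      (fun x => ((Real.sqrt (Fintype.card (∀ v, Fin n → Fin (d v))) : ℝ) : ℂ) * copies ψ n x))
    (t : Finset I) {τ : ℝ} (ht : ∀ i ∈ t, p i ≤ τ) (hτ : 0 ≤ τ) :
    1 - ε ≤ ∑ i ∈ tᶜ, p i + τ * m e := by
  obtain ⟨hm1, Γ, ⟨r, hΓ⟩, hε⟩ := hm
  obtain ⟨J, _, A, hA, hΓA⟩ := hΓ.exists_separable r
  have hne := nonempty_fin_of_norm_eq_one hψ
  set u := copies ψ n with hu
  have hu1 : ∑ x, ‖u x‖ ^ 2 = 1 := sum_norm_sq_copies hψ n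
  -- The unnormalized output vectors of the separable Kraus operators; their squared norms are the
  -- outcome probabilities.
  let χ := fun i => (localOp (A i)).mulVec (resourceVec T m)
  have hχ : ∑ i, ∑ x, ‖χ i x‖ ^ 2 = 1 := by
    have h1 : ((∑ i, ∑ x, ‖χ i x‖ ^ 2 : ℝ) : ℂ) = 1 := by
      rw [Complex.ofReal_sum]
      simp only [← star_dotProduct_self]
      have h2 : ∀ i, star (χ i) ⬝ᵥ χ i = star (resourceVec T m) ⬝ᵥ
          ((localOp (A i)).conjTranspose * localOp (A i)).mulVec (resourceVec T m) := fun i => by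
        simp only [χ]
        rw [Matrix.star_mulVec, ← Matrix.dotProduct_mulVec, Matrix.mulVec_mulVec]
      simp only [h2]
      rw [← dotProduct_sum, ← Matrix.sum_mulVec, hA, Matrix.one_mulVec, star_dotProduct_self,
        sum_norm_sq_resourceVec hT hm1, Complex.ofReal_one]
    exact_mod_cast h1
  have hov : ∀ i, ‖star (χ i) ⬝ᵥ u‖ ^ 2 ≤ (∑ x, ‖χ i x‖ ^ 2) * (∑ i ∈ tᶜ, p i + τ * m e) := by
    intro i
    let c : ℂ := ((Real.sqrt (Fintype.card (∀ v, Fin n → Fin (d v))) : ℝ) : ℂ)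
    have h1 := hdec.norm_ip_sq_le (((schmidtRankLE_resourceVec (root := root) (m := m) hT
      e).localOp_mulVec (A i)).const_mul c) t ht hτ
    rw [nsq_sqrt_card_mul] at h1
    have h2 : ip (fun x => c * χ i x) (fun x => c * u x) = star (χ i) ⬝ᵥ u := by
      rw [ip_mul_left, ip_mul_right, ip, Fintype.expect_eq_sum_div_card]
      have hcard : (0 : ℝ) < Fintype.card (∀ v, Fin n → Fin (d v)) := by
        exact_mod_cast Fintype.card_pos
      have hc : conj c * c = (Fintype.card (∀ v, Fin n → Fin (d v)) : ℂ) := by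
        simp only [c, Complex.conj_ofReal]
        rw [← Complex.ofReal_mul, Real.mul_self_sqrt hcard.le, Complex.ofReal_natCast]
      rw [← mul_assoc, hc, mul_div_cancel₀ _ (by exact_mod_cast hcard.ne')]
      rfl
    rw [← h2]
    exact h1
  have hsum : ∑ i, ‖star (χ i) ⬝ᵥ u‖ ^ 2 ≤ ∑ i ∈ tᶜ, p i + τ * m e := by
    refine (Finset.sum_le_sum fun i _ => hov i).trans ?_
    rw [← Finset.sum_mul, hχ, one_mul]
  -- The expectation in the target state is the fidelity minus `1`, and the trace norm bounds its
  -- modulus.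
  have hval : star u ⬝ᵥ (Γ (pureDensity (resourceVec T m)) - pureDensity u).mulVec u
      = ((∑ i, ‖star (χ i) ⬝ᵥ u‖ ^ 2 - 1 : ℝ) : ℂ) := by
    rw [hΓA]
    simp only [pureDensity_mulVec]
    rw [Matrix.sub_mulVec, Matrix.sum_mulVec, dotProduct_sub, dotProduct_sum]
    simp only [star_dotProduct_pureDensity_mulVec]
    rw [star_dotProduct_self, hu1]
    push_cast
    simp [χ]
  have hle := (norm_dotProduct_mulVec_le_traceNorm _ hu1).trans hε
  rw [hval, Complex.norm_real, Real.norm_eq_abs] at hle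
  linarith [(abs_le.1 hle).1]

/-- Typicality with `δ/2` gives `τ = 2 ^ (-n (S - δ/2))`. The other half of `δ` absorbs the constant
`(1 - ε)/2` that is left once the tail is at most `(1 - ε)/2`. -/
theorem eventually_forall_mem_achievable_le (hT : T.IsTree) (root : V) (hψ : ‖ψ‖ = 1) {ε δ : ℝ}
    (hε : ε < 1) (hδ : 0 < δ) (e : T.edgeSet) : ∀ᶠ n : ℕ in atTop, ∀ m ∈ achievable T ψ n ε,
      (2 : ℝ) ^ (n * (vonNeumannEntropy (edgeState T root ψ e)
        (edgeState_isHermitian T root ψ e) - δ)) ≤ m e := by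
  classical
  let p := (edgeState_isHermitian T root ψ e).eigenvalues
  have hp0 : ∀ i, 0 ≤ p i := eigenvalues_nonneg hψ e
  have hp : ∑ i, p i = 1 := sum_eigenvalues hψ e
  have hδ2 : 0 < δ / 2 := by positivity
  have h1 := (tendsto_sum_compl_typical hp0 hp hδ2).eventually_le_const
    (show (0 : ℝ) < (1 - ε) / 2 by linarith)
  have h2 : Tendsto (fun n : ℕ => (2 : ℝ) ^ (-(n * (δ / 2)))) atTop (𝓝 0) := by
    have h3 : ∀ n : ℕ, ((2 : ℝ) ^ (-(δ / 2))) ^ n = (2 : ℝ) ^ (-(n * (δ / 2))) := fun n => by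
      rw [← Real.rpow_natCast, ← Real.rpow_mul zero_le_two]
      congr 1; ring
    simp only [← h3]
    refine tendsto_pow_atTop_nhds_zero_of_lt_one (by positivity) ?_
    exact Real.rpow_lt_one_of_one_lt_of_neg one_lt_two (by linarith)
  filter_upwards [h1, h2.eventually_le_const (show (0 : ℝ) < (1 - ε) / 2 by linarith)]
    with n hn1 hn2 m hm
  have h4 := one_sub_le_of_mem_achievable hT hψ hm e
    (hasSchmidtDecomp_copies (root := root) hψ e n) (typical p n (δ / 2))
    (fun i hi => (mem_typical.1 hi).2) (by positivity)
  have h5 : (2 : ℝ) ^ (-(n * (δ / 2))) ≤ (2 : ℝ) ^ (-(n * (shannon p - δ / 2))) * m e := by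
    linarith
  have h6 : (0 : ℝ) < (2 : ℝ) ^ (n * (shannon p - δ / 2)) := by positivity
  have h7 := mul_le_mul_of_nonneg_left h5 h6.le
  rw [← mul_assoc, ← Real.rpow_add zero_lt_two, ← Real.rpow_add zero_lt_two, add_neg_cancel,
    Real.rpow_zero, one_mul] at h7
  refine le_trans (le_of_eq ?_) h7
  change (2 : ℝ) ^ (n * (shannon p - δ)) = _
  congr 1; ring

end Converse

end TreeCost

end

/-! ### The asymptotic edge costs. -/

theorem corollary8 {V : Type} [Fintype V] [DecidableEq V]
    (T : SimpleGraph V) [DecidableRel T.Adj] (hT : T.IsTree) (root : V)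
    (d : V → ℕ) (ψ : EuclideanSpace ℂ (∀ v, Fin (d v))) (hψ : ‖ψ‖ = 1) :
    (∀ n : ℕ, 0 < n → ∀ ε : ℝ, 0 < ε →
      ∃ m : T.edgeSet → ℕ, TreeCost.IsOptimalConfig T ψ n ε m) ∧
    ∀ m : ℕ → ℝ → T.edgeSet → ℕ,
      (∀ n : ℕ, 0 < n → ∀ ε : ℝ, 0 < ε → TreeCost.IsOptimalConfig T ψ n ε (m n ε)) →
      ∀ e : T.edgeSet,
        TreeCost.HasIteratedLimit (fun n ε => (1 / (n : ℝ)) * Real.logb 2 (m n ε e))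
          (TreeCost.vonNeumannEntropy (TreeCost.edgeState T root ψ e)
            (TreeCost.edgeState_isHermitian T root ψ e)) := by
  refine ⟨fun n _ ε hε => TreeCost.exists_isOptimalConfig hT root hψ n hε.le, fun m hm e => ?_⟩
  let S := fun e => TreeCost.vonNeumannEntropy (TreeCost.edgeState T root ψ e)
    (TreeCost.edgeState_isHermitian T root ψ e)
  -- The inner limit does not depend on `ε` in `(0, 1)`, so the outer limit is that of a constant.
  refine ⟨fun _ => S e, ?_, tendsto_const_nhds⟩
  filter_upwards [Ioo_mem_nhdsGT (zero_lt_one' ℝ)] with ε hε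
  -- The form with `n > N` ensures `n > 0`, where the configuration is known to be optimal.
  rw [Metric.tendsto_atTop']
  intro r hr
  let K : ℝ := Fintype.card T.edgeSet
  have hK : 0 ≤ K := Nat.cast_nonneg _
  -- The total excess is at most `2 K n δ`, with `K` the number of edges; the extra `2` in the
  -- denominator makes the final bound strict and covers `K = 0`.
  let δ := r / (2 * K + 2)
  have hδ : 0 < δ := by positivity
  have hδr : δ * (2 * K + 2) = r := div_mul_cancel₀ _ (by positivity)
  obtain ⟨N, hN⟩ := eventually_atTop.1
    ((TreeCost.eventually_exists_mem_achievable hT root hψ hε.1 hδ).and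
      (eventually_all.2 fun e =>
        TreeCost.eventually_forall_mem_achievable_le hT root hψ hε.2 hδ e))
  refine ⟨N, fun n hn => ?_⟩
  obtain ⟨⟨m', hm', hup⟩, hlow⟩ := hN n hn.le
  have hn0 : 0 < n := (Nat.zero_le N).trans_lt hn
  have hn' : (0 : ℝ) < n := by exact_mod_cast hn0
  obtain ⟨hmem, hmin⟩ := hm n hn0 ε hε.1
  have hlog : ∀ k ∈ TreeCost.achievable T ψ n ε, ∀ f, n * (S f - δ) ≤ Real.logb 2 (k f) := by
    intro k hk f
    have hk0 : (0 : ℝ) < k f := by exact_mod_cast hk.1 f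
    rw [Real.le_logb_iff_rpow_le one_lt_two hk0]
    exact hlow f k hk
  have hlog' : ∀ f, Real.logb 2 (m' f) ≤ n * (S f + δ) := fun f => by
    have hk0 : (0 : ℝ) < m' f := by exact_mod_cast hm'.1 f
    rw [Real.logb_le_iff_le_rpow one_lt_two hk0]
    exact hup f
  have h1 : ∑ f, Real.logb 2 (m n ε f) ≤ ∑ f, n * (S f + δ) :=
    (hmin m' hm').trans (Finset.sum_le_sum fun f _ => hlog' f)
  -- Every term of the sum is nonnegative by the lower bound on each edge, so a single excess is at
  -- most the total.
  have h2 : Real.logb 2 (m n ε e) - n * (S e - δ) ≤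
      ∑ f, (Real.logb 2 (m n ε f) - n * (S f - δ)) :=
    Finset.single_le_sum (f := fun f => Real.logb 2 (m n ε f) - n * (S f - δ))
      (fun f _ => sub_nonneg.2 (hlog _ hmem f)) (Finset.mem_univ e)
  have h3 : ∑ f, n * (S f + δ) = ∑ f, n * (S f - δ) + K * (2 * (n * δ)) := by
    rw [← nsmul_eq_mul, ← Finset.card_univ, ← Finset.sum_const, ← Finset.sum_add_distrib]
    exact Finset.sum_congr rfl fun f _ => by ring
  rw [Finset.sum_sub_distrib] at h2
  have h4 := hlog _ hmem e
  have h5 : |Real.logb 2 (m n ε e) - n * S e| < n * r := by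
    have h6 : n * δ * (2 * K + 2) = n * r := by rw [mul_assoc, hδr]
    have h7 : 0 < n * δ := by positivity
    have h8 : 0 ≤ n * δ * K := by positivity
    rw [abs_lt]
    constructor <;> nlinarith
  rw [Real.dist_eq]
  have h6 : 1 / (n : ℝ) * Real.logb 2 (m n ε e) - S e
      = (Real.logb 2 (m n ε e) - n * S e) / n := by
    field_simp
  rw [h6, abs_div, abs_of_pos hn', div_lt_iff₀ hn', mul_comm r]
  exact h5
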